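/- For $N\ge 0$ and integers $\mu_1\ge\dots\ge\mu_N\ge 0$ let $$\chi_\mu(x_1,\dots,x_N)=\frac{\det\big[x_i^{\mu_j+N+1-j}-x_i^{-\mu_j-N-1+j}\big]_{i,j=1}^N}{\det\big[x_i^{N+1-j}-x_i^{-N-1+j}\big]_{i,j=1}^N}$$ be the symplectic character (a Laurent polynomial, extended by continuity to the zeros of the denominator in $(\mathbb C\setminus\{0\})^N$). Let $\lambda^L=(\lambda^L_1,\dots,\lambda^L_L)$, $\lambda^L_i=\lfloor (L-i)/2\rfloor$, put $\tau_L(z_1,\dots,z_L)=\chi_{\lambda^L}(z_1^2,\dots,z_L^2)$ and $$R_L(\zeta_1,\zeta_2;z_1,\dots,z_L)=\frac{\tau_{L+1}(\zeta_1,z_1,\dots,z_L)\,\tau_{L+1}(\zeta_2,z_1,\dots,z_L)}{\tau_L(z_1,\dots,z_L)\,\tau_{L+2}(\zeta_1,\zeta_2,z_1,\dots,z_L)},\qquad u_L=(-1)^L\,\mathbf i\frac{\sqrt3}{2}\,\ln R_L ,$$ $$X_L^{(j)}=z_j\frac{\partial}{\partial z_j}u_L(\zeta_1,\zeta_2;z_1,\dots,z_L),\qquad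 Y_L=w\frac{\partial}{\partial w}u_{L+2}(\zeta_1,\zeta_2;z_1,\dots,z_L,vq^{-1},w)\Big|_{v=w},$$ where the derivative of $\ln R$ is that of any local holomorphic branch, i.e. the logarithmic derivative of $R$. Let $x^{3/2}$ denote the principal branch. Call $x\in\mathbb C$ admissible if neither $x$ nor $x^{3/2}$ lies in $(-\infty,0]$. Call $x,y$ non-resonant if $x^{3/2}=y^{3/2}$ implies $x=y$, and $x^{3/2}y^{3/2}=1$ implies $xy=1$. (All of this holds automatically when $x,y\neq 0$ and $|\arg x|,|\arg y|<2\pi/3$.) **Theorem.** (a) Let $\zeta_1,\zeta_2,z\in\mathbb C$ with $\operatorname{Re}z>0$ be such that $z^2,\zeta_1^2,\zeta_2^2$ are admissible and pairwise non-resonant. Then for all sufficiently large $L$ and all $j=1,\dots,L$ the function $R_L$ is holomorphic in $z_j$ near, and non-zero at, the point $z_j=z$, $z_i=1$ ($i\ne j$), and as $L\to\infty$, uniformly in $j$, $$X_L^{(j)}\Big|_{z_j=z;\ z_i=1,\,i\neq j}=\frac{\mathbf i\sqrt3}{4L}\,(z^3-z^{-3})+o\Big(\frac1L\Big).$$ (b)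 Let $\zeta_1,\zeta_2,q,w\in\mathbb C$ with $q\ne0$, $\operatorname{Re}w>0$ be such that $w^2,(wq^{-1})^2,\zeta_1^2,\zeta_2^2$ are admissible and pairwise non-resonant. Then for all sufficiently large $L$ the function $R_{L+2}(\zeta_1,\zeta_2;1,\dots,1,wq^{-1},t)$ is holomorphic in $t$ near, and non-zero at, $t=w$, and as $L\to\infty$ $$Y_L\Big|_{z_i=1,\ i=1,\dots,L}=\frac{\mathbf i\sqrt3}{4L}\,(w^3-w^{-3})+o\Big(\frac1L\Big).$$ In particular the leading terms do not depend on $\zeta_1,\zeta_2$ (nor on $q$). -/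

import Mathlib

open Filter Topology

noncomputable section

namespace DenseLoop

/-- The alternant `det [x_i ^ (μ_j + N + 1 - j) - x_i ^ (-(μ_j + N + 1 - j))]`, `1 ≤ i, j ≤ N`
(with `j` counted from `0` in the code). -/
def alternant {N : ℕ} (μ : Fin N → ℕ) (x : Fin N → ℂ) : ℂ :=
  (Matrix.of fun i j : Fin N =>
    x i ^ (μ j + N - (j : ℕ)) - (x i)⁻¹ ^ (μ j + N - (j : ℕ))).det

/-- The symplectic character of `Sp(2N)` with signature `μ`, as a function of the eigenvalues
`x_1^{±1}, ..., x_N^{±1}`: the quotient of the alternants of `μ` and of the empty signature. The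
quotient is a Laurent polynomial; at the points of `(ℂ \ {0})^N` where the denominator vanishes
(such as `(1, ..., 1)`) its value is the one given by continuity. -/
def symplecticChar {N : ℕ} (μ : Fin N → ℕ) : (Fin N → ℂ) → ℂ :=
  extendFrom {x | alternant (fun _ => 0) x ≠ 0}
    (fun x => alternant μ x / alternant (fun _ => 0) x)

/-- The staircase signature `λ^L`, `λ^L_i = ⌊(L - i) / 2⌋` for `i = 1, ..., L`
(with `i` counted from `0` in the code). -/
def staircase (L : ℕ) : Fin L → ℕ := fun i => (L - 1 - (i : ℕ)) / 2

/-- `τ_L(z_1, ..., z_L) = χ_{λ^L}(z_1 ^ 2, ..., z_L ^ 2)`. -/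
def tau {L : ℕ} (z : Fin L → ℂ) : ℂ := symplecticChar (staircase L) (fun i => z i ^ 2)

/-- The argument of the logarithm in
`u_L = (-1)^L (i √3 / 2) ln [τ_{L+1}(ζ₁, z) τ_{L+1}(ζ₂, z) / (τ_L(z) τ_{L+2}(ζ₁, ζ₂, z))]`. -/
def ratio {L : ℕ} (ζ₁ ζ₂ : ℂ) (z : Fin L → ℂ) : ℂ :=
  (tau (Matrix.vecCons ζ₁ z) * tau (Matrix.vecCons ζ₂ z)) /
    (tau z * tau (Matrix.vecCons ζ₁ (Matrix.vecCons ζ₂ z)))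

/-- `X_L^{(j)} = z_j ∂u_L/∂z_j`. The derivative of a logarithm is the logarithmic derivative, for
every branch of the logarithm: see `horizontalCurrent_eq_of_branch`. -/
def horizontalCurrent {L : ℕ} (ζ₁ ζ₂ : ℂ) (z : Fin L → ℂ) (j : Fin L) : ℂ :=
  z j * ((-1) ^ L * (Complex.I * (Real.sqrt 3 / 2)) *
    logDeriv (fun t => ratio ζ₁ ζ₂ (Function.update z j t)) (z j))

/-- The point `(z_1, ..., z_L, a, b)`. -/
def append2 {L : ℕ} (z : Fin L → ℂ) (a b : ℂ) : Fin (L + 2) → ℂ :=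
  Fin.snoc (α := fun _ => ℂ) (Fin.snoc (α := fun _ => ℂ) z a) b

/-- `Y_L = w ∂/∂w u_{L+2}(ζ₁, ζ₂; z_1, ..., z_L, v q⁻¹, w)` at `v = w`; the derivative is taken in
the last variable only, at fixed `v`. -/
def verticalCurrent {L : ℕ} (ζ₁ ζ₂ q : ℂ) (z : Fin L → ℂ) (w : ℂ) : ℂ :=
  w * ((-1) ^ (L + 2) * (Complex.I * (Real.sqrt 3 / 2)) *
    logDeriv (fun t => ratio ζ₁ ζ₂ (append2 z (w * q⁻¹) t)) w)

/-- Whichever local branch `ℓ` of the logarithm of the ratio is used to form `u_L`, its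
derivative yields `horizontalCurrent`. -/
theorem horizontalCurrent_eq_of_branch {L : ℕ} (ζ₁ ζ₂ : ℂ) (z : Fin L → ℂ) (j : Fin L)
    (ℓ : ℂ → ℂ) (hd : DifferentiableAt ℂ ℓ (z j))
    (hℓ : ∀ᶠ t in 𝓝 (z j), Complex.exp (ℓ t) = ratio ζ₁ ζ₂ (Function.update z j t)) :
    horizontalCurrent ζ₁ ζ₂ z j =
      z j * deriv (fun t => (-1) ^ L * (Complex.I * (Real.sqrt 3 / 2)) * ℓ t) (z j) := by
  have h1 : deriv (fun t => ratio ζ₁ ζ₂ (Function.update z j t)) (z j) =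
      Complex.exp (ℓ (z j)) * deriv ℓ (z j) := by
    rw [← Filter.EventuallyEq.deriv_eq hℓ]
    exact (hd.hasDerivAt.cexp).deriv
  have h0 : Complex.exp (ℓ (z j)) = ratio ζ₁ ζ₂ (Function.update z j (z j)) := hℓ.self_of_nhds
  rw [horizontalCurrent, deriv_const_mul _ hd, logDeriv_apply, h1, ← h0,
    mul_div_cancel_left₀ _ (Complex.exp_ne_zero _)]

/-- The same for `verticalCurrent`. -/
theorem verticalCurrent_eq_of_branch {L : ℕ} (ζ₁ ζ₂ q : ℂ) (z : Fin L → ℂ) (w : ℂ)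
    (ℓ : ℂ → ℂ) (hd : DifferentiableAt ℂ ℓ w)
    (hℓ : ∀ᶠ t in 𝓝 w, Complex.exp (ℓ t) = ratio ζ₁ ζ₂ (append2 z (w * q⁻¹) t)) :
    verticalCurrent ζ₁ ζ₂ q z w =
      w * deriv (fun t => (-1) ^ (L + 2) * (Complex.I * (Real.sqrt 3 / 2)) * ℓ t) w := by
  have h1 : deriv (fun t => ratio ζ₁ ζ₂ (append2 z (w * q⁻¹) t)) w =
      Complex.exp (ℓ w) * deriv ℓ w := by
    rw [← Filter.EventuallyEq.deriv_eq hℓ]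
    exact (hd.hasDerivAt.cexp).deriv
  have h0 : Complex.exp (ℓ w) = ratio ζ₁ ζ₂ (append2 z (w * q⁻¹) w) := hℓ.self_of_nhds
  rw [verticalCurrent, deriv_const_mul _ hd, logDeriv_apply, h1, ← h0,
    mul_div_cancel_left₀ _ (Complex.exp_ne_zero _)]

/-- The principal branch of `x ^ (3/2)`, in terms of which the univariate asymptotics is
expressed. -/
def pow32 (x : ℂ) : ℂ := x ^ (3 / 2 : ℂ)

/-- `x` is in the domain of the univariate asymptotics: neither `x` nor `x ^ (3/2)` is a real
number `≤ 0`. -/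
def Admissible (x : ℂ) : Prop := x ∈ Complex.slitPlane ∧ pow32 x ∈ Complex.slitPlane

/-- `x ^ (3/2)` and `y ^ (3/2)` coincide, or are inverse to each other, only if the same is true
of `x` and `y`. -/
def NonResonant (x y : ℂ) : Prop :=
  (pow32 x = pow32 y → x = y) ∧ (pow32 x * pow32 y = 1 → x * y = 1)

end DenseLoop

end

noncomputable section

namespace DenseLoop

/-! Write z = e^{t/3} and Y = z + z⁻¹ = 2 cosh(t/3), so that X = z² + z⁻² = Y² - 2. The numerator of
the staircase character is the alternant with exponents 1, 2, 4, 5, 7, 8, ..., the positive integers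
prime to 3. Once the factors x - x⁻¹ are cancelled, numerator and denominator are alternants of
polynomials in X, and the denominator is a Vandermonde determinant (`symplecticChar_staircase`).

Setting m coordinates equal to 1 means X = 2, so one wants a triangular change of basis after which
the j-th polynomial vanishes to order j at X = 2. It is explicit: ∫₀ᵗ (cosh t - cosh r)^N cosh(κ r)
dr, with κ = 2/3 for even N and κ = 1/3 for odd N, is a combination of the functions sinh(2nt/3)
with n prime to 3 and |n| bounded by the N-th exponent, and it vanishes to order 2N + 1 at t = 0
(`stairSum_eq_sum`, `exists_stairSum_eq`). Hence τ with m ones and k further variables is a constant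
times a k × k alternant quotient (`exists_tau_eq`).

Watson's lemma shows that this integral, divided by its leading behaviour, is 1 + c_N (cosh t - 1) +
O(N⁻²) with c_N = (κ² - 1/4)/(2N + 3). The integral representation serves |Im t| < π; for π < |Im t|
< 3π/2 a three-term relation under shifts by πi adds only an exponentially small term
(`normAmp_estimate`). The k × k determinant is then a perturbed Vandermonde determinant in the
variables cosh t_i - 1. To first order only the coefficient of the last column survives, multiplied
by the sum of these variables (`vandermonde_det_estimate`). Coincident variables are reached by the
maximum principle on a polydisc (`reducedChar_estimate`).

In the cross ratio all leading factors, which involve one variable or a pair, drop out of the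
logarithmic derivative. What remains is (2c_{M+1} - c_M - c_{M+2}) times the derivative of cosh t -
1. Since c_N = (1/36 + (-1)^N/6)/(2N + 3), the non-oscillating parts cancel to leading order, while
the oscillating ones add up to (-1)^L/(3L), whose sign is undone by the one in u_L. With z ∂_z cosh
t = (3/2)(z³ - z⁻³) and the factor i√3/2 this gives the stated limit. -/

/-! ### Alternants divided by the Vandermonde determinant, as polynomials. -/

/-- Two continuous functions that agree at all points with pairwise distinct coordinates, none of
them equal to `a`, are equal. -/
theorem eq_of_eq_on_generic {n : ℕ} (a : ℂ) {f g : (Fin n → ℂ) → ℂ} (hf : Continuous f)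
    (hg : Continuous g)
    (h : ∀ x : Fin n → ℂ, Function.Injective x → (∀ i, x i ≠ a) → f x = g x) (x : Fin n → ℂ) :
    f x = g x := by
  -- The offsets i + 1 are non-zero and pairwise distinct, so each forbidden coincidence occurs for
  -- at most one ε.
  let y : ℂ → Fin n → ℂ := fun ε i => x i + ε * ((i : ℕ) + 1 : ℂ)
  have hy : Continuous y := by fun_prop
  have key : ∀ b c : ℂ, c ≠ 0 → ∀ᶠ ε in 𝓝[≠] (0 : ℂ), b + ε * c ≠ 0 := by
    intro b c hc
    have : ({-b / c} : Set ℂ)ᶜ ∪ {0} ∈ 𝓝 (0 : ℂ) := by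
      by_cases hb : b = 0
      · refine Filter.mem_of_superset Filter.univ_mem fun z _ => ?_
        by_cases hz : z = 0
        · right; exact hz
        · left; simpa [hb] using hz
      · refine Filter.mem_of_superset (isOpen_compl_singleton.mem_nhds ?_) Set.subset_union_left
        simp only [Set.mem_compl_iff, Set.mem_singleton_iff]
        intro h0
        exact (div_ne_zero (neg_ne_zero.2 hb) hc) h0.symm
    filter_upwards [mem_nhdsWithin_of_mem_nhds this, self_mem_nhdsWithin] with ε h1 h2 h3
    rcases h1 with h1 | h1
    · apply h1
      rw [Set.mem_singleton_iff, eq_div_iff hc]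
      linear_combination h3
    · exact h2 h1
  have e1 : ∀ᶠ ε in 𝓝[≠] (0 : ℂ), ∀ i j : Fin n, i ≠ j → y ε i ≠ y ε j := by
    refine Filter.eventually_all.2 fun i => Filter.eventually_all.2 fun j => ?_
    by_cases hij : i = j
    · simp [hij]
    · have : ((i : ℕ) : ℂ) - ((j : ℕ) : ℂ) ≠ 0 := by
        rw [sub_ne_zero]
        exact_mod_cast fun h => hij (Fin.ext h)
      filter_upwards [key (x i - x j) _ this] with ε hε _ h3
      apply hε
      simp only [y] at h3
      linear_combination h3
  have e2 : ∀ᶠ ε in 𝓝[≠] (0 : ℂ), ∀ i : Fin n, y ε i ≠ a := by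
    refine Filter.eventually_all.2 fun i => ?_
    have : ((i : ℕ) : ℂ) + 1 ≠ 0 := by exact_mod_cast Nat.succ_ne_zero (i : ℕ)
    filter_upwards [key (x i - a) _ this] with ε hε h3
    apply hε
    simp only [y] at h3
    linear_combination h3
  have ef : ∀ᶠ ε in 𝓝[≠] (0 : ℂ), f (y ε) = g (y ε) := by
    filter_upwards [e1, e2] with ε h1 h2
    exact h _ (fun i j hij => by_contra fun hne => h1 i j hne hij) h2
  have hy0 : y 0 = x := by ext i; simp [y]
  have lf : Tendsto (fun ε => f (y ε)) (𝓝[≠] (0 : ℂ)) (𝓝 (f x)) := by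
    have := (hf.comp hy).tendsto 0
    simp only [Function.comp, hy0] at this
    exact this.mono_left nhdsWithin_le_nhds
  have lg : Tendsto (fun ε => g (y ε)) (𝓝[≠] (0 : ℂ)) (𝓝 (g x)) := by
    have := (hg.comp hy).tendsto 0
    simp only [Function.comp, hy0] at this
    exact this.mono_left nhdsWithin_le_nhds
  exact tendsto_nhds_unique (lf.congr' ef) lg

/-- The matrix of values of a sequence of polynomials at `n` points. -/
def valueMatrix (g : ℕ → Polynomial ℂ) {n : ℕ} (x : Fin n → ℂ) : Matrix (Fin n) (Fin n) ℂ :=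
  Matrix.of fun i j => (g j).eval (x i)

/-- The Vandermonde determinant divides every alternant. -/
theorem exists_alternant_quotient (g : ℕ → Polynomial ℂ) (n : ℕ) :
    ∃ p : MvPolynomial (Fin n) ℂ, ∀ x : Fin n → ℂ,
      MvPolynomial.eval x p * (Matrix.vandermonde x).det = (valueMatrix g x).det := by
  let v : Fin n → MvPolynomial (Fin n) ℂ := MvPolynomial.X
  let w : Polynomial (MvPolynomial (Fin n) ℂ) := ∏ i, (Polynomial.X - Polynomial.C (v i))
  have hw : w.Monic := Polynomial.monic_prod_of_monic _ _ fun i _ => Polynomial.monic_X_sub_C _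
  have hwd : w.natDegree = n := by
    rw [Polynomial.natDegree_prod_of_monic _ _ fun i _ => Polynomial.monic_X_sub_C _]
    simp
  let G : ℕ → Polynomial (MvPolynomial (Fin n) ℂ) := fun j => (g j).map MvPolynomial.C
  -- Reduction modulo ∏ (X - x_i) keeps the values at every x_i and brings the degree below n. The
  -- value matrix thus factors as the Vandermonde matrix times a matrix of coefficients, whose
  -- determinant is the quotient.
  let r : ℕ → Polynomial (MvPolynomial (Fin n) ℂ) := fun j => G j %ₘ w
  have hr : ∀ i j, (r j).eval (v i) = (G j).eval (v i) := by
    intro i j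
    have h := congrArg (Polynomial.eval (v i)) (Polynomial.modByMonic_add_div (G j) w)
    have hz : w.eval (v i) = 0 := by
      rw [Polynomial.eval_prod]
      exact Finset.prod_eq_zero (Finset.mem_univ i) (by simp)
    rw [← h]
    simp [hz, r]
  have hd : ∀ j, 0 < n → (r j).natDegree < n := by
    intro j hn
    have := Polynomial.natDegree_modByMonic_lt (G j) hw (by
      intro h1
      rw [h1] at hwd
      simp at hwd
      omega)
    rwa [hwd] at this
  let A : Matrix (Fin n) (Fin n) (MvPolynomial (Fin n) ℂ) := Matrix.of fun k j => (r j).coeff k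
  have hm : Matrix.vandermonde v * A = Matrix.of fun i j : Fin n => (G j).eval (v i) := by
    ext1 i j
    rw [Matrix.mul_apply, Matrix.of_apply, ← hr,
      Polynomial.eval_eq_sum_range' (hd j i.pos), ← Fin.sum_univ_eq_sum_range
        (fun k => (r j).coeff k * v i ^ k)]
    refine Finset.sum_congr rfl fun k _ => ?_
    rw [Matrix.vandermonde_apply, mul_comm]
    rfl
  refine ⟨A.det, fun x => ?_⟩
  have h := congrArg (fun M => MvPolynomial.eval x (Matrix.det M)) hm
  simp only [Matrix.det_mul, map_mul] at h
  rw [mul_comm]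
  have h1 : MvPolynomial.eval x (Matrix.vandermonde v).det = (Matrix.vandermonde x).det := by
    rw [RingHom.map_det]
    congr 1
    ext i j
    simp [Matrix.vandermonde_apply, v]
  rw [h1] at h
  rw [h, RingHom.map_det]
  congr 1
  ext i j
  simp only [RingHom.mapMatrix_apply, Matrix.map_apply, Matrix.of_apply, valueMatrix, G,
    Polynomial.eval_map]
  rw [Polynomial.hom_eval₂]
  simp [v, Polynomial.eval₂_eq_eval_map, MvPolynomial.eval]

/-- The quotient of the alternant of `g 0, ..., g (n - 1)` by the Vandermonde determinant. -/
def altQuot (g : ℕ → Polynomial ℂ) (n : ℕ) : MvPolynomial (Fin n) ℂ :=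
  (exists_alternant_quotient g n).choose

theorem altQuot_mul (g : ℕ → Polynomial ℂ) {n : ℕ} (x : Fin n → ℂ) :
    MvPolynomial.eval x (altQuot g n) * (Matrix.vandermonde x).det = (valueMatrix g x).det :=
  (exists_alternant_quotient g n).choose_spec x

theorem continuous_altQuot (g : ℕ → Polynomial ℂ) (n : ℕ) :
    Continuous fun x : Fin n → ℂ => MvPolynomial.eval x (altQuot g n) :=
  MvPolynomial.continuous_eval _

theorem altQuot_perm (g : ℕ → Polynomial ℂ) {n : ℕ} (σ : Equiv.Perm (Fin n)) (x : Fin n → ℂ) :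
    MvPolynomial.eval (x ∘ σ) (altQuot g n) = MvPolynomial.eval x (altQuot g n) := by
  refine eq_of_eq_on_generic 0 (f := fun x => MvPolynomial.eval (x ∘ σ) (altQuot g n))
    ((continuous_altQuot g n).comp (by fun_prop)) (continuous_altQuot g n) ?_ x
  intro x hx _
  have hv := Matrix.det_vandermonde_ne_zero_iff.2 hx
  have h1 := altQuot_mul g (x ∘ σ)
  have h2 : (valueMatrix g (x ∘ σ)).det = Equiv.Perm.sign σ * (valueMatrix g x).det := by
    rw [← Matrix.det_permute σ]; rfl
  have h3 : (Matrix.vandermonde (x ∘ σ)).det =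
      Equiv.Perm.sign σ * (Matrix.vandermonde x).det := by
    rw [← Matrix.det_permute σ]; rfl
  rw [h2, h3, ← altQuot_mul g x] at h1
  have hs : ((Equiv.Perm.sign σ : ℤ) : ℂ) ≠ 0 := by
    rcases Int.units_eq_one_or (Equiv.Perm.sign σ) with h | h <;> simp [h]
  refine mul_right_cancel₀ (mul_ne_zero hs hv) ?_
  linear_combination h1

/-- A triangular change of basis multiplies the value matrix on the right by an upper triangular
matrix, whose determinant is the product of the diagonal coefficients. -/
theorem altQuot_triangular {g g' : ℕ → Polynomial ℂ} (A : ℕ → ℕ → ℂ)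
    (h : ∀ j, g' j = ∑ k ∈ Finset.range (j + 1), Polynomial.C (A k j) * g k) {n : ℕ}
    (x : Fin n → ℂ) :
    MvPolynomial.eval x (altQuot g' n) =
      (∏ j ∈ Finset.range n, A j j) * MvPolynomial.eval x (altQuot g n) := by
  refine eq_of_eq_on_generic 0 (continuous_altQuot g' n)
    (g := fun x => (∏ j ∈ Finset.range n, A j j) * MvPolynomial.eval x (altQuot g n))
    (continuous_const.mul (continuous_altQuot g n)) ?_ x
  intro x hx _
  refine mul_right_cancel₀ (Matrix.det_vandermonde_ne_zero_iff.2 hx) ?_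
  rw [mul_assoc, altQuot_mul, altQuot_mul]
  let T : Matrix (Fin n) (Fin n) ℂ := Matrix.of fun k j => if k ≤ j then A k j else 0
  have hT : T.det = ∏ j ∈ Finset.range n, A j j := by
    rw [Matrix.det_of_isUpperTriangular]
    · rw [← Fin.prod_univ_eq_prod_range (fun j => A j j)]
      simp [T]
    · intro i j hij
      simp only [id] at hij
      simp [T, hij]
  rw [← hT, mul_comm, ← Matrix.det_mul]
  congr 1
  ext i j
  rw [Matrix.mul_apply]
  simp only [valueMatrix, Matrix.of_apply, h, Polynomial.eval_finsetSum, Polynomial.eval_mul,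
    Polynomial.eval_C, T, mul_ite, mul_zero]
  have h1 : Finset.range (j + 1) ⊆ Finset.range n := by
    intro k hk
    simp only [Finset.mem_range] at hk ⊢
    omega
  refine Eq.symm (Eq.trans ?_ (Finset.sum_subset_zero_on_sdiff (s₂ := Finset.range n)
    (g := fun k => if k ≤ (j : ℕ) then (g k).eval (x i) * A k j else 0) h1 ?_ ?_).symm)
  · rw [← Fin.sum_univ_eq_sum_range
      (fun k => if k ≤ (j : ℕ) then (g k).eval (x i) * A k j else 0)]
    rfl
  · intro k hk
    simp only [Finset.mem_sdiff, Finset.mem_range] at hk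
    rw [if_neg (by omega)]
  · intro k hk
    simp only [Finset.mem_range] at hk
    rw [if_pos (by omega), mul_comm]

/-- In the row of the point a only the first entry survives. The factors x_i - a of the remaining
minor are exactly those by which the two Vandermonde determinants differ. Working with the
polynomial quotient makes this meaningful even when some x_i equals a, which is what repeated
peeling requires. -/
theorem altQuot_peel {g g' : ℕ → Polynomial ℂ} (a : ℂ)
    (h : ∀ j, g (j + 1) = (Polynomial.X - Polynomial.C a) * g' j) {n : ℕ} (x : Fin n → ℂ) :
    MvPolynomial.eval (Matrix.vecCons a x) (altQuot g (n + 1)) =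
      (g 0).eval a * MvPolynomial.eval x (altQuot g' n) := by
  refine eq_of_eq_on_generic a
    (f := fun x : Fin n → ℂ => MvPolynomial.eval (Matrix.vecCons a x) (altQuot g (n + 1)))
    (g := fun x => (g 0).eval a * MvPolynomial.eval x (altQuot g' n))
    ((continuous_altQuot g (n + 1)).comp (by fun_prop))
    (continuous_const.mul (continuous_altQuot g' n)) ?_ x
  intro x hx hxa
  have hv := Matrix.det_vandermonde_ne_zero_iff.2 hx
  have hP : ∏ i, (x i - a) ≠ 0 := Finset.prod_ne_zero_iff.2 fun i _ => sub_ne_zero.2 (hxa i)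
  have h1 := altQuot_mul g (Matrix.vecCons a x)
  have h2 : (Matrix.vandermonde (Matrix.vecCons a x)).det =
      (∏ i, (x i - a)) * (Matrix.vandermonde x).det := by
    rw [Matrix.det_vandermonde, Matrix.det_vandermonde, Fin.prod_univ_succ]
    congr 1
    · rw [Fin.prod_Ioi_zero]
      simp
    · refine Finset.prod_congr rfl fun i _ => ?_
      rw [Fin.prod_Ioi_succ]
      simp
  have h3 : (valueMatrix g (Matrix.vecCons a x)).det =
      (g 0).eval a * ((∏ i, (x i - a)) * (valueMatrix g' x).det) := by
    rw [Matrix.det_succ_row_zero, Finset.sum_eq_single 0]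
    · simp only [Fin.val_zero, pow_zero, one_mul, valueMatrix, Matrix.of_apply,
        Matrix.cons_val_zero]
      congr 1
      rw [← Matrix.det_mul_column]
      congr 1
      ext i j
      simp [h]
    · intro j _ hj
      obtain ⟨k, rfl⟩ := Fin.exists_succ_eq.2 hj
      simp [valueMatrix, h]
    · simp
  rw [h2, h3] at h1
  refine mul_right_cancel₀ (mul_ne_zero hP hv) ?_
  rw [h1, ← altQuot_mul g' x]
  ring

/-! ### Dependence on the multiset of coordinates, and repeated coordinates. -/

/-- The multiset of coordinates of a point. -/
def coords {n : ℕ} (x : Fin n → ℂ) : Multiset ℂ := Finset.univ.val.map x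

theorem card_coords {n : ℕ} (x : Fin n → ℂ) : (coords x).card = n := by
  simp [coords]

theorem coords_vecCons {n : ℕ} (a : ℂ) (x : Fin n → ℂ) :
    coords (Matrix.vecCons a x) = a ::ₘ coords x := by
  simp [coords, List.ofFn_succ]

theorem coords_snoc {n : ℕ} (x : Fin n → ℂ) (a : ℂ) :
    coords (Fin.snoc (α := fun _ => ℂ) x a : Fin (n + 1) → ℂ) = a ::ₘ coords x := by
  simp only [coords, Fin.univ_val_map, List.ofFn_succ_last, Fin.snoc_castSucc, Fin.snoc_last]
  rw [← Multiset.coe_add, add_comm]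
  simp

theorem coords_comp {n : ℕ} (f : ℂ → ℂ) (x : Fin n → ℂ) :
    coords (fun i => f (x i)) = (coords x).map f := by
  rw [coords, coords, Multiset.map_map]
  rfl

theorem coords_const (n : ℕ) (a : ℂ) : coords (fun _ : Fin n => a) = Multiset.replicate n a := by
  simp [coords]

theorem exists_coords_eq (s : Multiset ℂ) : ∃ x : Fin s.card → ℂ, coords x = s := by
  induction s using Quotient.inductionOn with
  | _ l =>
    refine ⟨l.get, ?_⟩
    change Multiset.map l.get (Finset.univ : Finset (Fin l.length)).val = l
    rw [Fin.univ_val_map, List.ofFn_get]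

theorem exists_perm_of_coords_eq {n : ℕ} {x y : Fin n → ℂ} (h : coords x = coords y) :
    ∃ σ : Equiv.Perm (Fin n), x = y ∘ σ := by
  classical
  have key : ∀ c, Nonempty ({i // x i = c} ≃ {i // y i = c}) := by
    intro c
    refine ⟨Fintype.equivOfCardEq ?_⟩
    rw [Fintype.card_subtype, Fintype.card_subtype]
    have := congrArg (Multiset.count c) h
    simp only [coords, Multiset.count_map] at this
    simp only [Finset.card, Finset.filter]
    simpa only [eq_comm] using this
  refine ⟨Equiv.ofFiberEquiv fun c => (key c).some, ?_⟩
  ext i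
  exact (Equiv.ofFiberEquiv_map (fun c => (key c).some) i).symm

theorem coords_update {n : ℕ} (x : Fin n → ℂ) (j : Fin n) (a : ℂ) :
    coords (Function.update x j a) + {x j} = a ::ₘ coords x := by
  classical
  have h : ∀ y : Fin n → ℂ, coords y = y j ::ₘ (Finset.univ.erase j).val.map y := by
    intro y
    rw [coords, ← Multiset.map_cons, Finset.erase_val, Multiset.cons_erase (Finset.mem_univ_val j)]
  rw [h (Function.update x j a), h x]
  have : (Finset.univ.erase j).val.map (Function.update x j a) = (Finset.univ.erase j).val.map x :=
    Multiset.map_congr rfl fun i hi => by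
      have : i ≠ j := by
        rintro rfl
        rw [Finset.mem_val] at hi
        exact Finset.notMem_erase i _ hi
      simp [this]
  rw [this]
  simp only [Function.update_self, Multiset.cons_add]
  rw [add_comm]
  rfl

theorem altQuot_eq_of_coords_eq (g : ℕ → Polynomial ℂ) {n : ℕ} {x y : Fin n → ℂ}
    (h : coords x = coords y) :
    MvPolynomial.eval x (altQuot g n) = MvPolynomial.eval y (altQuot g n) := by
  obtain ⟨σ, rfl⟩ := exists_perm_of_coords_eq h
  exact altQuot_perm g σ y

/-- Peeling off coordinates equal to `a`, when the `j`-th polynomial is divisible by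
`(X - a) ^ j`. -/
theorem altQuot_of_coords_eq_add_replicate (a : ℂ) (m : ℕ) {k : ℕ} (y : Fin k → ℂ) :
    ∀ (h : ℕ → Polynomial ℂ) {n : ℕ} (x : Fin n → ℂ),
      coords x = Multiset.replicate m a + coords y →
      MvPolynomial.eval x (altQuot (fun j => (Polynomial.X - Polynomial.C a) ^ j * h j) n) =
        (∏ l ∈ Finset.range m, (h l).eval a) *
          MvPolynomial.eval y
            (altQuot (fun j => (Polynomial.X - Polynomial.C a) ^ j * h (m + j)) k) := by
  induction m with
  | zero =>
    intro h n x hx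
    have hn : n = k := by simpa [card_coords] using congrArg Multiset.card hx
    subst hn
    rw [altQuot_eq_of_coords_eq _ (by simpa using hx)]
    simp
  | succ m ih =>
    intro h n x hx
    obtain ⟨x', hx'⟩ := exists_coords_eq (Multiset.replicate m a + coords y)
    have hn : n = (Multiset.replicate m a + coords y).card + 1 := by
      have := congrArg Multiset.card hx
      simp [card_coords] at this ⊢
      omega
    subst hn
    have hc : coords x = coords (Matrix.vecCons a x') := by
      rw [coords_vecCons, hx', hx, Multiset.replicate_succ, Multiset.cons_add]
    rw [altQuot_eq_of_coords_eq _ hc,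
      altQuot_peel (g' := fun j => (Polynomial.X - Polynomial.C a) ^ j * h (j + 1)) a
        (fun j => by ring), ih (fun j => h (j + 1)) x' hx', Finset.prod_range_succ', ← mul_assoc]
    congr 1
    · simp [mul_comm]
    · simp only [Nat.add_right_comm m _ 1]

/-! ### The staircase character as an alternant quotient of Chebyshev polynomials. -/

/-- The exponents `1, 2, 4, 5, 7, 8, ...` -/
def stairExp (k : ℕ) : ℕ := 3 * k / 2 + 1

theorem S_eval_add_inv {x : ℂ} (hx : x ≠ 0) (n : ℤ) :
    (x - x⁻¹) * (Polynomial.Chebyshev.S ℂ (n - 1)).eval (x + x⁻¹) = x ^ n - x ^ (-n) := by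
  induction n using Polynomial.Chebyshev.induct with
  | zero => simp
  | one => simp
  | add_two n ih1 ih0 =>
    have := Polynomial.Chebyshev.S_add_two ℂ ((n : ℤ) - 1)
    rw [show (n : ℤ) - 1 + 2 = n + 2 - 1 by ring, show (n : ℤ) - 1 + 1 = n + 1 - 1 by ring] at this
    rw [this]
    simp only [Polynomial.eval_sub, Polynomial.eval_mul, Polynomial.eval_X]
    rw [mul_sub, ih0, mul_left_comm, ih1]
    simp only [neg_add, zpow_add₀ hx, zpow_neg, zpow_ofNat]
    field_simp
    ring
  | neg_add_one n ih0 ih1 =>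
    have := Polynomial.Chebyshev.S_sub_two ℂ (-(n : ℤ) - 1 + 1)
    rw [show -(n : ℤ) - 1 + 1 - 2 = -n - 1 - 1 by ring,
      show -(n : ℤ) - 1 + 1 - 1 = -n - 1 by ring,
      show -(n : ℤ) - 1 + 1 = -n + 1 - 1 by ring] at this
    rw [this]
    simp only [Polynomial.eval_sub, Polynomial.eval_mul, Polynomial.eval_X]
    rw [mul_sub, ih1, mul_left_comm, ih0]
    simp only [neg_add, neg_sub, zpow_add₀ hx, zpow_sub₀ hx, zpow_neg, zpow_one, neg_neg]
    field_simp
    ring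

theorem S_monic (n : ℕ) : (Polynomial.Chebyshev.S ℂ n).natDegree = n ∧
    (Polynomial.Chebyshev.S ℂ n).Monic := by
  induction n using Nat.strong_induction_on with
  | _ n ih =>
    match n with
    | 0 => simp
    | 1 => simp [Polynomial.monic_X]
    | n + 2 =>
      obtain ⟨d1, m1⟩ := ih (n + 1) (by omega)
      obtain ⟨d0, m0⟩ := ih n (by omega)
      have h := Polynomial.Chebyshev.S_add_two ℂ n
      have hm : (Polynomial.X * Polynomial.Chebyshev.S ℂ (n + 1 : ℕ)).Monic :=
        Polynomial.monic_X.mul m1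
      have hd : (Polynomial.X * Polynomial.Chebyshev.S ℂ (n + 1 : ℕ)).natDegree = n + 2 := by
        rw [Polynomial.monic_X.natDegree_mul m1, d1, Polynomial.natDegree_X]
        omega
      push_cast at h hm hd ⊢
      rw [h]
      have hlt : (Polynomial.Chebyshev.S ℂ n).degree <
          (Polynomial.X * Polynomial.Chebyshev.S ℂ (n + 1)).degree := by
        rw [Polynomial.degree_eq_natDegree hm.ne_zero, Polynomial.degree_eq_natDegree m0.ne_zero,
          hd, d0]
        exact_mod_cast (by omega : n < n + 2)
      refine ⟨?_, hm.sub_of_left hlt⟩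
      rw [Polynomial.natDegree_sub_eq_left_of_natDegree_lt, hd]
      rw [hd, d0]
      omega

/-- An alternant with exponents `e 0, e 1, ...` in terms of Chebyshev polynomials. -/
theorem det_alternant_eq (e : ℕ → ℕ) {n : ℕ} {x : Fin n → ℂ} (hx : ∀ i, x i ≠ 0) :
    (Matrix.of fun i j : Fin n => x i ^ e j - (x i)⁻¹ ^ e j).det =
      (∏ i, (x i - (x i)⁻¹)) *
        (valueMatrix (fun k => Polynomial.Chebyshev.S ℂ ((e k : ℤ) - 1))
          (fun i => x i + (x i)⁻¹)).det := by
  rw [← Matrix.det_mul_column]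
  congr 1
  ext i j
  simp only [Matrix.of_apply, valueMatrix]
  rw [S_eval_add_inv (hx i)]
  simp

/-- Read backwards, the exponents no longer depend on n, so one sequence of polynomials serves all
sizes. The sign of the reversal is common to numerator and denominator. -/
theorem alternant_eq_sign_mul {n : ℕ} (μ : Fin n → ℕ) (e : ℕ → ℕ)
    (h : ∀ j : Fin n, μ j + n - j = e (Fin.rev j)) (x : Fin n → ℂ) :
    alternant μ x = Equiv.Perm.sign (Fin.revPerm : Equiv.Perm (Fin n)) *
      (Matrix.of fun i j : Fin n => x i ^ e j - (x i)⁻¹ ^ e j).det := by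
  rw [← Matrix.det_permute', alternant]
  congr 1
  ext i j
  simp [h]

theorem det_alternant_zero {n : ℕ} {x : Fin n → ℂ} (hx : ∀ i, x i ≠ 0) :
    (Matrix.of fun i j : Fin n => x i ^ ((j : ℕ) + 1) - (x i)⁻¹ ^ ((j : ℕ) + 1)).det =
      (∏ i, (x i - (x i)⁻¹)) * (Matrix.vandermonde fun i => x i + (x i)⁻¹).det := by
  rw [det_alternant_eq (fun k => k + 1) hx, Matrix.det_eval_matrixOfPolynomials_eq_det_vandermonde
    (fun i => x i + (x i)⁻¹) (fun k => Polynomial.Chebyshev.S ℂ ((k : ℕ) : ℤ))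
    (fun k => (S_monic k).1) (fun k => (S_monic k).2)]
  congr 2
  ext i j
  simp [valueMatrix]

/-- The alternant of the empty signature does not vanish on a dense set. -/
theorem mem_closure_alternant_ne_zero {n : ℕ} (x : Fin n → ℂ) :
    x ∈ closure {x : Fin n → ℂ | alternant (fun _ => 0) x ≠ 0} := by
  let y : ℂ → Fin n → ℂ := fun ε i => x i + ε * ((i : ℕ) + 1 : ℂ)
  have hy : Continuous y := by fun_prop
  have hy0 : y 0 = x := by ext i; simp [y]
  have key : ∀ p : Polynomial ℂ, p ≠ 0 → ∀ᶠ ε in 𝓝[≠] (0 : ℂ), p.eval ε ≠ 0 := by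
    intro p hp
    have hfin : (p.rootSet ℂ \ {0}).Finite := (Polynomial.rootSet_finite p ℂ).sdiff
    have : (p.rootSet ℂ \ {0})ᶜ ∈ 𝓝 (0 : ℂ) := hfin.isClosed.isOpen_compl.mem_nhds (by simp)
    filter_upwards [mem_nhdsWithin_of_mem_nhds this, self_mem_nhdsWithin] with ε h1 h2 h3
    exact h1 ⟨by simpa [Polynomial.mem_rootSet, hp] using h3, h2⟩
  have key2 : ∀ b c d e f : ℂ, b ≠ 0 → d ≠ 0 →
      ∀ᶠ ε in 𝓝[≠] (0 : ℂ), (c + ε * b) * (e + ε * d) ≠ f := by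
    intro b c d e f hb hd
    have hp : (Polynomial.C (b * d) * Polynomial.X ^ 2 + Polynomial.C (c * d + b * e) * Polynomial.X
        + Polynomial.C (c * e - f) : Polynomial ℂ) ≠ 0 := by
      intro h
      have := Polynomial.natDegree_quadratic (a := b * d) (b := c * d + b * e) (c := c * e - f)
        (mul_ne_zero hb hd)
      rw [h] at this
      simp at this
    filter_upwards [key _ hp] with ε h1 h2
    apply h1
    simp
    linear_combination h2
  have key1 : ∀ b c : ℂ, b ≠ 0 → ∀ᶠ ε in 𝓝[≠] (0 : ℂ), c + ε * b ≠ 0 := by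
    intro b c hb
    filter_upwards [key2 b c b c 0 hb hb] with ε h1 h2
    exact h1 (by rw [h2, zero_mul])
  have hi : ∀ i : Fin n, ((i : ℕ) : ℂ) + 1 ≠ 0 := fun i => by
    exact_mod_cast Nat.succ_ne_zero (i : ℕ)
  have e0 : ∀ᶠ ε in 𝓝[≠] (0 : ℂ), ∀ i, y ε i ≠ 0 :=
    Filter.eventually_all.2 fun i => key1 _ _ (hi i)
  -- The case i = j excludes the zeros of x - x⁻¹; the cases i ≠ j, together with `e2`, exclude
  -- coincidences of x + x⁻¹.
  have e1 : ∀ᶠ ε in 𝓝[≠] (0 : ℂ), ∀ i j, y ε i * y ε j ≠ 1 :=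
    Filter.eventually_all.2 fun i => Filter.eventually_all.2 fun j => key2 _ _ _ _ _ (hi i) (hi j)
  have e2 : ∀ᶠ ε in 𝓝[≠] (0 : ℂ), ∀ i j, i ≠ j → y ε i ≠ y ε j := by
    refine Filter.eventually_all.2 fun i => Filter.eventually_all.2 fun j => ?_
    by_cases hij : i = j
    · simp [hij]
    · have : ((i : ℕ) : ℂ) - ((j : ℕ) : ℂ) ≠ 0 := by
        rw [sub_ne_zero]
        exact_mod_cast fun h => hij (Fin.ext h)
      filter_upwards [key1 _ (x i - x j) this] with ε hε _ h3
      apply hε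
      simp only [y] at h3
      linear_combination h3
  have ht : Tendsto y (𝓝[≠] (0 : ℂ)) (𝓝 x) := by
    have := hy.tendsto 0
    rw [hy0] at this
    exact this.mono_left nhdsWithin_le_nhds
  refine mem_closure_of_tendsto ht ?_
  filter_upwards [e0, e1, e2] with ε h0 h1 h2
  change alternant (fun _ => 0) (y ε) ≠ 0
  rw [alternant_eq_sign_mul _ (fun k => k + 1)
    (fun j => by simp only [Fin.val_rev]; omega), det_alternant_zero h0]
  refine mul_ne_zero ?_ (mul_ne_zero ?_ ?_)
  · rcases Int.units_eq_one_or (Equiv.Perm.sign (Fin.revPerm : Equiv.Perm (Fin n))) with h | h <;>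
      simp [h]
  · refine Finset.prod_ne_zero_iff.2 fun i _ h => h1 i i ?_
    have := h0 i
    field_simp at h
    linear_combination h
  · refine Matrix.det_vandermonde_ne_zero_iff.2 fun i j hij => by_contra fun hne => ?_
    have hi := h0 i
    have hj := h0 j
    have : (y ε i - y ε j) * (y ε i * y ε j - 1) = 0 := by
      field_simp at hij
      linear_combination hij
    rcases mul_eq_zero.1 this with h | h
    · exact h2 i j hne (sub_eq_zero.1 h)
    · exact h1 i j (sub_eq_zero.1 h)

/-- The polynomials whose alternant is the numerator of `τ`. -/
def stairPoly (k : ℕ) : Polynomial ℂ := Polynomial.Chebyshev.S ℂ ((stairExp k : ℤ) - 1)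

/-- Where the denominator is non-zero, the sign and the product of the x_i - x_i⁻¹ cancel. The
resulting polynomial in x + x⁻¹ is continuous away from zero coordinates, and density of the good
set makes it the value of the continuous extension. -/
theorem symplecticChar_staircase {n : ℕ} {x : Fin n → ℂ} (hx : ∀ i, x i ≠ 0) :
    symplecticChar (staircase n) x =
      MvPolynomial.eval (fun i => x i + (x i)⁻¹) (altQuot stairPoly n) := by
  refine extendFrom_eq (mem_closure_alternant_ne_zero x) ?_
  have hc : Tendsto (fun x : Fin n → ℂ =>
      MvPolynomial.eval (fun i => x i + (x i)⁻¹) (altQuot stairPoly n))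
      (𝓝[{x | alternant (fun _ => 0) x ≠ 0}] x)
      (𝓝 (MvPolynomial.eval (fun i => x i + (x i)⁻¹) (altQuot stairPoly n))) := by
    refine Tendsto.mono_left ?_ nhdsWithin_le_nhds
    refine ((continuous_altQuot stairPoly n).tendsto _).comp ?_
    refine tendsto_pi_nhds.2 fun i => ?_
    have h1 : Tendsto (fun y : Fin n → ℂ => y i) (𝓝 x) (𝓝 (x i)) :=
      (continuous_apply i).tendsto x
    exact h1.add (h1.inv₀ (hx i))
  refine hc.congr' ?_
  have hne : ∀ᶠ y in 𝓝[{x | alternant (fun _ => 0) x ≠ 0}] x, ∀ i, y i ≠ 0 := by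
    refine Filter.eventually_all.2 fun i => ?_
    exact mem_nhdsWithin_of_mem_nhds (((continuous_apply i).tendsto x).eventually_ne (hx i))
  filter_upwards [hne, self_mem_nhdsWithin] with y hy hA
  change alternant (fun _ => 0) y ≠ 0 at hA
  rw [alternant_eq_sign_mul _ (fun k => k + 1)
    (fun j => by simp only [Fin.val_rev]; omega), det_alternant_zero hy] at hA
  rw [alternant_eq_sign_mul (staircase n) stairExp
      (fun j => by simp only [Fin.val_rev, stairExp, staircase]; omega),
    alternant_eq_sign_mul _ (fun k => k + 1) (fun j => by simp only [Fin.val_rev]; omega),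
    det_alternant_zero hy, det_alternant_eq stairExp hy, ← altQuot_mul]
  rw [mul_ne_zero_iff, mul_ne_zero_iff] at hA
  obtain ⟨h1, h2, h3⟩ := hA
  rw [eq_div_iff (by simp [h1, h2, h3])]
  change _ = _ * (_ * (MvPolynomial.eval _ (altQuot stairPoly n) * _))
  ring

/-! ### Sums of hyperbolic sines and their primitives. -/

/-- The coefficients of `∫ r in 0..t, (cosh t - cosh r) ^ N * cosh (κ r)` as a sum of hyperbolic
sines. -/
def sinhCoeff (κ : ℂ) : ℕ → ℕ → ℂ
  | 0, i => if i = 0 then κ⁻¹ else 0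
  | N + 1, i => (N + 1) / (2 * (2 * i - (N + 1) + κ)) *
      ((if i = 0 then 0 else sinhCoeff κ N (i - 1)) - sinhCoeff κ N i)

/-- The sum of hyperbolic sines equal to
`∫ r in 0..t, (cosh t - cosh r) ^ N * cosh (κ r)`. -/
def sinhSum (κ : ℂ) (N : ℕ) (t : ℂ) : ℂ :=
  ∑ i ∈ Finset.range (N + 1), sinhCoeff κ N i * Complex.sinh ((2 * i - N + κ) * t)

theorem sinhCoeff_eq_zero (κ : ℂ) {N i : ℕ} (h : N < i) : sinhCoeff κ N i = 0 := by
  induction N generalizing i with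
  | zero => simp [sinhCoeff]; omega
  | succ N ih =>
    rw [sinhCoeff, if_neg (by omega), ih (by omega), ih (by omega)]
    simp

theorem sinhCoeff_self_ne_zero {κ : ℂ} (hκ : ∀ j : ℤ, (j : ℂ) + κ ≠ 0) (N : ℕ) :
    sinhCoeff κ N N ≠ 0 := by
  induction N with
  | zero => simpa [sinhCoeff] using hκ 0
  | succ N ih =>
    rw [sinhCoeff, if_neg (by omega), sinhCoeff_eq_zero κ (Nat.lt_succ_self N), sub_zero]
    refine mul_ne_zero (div_ne_zero (by exact_mod_cast Nat.succ_ne_zero N) ?_) (by simpa using ih)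
    refine mul_ne_zero two_ne_zero ?_
    have := hκ (N + 1)
    push_cast at this ⊢
    convert this using 1
    ring

theorem sinhSum_zero_right (κ : ℂ) (N : ℕ) : sinhSum κ N 0 = 0 := by
  simp [sinhSum]

theorem hasDerivAt_sinh_mul (a t : ℂ) :
    HasDerivAt (fun t => Complex.sinh (a * t)) (a * Complex.cosh (a * t)) t := by
  have := ((hasDerivAt_id t).const_mul a).csinh
  simpa [mul_comm] using this

theorem hasDerivAt_sinhSum_zero {κ : ℂ} (hκ : κ ≠ 0) (t : ℂ) :
    HasDerivAt (sinhSum κ 0) (Complex.cosh (κ * t)) t := by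
  have : sinhSum κ 0 = fun t => κ⁻¹ * Complex.sinh (κ * t) := by
    ext t; simp [sinhSum, sinhCoeff]
  rw [this]
  convert! (hasDerivAt_sinh_mul κ t).const_mul κ⁻¹ using 1
  field_simp

/-- Apply 2 sinh t sinh(bt) = cosh((b+1)t) - cosh((b-1)t) termwise. The recursion in `sinhCoeff` is
this identity integrated, which requires the frequencies to be non-zero, hence κ not an integer. -/
theorem hasDerivAt_sinhSum_succ {κ : ℂ} (hκ : ∀ j : ℤ, (j : ℂ) + κ ≠ 0) (N : ℕ) (t : ℂ) :
    HasDerivAt (sinhSum κ (N + 1)) ((N + 1) * Complex.sinh t * sinhSum κ N t) t := by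
  have h1 : HasDerivAt (sinhSum κ (N + 1)) (∑ i ∈ Finset.range (N + 1 + 1),
      sinhCoeff κ (N + 1) i * ((2 * i - (N + 1 : ℕ) + κ) *
        Complex.cosh ((2 * i - (N + 1 : ℕ) + κ) * t))) t := by
    have := HasDerivAt.fun_sum (u := Finset.range (N + 1 + 1)) (x := t)
      (A := fun (i : ℕ) (t : ℂ) =>
        sinhCoeff κ (N + 1) i * Complex.sinh ((2 * i - (N + 1 : ℕ) + κ) * t))
      (fun i _ => (hasDerivAt_sinh_mul (2 * i - (N + 1 : ℕ) + κ) t).const_mul _)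
    exact this
  convert! h1 using 1
  have h2 : ∀ i : ℕ, sinhCoeff κ (N + 1) i * ((2 * i - (N + 1 : ℕ) + κ) *
        Complex.cosh ((2 * i - (N + 1 : ℕ) + κ) * t)) =
      (N + 1) / 2 * ((if i = 0 then 0 else sinhCoeff κ N (i - 1)) *
        Complex.cosh ((2 * i - (N + 1 : ℕ) + κ) * t)) -
      (N + 1) / 2 * (sinhCoeff κ N i * Complex.cosh ((2 * i - (N + 1 : ℕ) + κ) * t)) := by
    intro i
    have h3 : (2 * (i : ℂ) - ((N + 1 : ℕ) : ℂ) + κ) ≠ 0 := by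
      have := hκ (2 * i - (N + 1))
      push_cast at this ⊢
      exact this
    rw [sinhCoeff]
    push_cast at h3 ⊢
    field_simp
  rw [Finset.sum_congr rfl fun i _ => h2 i, Finset.sum_sub_distrib, Finset.sum_range_succ',
    Finset.sum_range_succ (fun i => (N + 1 : ℂ) / 2 * (sinhCoeff κ N i *
      Complex.cosh ((2 * i - (N + 1 : ℕ) + κ) * t)))]
  simp only [if_true, zero_mul, mul_zero, add_zero, sinhCoeff_eq_zero κ (Nat.lt_succ_self N),
    Nat.succ_ne_zero, if_false, Nat.add_sub_cancel, ← Finset.sum_sub_distrib]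
  rw [sinhSum, Finset.mul_sum]
  refine Finset.sum_congr rfl fun i _ => ?_
  have e1 : (2 * ((i + 1 : ℕ) : ℂ) - ((N + 1 : ℕ) : ℂ) + κ) * t = (2 * i - N + κ) * t + t := by
    push_cast; ring
  have e2 : (2 * (i : ℂ) - ((N + 1 : ℕ) : ℂ) + κ) * t = (2 * i - N + κ) * t - t := by
    push_cast; ring
  rw [e1, e2, Complex.cosh_add, Complex.cosh_sub]
  ring

/-- A primitive of `(a - cosh r) ^ N` against the differential of `sinhSum κ M`. -/
theorem exists_primitive {κ : ℂ} (hκ : ∀ j : ℤ, (j : ℂ) + κ ≠ 0) (a : ℂ) (N : ℕ) :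
    ∀ M : ℕ, ∃ T : ℂ → ℂ,
      (∀ r, HasDerivAt T ((a - Complex.cosh r) ^ N * deriv (sinhSum κ M) r) r) ∧ T 0 = 0 ∧
        ∀ t, Complex.cosh t = a → T t * (M + N).choose N = sinhSum κ (M + N) t := by
  induction N with
  | zero =>
    intro M
    refine ⟨sinhSum κ M, fun r => ?_, sinhSum_zero_right κ M, fun t _ => by simp⟩
    rw [pow_zero, one_mul]
    cases M with
    | zero => exact (hasDerivAt_sinhSum_zero (by simpa using hκ 0) r).differentiableAt.hasDerivAt
    | succ M => exact (hasDerivAt_sinhSum_succ hκ M r).differentiableAt.hasDerivAt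
  | succ N ih =>
    intro M
    obtain ⟨T, hT, hT0, hTt⟩ := ih (M + 1)
    have hM : ((M : ℂ) + 1) ≠ 0 := by exact_mod_cast Nat.succ_ne_zero M
    -- Integration by parts: since `sinhSum κ (M + 1)` has derivative (M + 1) sinh r times `sinhSum
    -- κ M`, one power of a - cosh r is traded for one step in M. The boundary term vanishes where
    -- cosh t = a.
    refine ⟨fun r => (a - Complex.cosh r) ^ (N + 1) * sinhSum κ M r + (N + 1) / (M + 1) * T r,
      fun r => ?_, by simp [hT0, sinhSum_zero_right], fun t ht => ?_⟩
    · have hd : HasDerivAt (sinhSum κ M) (deriv (sinhSum κ M) r) r := by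
        cases M with
        | zero =>
          exact (hasDerivAt_sinhSum_zero (by simpa using hκ 0) r).differentiableAt.hasDerivAt
        | succ M => exact (hasDerivAt_sinhSum_succ hκ M r).differentiableAt.hasDerivAt
      have h1 := ((((Complex.hasDerivAt_cosh r).const_sub a).pow (N + 1)).mul hd).add
        ((hT r).const_mul (((N : ℂ) + 1) / (M + 1)))
      rw [(hasDerivAt_sinhSum_succ hκ M r).deriv] at h1
      convert! h1 using 1
      simp only [Nat.add_sub_cancel, Pi.pow_apply]
      push_cast
      field_simp
      ring
    · have h2 := hTt t ht
      have e : M + 1 + N = M + (N + 1) := by ring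
      rw [e] at h2
      simp only [ht, sub_self, ne_eq, Nat.succ_ne_zero, not_false_eq_true, zero_pow, zero_mul,
        zero_add]
      rw [← h2]
      have h3 := Nat.choose_succ_right_eq (M + (N + 1)) N
      rw [show M + (N + 1) - N = M + 1 by omega] at h3
      have h4 : ((M + (N + 1)).choose (N + 1) : ℂ) * (N + 1) =
          (M + (N + 1)).choose N * (M + 1) := by exact_mod_cast h3
      field_simp
      linear_combination (T t) * h4

/-! ### The principal inverse hyperbolic sine and the integral representation. -/

/-- The principal square root of `1 + w ^ 2`. -/
def coshArsinh (w : ℂ) : ℂ := (1 + w ^ 2) ^ (2⁻¹ : ℂ)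

/-- The principal branch of the inverse hyperbolic sine. -/
def carsinh (w : ℂ) : ℂ := Complex.log (w + coshArsinh w)

/-- The plane cut along `±i [1, ∞)`. -/
def arsinhDomain : Set ℂ := {w | 1 + w ^ 2 ∈ Complex.slitPlane}

theorem isOpen_arsinhDomain : IsOpen arsinhDomain :=
  Complex.isOpen_slitPlane.preimage (by fun_prop)

theorem zero_mem_arsinhDomain : (0 : ℂ) ∈ arsinhDomain := by
  simp [arsinhDomain]

theorem smul_mem_arsinhDomain {w : ℂ} (hw : w ∈ arsinhDomain) {τ : ℝ} (h0 : 0 ≤ τ) (h1 : τ ≤ 1) :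
    w * τ ∈ arsinhDomain := by
  change 1 + w ^ 2 ∈ Complex.slitPlane at hw
  change 1 + (w * τ) ^ 2 ∈ Complex.slitPlane
  rw [Complex.mem_slitPlane_iff] at hw ⊢
  have e : (w * τ) ^ 2 = ((τ ^ 2 : ℝ) : ℂ) * w ^ 2 := by push_cast; ring
  have hτ : 0 ≤ τ ^ 2 := by positivity
  have hτ1 : τ ^ 2 ≤ 1 := by nlinarith
  rw [e]
  simp only [Complex.add_re, Complex.one_re, Complex.add_im, Complex.one_im, zero_add,
    Complex.re_ofReal_mul, Complex.im_ofReal_mul] at hw ⊢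
  rcases eq_or_lt_of_le hτ with h | h
  · left; rw [← h]; simp
  · rcases hw with hw | hw
    · left; nlinarith
    · right; exact mul_ne_zero h.ne' hw

theorem coshArsinh_sq (w : ℂ) : coshArsinh w ^ 2 = 1 + w ^ 2 := by
  rw [coshArsinh, ← Complex.cpow_nat_mul]
  simp

theorem coshArsinh_neg (w : ℂ) : coshArsinh (-w) = coshArsinh w := by
  simp [coshArsinh]

theorem coshArsinh_zero : coshArsinh 0 = 1 := by
  simp [coshArsinh]

theorem coshArsinh_re_pos {w : ℂ} (hw : w ∈ arsinhDomain) : 0 < (coshArsinh w).re := by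
  have h0 : 1 + w ^ 2 ≠ 0 := Complex.slitPlane_ne_zero hw
  have ha := Complex.mem_slitPlane_iff_arg.1 hw
  rw [coshArsinh, Complex.cpow_def_of_ne_zero h0, Complex.exp_re]
  refine mul_pos (Real.exp_pos _) (Real.cos_pos_of_mem_Ioo ?_)
  have e : (Complex.log (1 + w ^ 2) * 2⁻¹).im = Complex.arg (1 + w ^ 2) / 2 := by
    rw [show (2⁻¹ : ℂ) = ((2⁻¹ : ℝ) : ℂ) by push_cast; rfl, Complex.im_mul_ofReal, Complex.log_im]
    ring
  rw [e]
  have h1 := Complex.neg_pi_lt_arg (1 + w ^ 2)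
  have h2 := lt_of_le_of_ne (Complex.arg_le_pi (1 + w ^ 2)) ha.1
  constructor <;> linarith

theorem coshArsinh_ne_zero {w : ℂ} (hw : w ∈ arsinhDomain) : coshArsinh w ≠ 0 := by
  intro h
  have := coshArsinh_re_pos hw
  simp [h] at this

theorem add_coshArsinh_mul (w : ℂ) : (w + coshArsinh w) * (coshArsinh w - w) = 1 := by
  linear_combination coshArsinh_sq w

/-- The numbers s + w and s - w, with s = `coshArsinh w`, are mutually inverse. If one of them lay
on (-∞, 0], both would have non-positive real part, contradicting Re s > 0 for half their sum. -/
theorem add_coshArsinh_mem {w : ℂ} (hw : w ∈ arsinhDomain) :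
    w + coshArsinh w ∈ Complex.slitPlane := by
  have hs := coshArsinh_re_pos hw
  have hm := add_coshArsinh_mul w
  rw [Complex.mem_slitPlane_iff]
  by_contra! hc
  obtain ⟨h1, h2⟩ := hc
  have hr := congrArg Complex.re hm
  rw [Complex.mul_re, h2] at hr
  simp only [Complex.add_re, Complex.sub_re, Complex.one_re, zero_mul, sub_zero] at hr h1
  nlinarith

theorem exp_carsinh {w : ℂ} (hw : w ∈ arsinhDomain) :
    Complex.exp (carsinh w) = w + coshArsinh w :=
  Complex.exp_log (Complex.slitPlane_ne_zero (add_coshArsinh_mem hw))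

theorem exp_neg_carsinh {w : ℂ} (hw : w ∈ arsinhDomain) :
    Complex.exp (-carsinh w) = coshArsinh w - w := by
  rw [Complex.exp_neg, exp_carsinh hw]
  exact inv_eq_of_mul_eq_one_right (add_coshArsinh_mul w)

theorem sinh_carsinh {w : ℂ} (hw : w ∈ arsinhDomain) : Complex.sinh (carsinh w) = w := by
  rw [Complex.sinh, exp_carsinh hw, exp_neg_carsinh hw]
  ring

theorem carsinh_zero : carsinh 0 = 0 := by
  simp [carsinh, coshArsinh]

theorem carsinh_neg {w : ℂ} (hw : w ∈ arsinhDomain) : carsinh (-w) = -carsinh w := by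
  have h := add_coshArsinh_mem hw
  rw [carsinh, coshArsinh_neg, carsinh, ← Complex.log_inv _ (Complex.mem_slitPlane_iff_arg.1 h).1]
  congr 1
  rw [eq_comm, inv_eq_iff_eq_inv, eq_comm]
  apply inv_eq_of_mul_eq_one_left
  linear_combination add_coshArsinh_mul w

theorem hasDerivAt_coshArsinh {w : ℂ} (hw : w ∈ arsinhDomain) :
    HasDerivAt coshArsinh (w / coshArsinh w) w := by
  have hd : DifferentiableAt ℂ coshArsinh w := by
    unfold coshArsinh
    refine DifferentiableAt.cpow (by fun_prop) (by fun_prop) hw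
  have h1 := (hd.hasDerivAt.pow 2)
  have h2 : HasDerivAt (fun w : ℂ => 1 + w ^ 2) (2 * w) w := by
    have := ((hasDerivAt_id w).pow 2).const_add 1
    simpa using this
  have e : coshArsinh ^ 2 = fun w : ℂ => 1 + w ^ 2 := by
    ext w; exact coshArsinh_sq w
  rw [e] at h1
  have h3 := h1.unique h2
  have h0 := coshArsinh_ne_zero hw
  have h4 : deriv coshArsinh w = w / coshArsinh w := by
    rw [eq_div_iff h0]
    simp at h3
    linear_combination h3 / 2
  rw [← h4]
  exact hd.hasDerivAt

theorem hasDerivAt_carsinh {w : ℂ} (hw : w ∈ arsinhDomain) :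
    HasDerivAt carsinh (coshArsinh w)⁻¹ w := by
  have h0 := coshArsinh_ne_zero hw
  have h1 := add_coshArsinh_mem hw
  have h2 := ((hasDerivAt_id w).add (hasDerivAt_coshArsinh hw)).clog h1
  have h3 := Complex.slitPlane_ne_zero h1
  convert! h2 using 1
  simp only [id, Pi.add_apply]
  field_simp
  ring

theorem sq_mem_slitPlane {c : ℂ} (hc : 0 < c.re) : c ^ 2 ∈ Complex.slitPlane := by
  rw [Complex.mem_slitPlane_iff]
  simp only [pow_two, Complex.mul_re, Complex.mul_im]
  by_cases h : c.im = 0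
  · left; rw [h]; nlinarith
  · right
    intro h2
    have : c.re * c.im = 0 := by linarith
    rcases mul_eq_zero.1 this with h3 | h3
    · exact hc.ne' h3
    · exact h h3

theorem cosh_re_pos {u : ℂ} (h : |u.im| < Real.pi / 2) : 0 < (Complex.cosh u).re := by
  have : (Complex.cosh u).re = Real.cosh u.re * Real.cos u.im := by
    conv_lhs => rw [← Complex.re_add_im u, Complex.cosh_add, Complex.cosh_mul_I, Complex.sinh_mul_I]
    rw [← Complex.ofReal_cosh, ← Complex.ofReal_cos, ← Complex.ofReal_sinh, ← Complex.ofReal_sin]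
    simp only [Complex.add_re, ← mul_assoc, ← Complex.ofReal_mul, Complex.ofReal_re,
      Complex.re_ofReal_mul, Complex.I_re, mul_zero, add_zero]
  rw [this]
  rw [abs_lt] at h
  exact mul_pos (Real.cosh_pos _) (Real.cos_pos_of_mem_Ioo ⟨by linarith, h.2⟩)

theorem sinh_mem_arsinhDomain {u : ℂ} (h : |u.im| < Real.pi / 2) :
    Complex.sinh u ∈ arsinhDomain := by
  change 1 + Complex.sinh u ^ 2 ∈ Complex.slitPlane
  rw [add_comm, ← Complex.cosh_sq]
  exact sq_mem_slitPlane (cosh_re_pos h)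

theorem coshArsinh_sinh {u : ℂ} (h : |u.im| < Real.pi / 2) :
    coshArsinh (Complex.sinh u) = Complex.cosh u := by
  rw [coshArsinh, add_comm, ← Complex.cosh_sq, Complex.sq_cpow_two_inv (cosh_re_pos h)]

theorem carsinh_sinh {u : ℂ} (h : |u.im| < Real.pi / 2) : carsinh (Complex.sinh u) = u := by
  rw [carsinh, coshArsinh_sinh h, add_comm, Complex.cosh_add_sinh, Complex.log_exp]
  · have := (abs_lt.1 h).1
    linarith [Real.pi_pos]
  · have := (abs_lt.1 h).2
    linarith [Real.pi_pos]

/-- The amplitude of the integral representation in the variable `sinh (r / 2)`. -/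
def amp (κ w : ℂ) : ℂ := Complex.cosh (2 * κ * carsinh w) / coshArsinh w

theorem continuousOn_amp (κ : ℂ) : ContinuousOn (amp κ) arsinhDomain := by
  intro w hw
  have h1 := (hasDerivAt_carsinh hw).continuousAt
  have h2 := (hasDerivAt_coshArsinh hw).continuousAt
  refine ContinuousAt.continuousWithinAt (ContinuousAt.div ?_ h2 (coshArsinh_ne_zero hw))
  exact Complex.continuous_cosh.continuousAt.comp (h1.const_mul _)

theorem continuousOn_amp_mul (κ : ℂ) {q : ℂ} (hq : q ∈ arsinhDomain) :
    ContinuousOn (fun τ : ℝ => amp κ (q * τ)) (Set.Icc 0 1) :=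
  (continuousOn_amp κ).comp (by fun_prop) fun _ hτ => smul_mem_arsinhDomain hq hτ.1 hτ.2

/-- The integral representation of `sinhSum`. -/
theorem sinhSum_eq_integral {κ : ℂ} (hκ : ∀ j : ℤ, (j : ℂ) + κ ≠ 0) (N : ℕ) {t : ℂ}
    (ht : |t.im| < Real.pi) :
    sinhSum κ N t = 2 * (2 * Complex.sinh (t / 2) ^ 2) ^ N * Complex.sinh (t / 2) *
      ∫ τ in (0 : ℝ)..1, ((1 - τ ^ 2 : ℝ) : ℂ) ^ N * amp κ (Complex.sinh (t / 2) * τ) := by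
  have hu : |(t / 2).im| < Real.pi / 2 := by
    have : (t / 2).im = t.im / 2 := by simp
    rw [this, abs_div, abs_two]
    linarith
  set q := Complex.sinh (t / 2) with hqdef
  have hq : q ∈ arsinhDomain := sinh_mem_arsinhDomain hu
  obtain ⟨T, hT, hT0, hTt⟩ := exists_primitive hκ (Complex.cosh t) N 0
  have hcosh : ∀ u : ℂ, Complex.cosh (2 * u) = 1 + 2 * Complex.sinh u ^ 2 := by
    intro u
    rw [Complex.cosh_two_mul, Complex.cosh_sq]
    ring
  have hct : Complex.cosh t = 1 + 2 * q ^ 2 := by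
    rw [← hcosh, mul_div_cancel₀ _ two_ne_zero]
  -- The substitution sinh(r/2) = qτ turns cosh t - cosh r into 2q²(1 - τ²) and dr into 2q dτ /
  -- cosh(r/2).
  have hderiv : ∀ τ ∈ Set.uIcc (0 : ℝ) 1, HasDerivAt (fun τ : ℝ => T (2 * carsinh (q * τ)))
      (2 * (2 * q ^ 2) ^ N * q * (((1 - τ ^ 2 : ℝ) : ℂ) ^ N * amp κ (q * τ))) τ := by
    intro τ hτ
    rw [Set.uIcc_of_le zero_le_one] at hτ
    have hd := smul_mem_arsinhDomain hq hτ.1 hτ.2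
    have h1 : HasDerivAt (fun z : ℂ => q * z) q (τ : ℂ) := by
      simpa using (hasDerivAt_id (τ : ℂ)).const_mul q
    have h2 := ((hasDerivAt_carsinh hd).comp (τ : ℂ) h1).const_mul 2
    have h3 := ((hT (2 * carsinh (q * τ))).comp (τ : ℂ) h2).comp_ofReal
    convert! h3 using 1
    rw [(hasDerivAt_sinhSum_zero (by simpa using hκ 0) _).deriv, hcosh, sinh_carsinh hd, hct, amp]
    have : (1 + 2 * q ^ 2 - (1 + 2 * (q * τ) ^ 2) : ℂ) = 2 * q ^ 2 * ((1 - τ ^ 2 : ℝ) : ℂ) := by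
      push_cast; ring
    rw [this, mul_pow, show κ * (2 * carsinh (q * τ)) = 2 * κ * carsinh (q * τ) by ring]
    ring
  have hcont : ContinuousOn (fun τ : ℝ =>
      2 * (2 * q ^ 2) ^ N * q * (((1 - τ ^ 2 : ℝ) : ℂ) ^ N * amp κ (q * τ))) (Set.Icc 0 1) := by
    have h1 : ContinuousOn (fun τ : ℝ => ((1 - τ ^ 2 : ℝ) : ℂ) ^ N) (Set.Icc 0 1) := by fun_prop
    exact continuousOn_const.mul (h1.mul (continuousOn_amp_mul κ hq))
  have hint := intervalIntegral.integral_eq_sub_of_hasDerivAt hderiv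
    (ContinuousOn.intervalIntegrable (by rwa [Set.uIcc_of_le zero_le_one]))
  rw [intervalIntegral.integral_const_mul] at hint
  rw [hint]
  have h4 := hTt t rfl
  have h5 : 2 * carsinh (q * (1 : ℝ)) = t := by
    rw [Complex.ofReal_one, mul_one, hqdef, carsinh_sinh hu]
    ring
  rw [h5]
  simp only [zero_add, Nat.choose_self, Nat.cast_one, mul_one] at h4
  simp [h4, carsinh_zero, hT0]

/-! ### Watson's lemma for the normalized integral. -/

/-- The moments of the weight `(1 - τ ^ 2) ^ N` on `[0, 1]`. -/
def moment (j N : ℕ) : ℝ := ∫ τ in (0 : ℝ)..1, τ ^ j * (1 - τ ^ 2) ^ N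

/-- Integrate the derivative of τ^(j+1) (1 - τ²)^(N+1) over [0, 1]: both boundary terms vanish. -/
theorem moment_add_two (j N : ℕ) : (2 * N + j + 3) * moment (j + 2) N = (j + 1) * moment j N := by
  have h1 : ∀ τ ∈ Set.uIcc (0 : ℝ) 1, HasDerivAt (fun τ : ℝ => τ ^ (j + 1) * (1 - τ ^ 2) ^ (N + 1))
      ((j + 1) * (τ ^ j * (1 - τ ^ 2) ^ N) -
        (2 * N + j + 3) * (τ ^ (j + 2) * (1 - τ ^ 2) ^ N)) τ := by
    intro τ _
    have h2 := (hasDerivAt_pow (j + 1) τ).mul (((hasDerivAt_pow 2 τ).const_sub 1).pow (N + 1))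
    convert! h2 using 1
    simp only [Nat.add_sub_cancel, Pi.pow_apply]
    push_cast
    ring
  have h3 := intervalIntegral.integral_eq_sub_of_hasDerivAt h1
    (Continuous.intervalIntegrable (by fun_prop) _ _)
  rw [intervalIntegral.integral_sub (Continuous.intervalIntegrable (by fun_prop) _ _)
    (Continuous.intervalIntegrable (by fun_prop) _ _), intervalIntegral.integral_const_mul,
    intervalIntegral.integral_const_mul] at h3
  simp only [ne_eq, Nat.succ_ne_zero, not_false_eq_true, zero_pow, zero_mul, one_pow, sub_self,
    mul_zero] at h3
  rw [moment, moment]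
  linarith

theorem moment_zero_pos (N : ℕ) : 0 < moment 0 N := by
  rw [moment]
  refine intervalIntegral.intervalIntegral_pos_of_pos_on
    (Continuous.intervalIntegrable (by fun_prop) _ _) ?_ zero_lt_one
  intro τ hτ
  have : τ ^ 2 < 1 := by nlinarith [hτ.1, hτ.2]
  simp only [pow_zero, one_mul]
  exact pow_pos (by linarith) N

theorem moment_two (N : ℕ) : moment 2 N = moment 0 N / (2 * N + 3) := by
  have := moment_add_two 0 N
  rw [eq_div_iff (by positivity)]
  push_cast at this
  linarith

theorem moment_four_le (N : ℕ) : moment 4 N ≤ moment 0 N / (N + 1) ^ 2 := by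
  have h := moment_add_two 2 N
  rw [moment_two] at h
  have h0 := moment_zero_pos N
  push_cast at h
  have e : moment 4 N = 3 * moment 0 N / ((2 * N + 3) * (2 * N + 5)) := by
    rw [eq_div_iff (by positivity)]
    field_simp at h
    linarith
  rw [e, div_le_div_iff₀ (by positivity) (by positivity)]
  have : 3 * ((N : ℝ) + 1) ^ 2 ≤ (2 * N + 3) * (2 * N + 5) := by
    nlinarith [(Nat.cast_nonneg N : (0 : ℝ) ≤ N)]
  nlinarith

theorem dslope_neg_of_odd {f : ℂ → ℂ} {w : ℂ} (h0 : f 0 = 0) (hf : f (-w) = -f w) :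
    dslope f 0 (-w) = dslope f 0 w := by
  by_cases hw : w = 0
  · simp [hw]
  · rw [dslope_of_ne _ (neg_ne_zero.2 hw), dslope_of_ne _ hw]
    simp [slope_def_field, h0, hf]

theorem eq_add_mul_dslope (f : ℂ → ℂ) (w : ℂ) : f w = f 0 + w * dslope f 0 w := by
  have := sub_smul_dslope f 0 w
  simp only [sub_zero, smul_eq_mul] at this
  rw [this]
  ring

/-- The expansion of the amplitude at the origin, with a continuous remainder. -/
theorem exists_amp_eq (κ : ℂ) : ∃ R : ℂ → ℂ, ContinuousOn R arsinhDomain ∧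
    ∀ w ∈ arsinhDomain, amp κ w = 1 + (2 * κ ^ 2 - 1 / 2) * w ^ 2 + w ^ 4 * R w := by
  have hnhds : arsinhDomain ∈ 𝓝 (0 : ℂ) := isOpen_arsinhDomain.mem_nhds zero_mem_arsinhDomain
  let S : ℂ → ℂ := fun w => Complex.sinh (κ * carsinh w)
  have hS0 : S 0 = 0 := by simp [S, carsinh_zero]
  have hSd : ∀ w ∈ arsinhDomain, HasDerivAt S
      (Complex.cosh (κ * carsinh w) * (κ * (coshArsinh w)⁻¹)) w := fun w hw =>
    ((hasDerivAt_carsinh hw).const_mul κ).csinh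
  have hSD : DifferentiableOn ℂ S arsinhDomain := fun w hw =>
    (hSd w hw).differentiableAt.differentiableWithinAt
  let D := dslope S 0
  have hD : DifferentiableOn ℂ D arsinhDomain := (Complex.differentiableOn_dslope hnhds).2 hSD
  have hD0 : D 0 = κ := by
    have := (hSd 0 zero_mem_arsinhDomain).deriv
    simp only [D, dslope_same, this]
    simp [carsinh_zero, coshArsinh_zero]
  -- From cosh 2u = 1 + 2 sinh² u and 1/s = 1 - w²/(s(1 + s)), valid because s² - 1 = w², the
  -- amplitude is 1 + w² G(w).
  let G : ℂ → ℂ := fun w =>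
    2 * D w ^ 2 / coshArsinh w - 1 / (coshArsinh w * (1 + coshArsinh w))
  have hs1 : ∀ w ∈ arsinhDomain, 1 + coshArsinh w ≠ 0 := by
    intro w hw h
    have h1 := coshArsinh_re_pos hw
    have h2 := congrArg Complex.re h
    simp at h2
    linarith
  have hsD : DifferentiableOn ℂ coshArsinh arsinhDomain := fun w hw =>
    (hasDerivAt_coshArsinh hw).differentiableAt.differentiableWithinAt
  have hG : DifferentiableOn ℂ G arsinhDomain := by
    refine DifferentiableOn.sub (DifferentiableOn.div ((hD.pow 2).const_mul 2) hsD fun w hw =>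
      coshArsinh_ne_zero hw) (DifferentiableOn.div (differentiableOn_const _)
      (hsD.mul (hsD.const_add 1)) fun w hw => mul_ne_zero (coshArsinh_ne_zero hw) (hs1 w hw))
  have hG0 : G 0 = 2 * κ ^ 2 - 1 / 2 := by
    simp only [G, hD0, coshArsinh_zero]
    norm_num
  have hGeven : ∀ w ∈ arsinhDomain, G (-w) = G w := by
    intro w hw
    have : D (-w) = D w := dslope_neg_of_odd hS0 (by simp [S, carsinh_neg hw])
    simp only [G, this, coshArsinh_neg]
  let G1 := dslope G 0
  have hG1 : DifferentiableOn ℂ G1 arsinhDomain := (Complex.differentiableOn_dslope hnhds).2 hG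
  -- G is even, so there is no cubic term and the remainder starts at w⁴.
  have hG10 : G1 0 = 0 := by
    have hd : DifferentiableAt ℂ G 0 := hG.differentiableAt hnhds
    have h1 : HasDerivAt (fun w => G (-w)) (-deriv G 0) 0 := by
      have h2 : HasDerivAt G (deriv G 0) (-0) := by simpa using hd.hasDerivAt
      have h5 := h2.scomp (0 : ℂ) (hasDerivAt_neg (0 : ℂ))
      rw [neg_one_smul] at h5
      exact h5
    have h2 : (fun w => G (-w)) =ᶠ[𝓝 0] G := by
      filter_upwards [hnhds] with w hw using hGeven w hw
    have h3 := (h1.congr_of_eventuallyEq h2.symm).unique hd.hasDerivAt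
    simp only [G1, dslope_same]
    have h4 : 2 * deriv G 0 = 0 := by linear_combination -h3
    simpa using h4
  refine ⟨dslope G1 0, ((Complex.differentiableOn_dslope hnhds).2 hG1).continuousOn, ?_⟩
  intro w hw
  have e1 : G w = 2 * κ ^ 2 - 1 / 2 + w ^ 2 * dslope G1 0 w := by
    rw [eq_add_mul_dslope G w, hG0]
    change _ + w * G1 w = _
    rw [eq_add_mul_dslope G1 w, hG10]
    ring
  have e2 : Complex.sinh (κ * carsinh w) = w * D w := by
    have := eq_add_mul_dslope S w
    rw [hS0, zero_add] at this
    exact this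
  have e3 : amp κ w = 1 + w ^ 2 * G w := by
    have h0 := coshArsinh_ne_zero hw
    have h1 := hs1 w hw
    rw [amp, mul_assoc, Complex.cosh_two_mul, Complex.cosh_sq, e2]
    simp only [G]
    field_simp
    linear_combination -(coshArsinh_sq w)
  rw [e3, e1]
  ring

/-- The normalized integral in the representation of `sinhSum`. -/
def ampMean (κ : ℂ) (N : ℕ) (q : ℂ) : ℂ :=
  (∫ τ in (0 : ℝ)..1, ((1 - τ ^ 2 : ℝ) : ℂ) ^ N * amp κ (q * τ)) / moment 0 N

theorem sinhSum_eq_ampMean {κ : ℂ} (hκ : ∀ j : ℤ, (j : ℂ) + κ ≠ 0) (N : ℕ) {t : ℂ}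
    (ht : |t.im| < Real.pi) :
    sinhSum κ N t = 2 * moment 0 N * (2 * Complex.sinh (t / 2) ^ 2) ^ N * Complex.sinh (t / 2) *
      ampMean κ N (Complex.sinh (t / 2)) := by
  have : (moment 0 N : ℂ) ≠ 0 := by exact_mod_cast (moment_zero_pos N).ne'
  rw [sinhSum_eq_integral hκ N ht, ampMean]
  field_simp

/-- Watson's lemma for `ampMean`, uniformly on compact sets. -/
theorem ampMean_estimate (κ : ℂ) {Q : Set ℂ} (hQ : IsCompact Q) (hQd : Q ⊆ arsinhDomain) :
    ∃ C : ℝ, 0 ≤ C ∧ ∀ q ∈ Q, ∀ N : ℕ,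
      ‖ampMean κ N q - 1 - (2 * κ ^ 2 - 1 / 2) / (2 * N + 3) * q ^ 2‖ ≤
        C * ‖q‖ ^ 4 / (N + 1) ^ 2 := by
  obtain ⟨R, hR, hamp⟩ := exists_amp_eq κ
  have hK : IsCompact ((fun p : ℂ × ℝ => p.1 * (p.2 : ℂ)) '' (Q ×ˢ Set.Icc (0 : ℝ) 1)) :=
    (hQ.prod isCompact_Icc).image (by fun_prop)
  have hKd : (fun p : ℂ × ℝ => p.1 * (p.2 : ℂ)) '' (Q ×ˢ Set.Icc (0 : ℝ) 1) ⊆ arsinhDomain := by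
    rintro _ ⟨⟨q, τ⟩, ⟨hq, hτ⟩, rfl⟩
    exact smul_mem_arsinhDomain (hQd hq) hτ.1 hτ.2
  obtain ⟨C, hC⟩ := hK.exists_bound_of_continuousOn (hR.mono hKd)
  refine ⟨max C 0, le_max_right _ _, fun q hq N => ?_⟩
  have hm0 := moment_zero_pos N
  have hm0' : (moment 0 N : ℂ) ≠ 0 := by exact_mod_cast hm0.ne'
  have hcast : ∀ j : ℕ, (∫ τ in (0 : ℝ)..1, (τ : ℂ) ^ j * ((1 - τ ^ 2 : ℝ) : ℂ) ^ N) =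
      (moment j N : ℂ) := by
    intro j
    rw [moment, ← intervalIntegral.integral_ofReal]
    push_cast
    rfl
  have hi1 : IntervalIntegrable (fun τ : ℝ => ((1 - τ ^ 2 : ℝ) : ℂ) ^ N * amp κ (q * τ))
      MeasureTheory.volume 0 1 := by
    refine ContinuousOn.intervalIntegrable ?_
    rw [Set.uIcc_of_le zero_le_one]
    exact ContinuousOn.mul (by fun_prop) (continuousOn_amp_mul κ (hQd hq))
  have hi2 : ∀ (j : ℕ) (c : ℂ), IntervalIntegrable
      (fun τ : ℝ => c * ((τ : ℂ) ^ j * ((1 - τ ^ 2 : ℝ) : ℂ) ^ N)) MeasureTheory.volume 0 1 :=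
    fun j c => Continuous.intervalIntegrable (by fun_prop) _ _
  -- The terms 1 and w² of the amplitude integrate to `moment 0 N` and `moment 2 N`, whose quotient
  -- produces the denominator 2N + 3; only the quartic remainder is left.
  have key : ampMean κ N q - 1 - (2 * κ ^ 2 - 1 / 2) / (2 * N + 3) * q ^ 2 =
      (∫ τ in (0 : ℝ)..1, q ^ 4 * ((τ : ℂ) ^ 4 * ((1 - τ ^ 2 : ℝ) : ℂ) ^ N * R (q * τ))) /
        moment 0 N := by
    have e1 : (∫ τ in (0 : ℝ)..1, q ^ 4 * ((τ : ℂ) ^ 4 * ((1 - τ ^ 2 : ℝ) : ℂ) ^ N * R (q * τ))) =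
        ∫ τ in (0 : ℝ)..1, (((1 - τ ^ 2 : ℝ) : ℂ) ^ N * amp κ (q * τ) -
          1 * ((τ : ℂ) ^ 0 * ((1 - τ ^ 2 : ℝ) : ℂ) ^ N) -
          ((2 * κ ^ 2 - 1 / 2) * q ^ 2) * ((τ : ℂ) ^ 2 * ((1 - τ ^ 2 : ℝ) : ℂ) ^ N)) := by
      refine intervalIntegral.integral_congr fun τ hτ => ?_
      rw [Set.uIcc_of_le zero_le_one] at hτ
      rw [hamp _ (smul_mem_arsinhDomain (hQd hq) hτ.1 hτ.2)]
      ring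
    rw [e1, intervalIntegral.integral_sub (hi1.sub (hi2 0 1)) (hi2 2 _),
      intervalIntegral.integral_sub hi1 (hi2 0 1), intervalIntegral.integral_const_mul,
      intervalIntegral.integral_const_mul, hcast, hcast, moment_two, ampMean]
    have : (2 * (N : ℂ) + 3) ≠ 0 := by exact_mod_cast (by positivity : (2 * (N : ℝ) + 3) ≠ 0)
    generalize (∫ τ in (0 : ℝ)..1, ((1 - τ ^ 2 : ℝ) : ℂ) ^ N * amp κ (q * τ)) = I
    push_cast
    field_simp
  rw [key, intervalIntegral.integral_const_mul, norm_div, norm_mul, Complex.norm_real,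
    Real.norm_of_nonneg hm0.le, norm_pow]
  have hb : ‖∫ τ in (0 : ℝ)..1, (τ : ℂ) ^ 4 * ((1 - τ ^ 2 : ℝ) : ℂ) ^ N * R (q * τ)‖ ≤
      ∫ τ in (0 : ℝ)..1, max C 0 * (τ ^ 4 * (1 - τ ^ 2) ^ N) := by
    refine intervalIntegral.norm_integral_le_of_norm_le zero_le_one ?_
      (Continuous.intervalIntegrable (by fun_prop) _ _)
    refine Filter.Eventually.of_forall fun τ hτ => ?_
    have hτ' : τ ∈ Set.Icc (0 : ℝ) 1 := ⟨hτ.1.le, hτ.2⟩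
    have h1 : ‖R (q * τ)‖ ≤ max C 0 := (hC _ ⟨(q, τ), ⟨hq, hτ'⟩, rfl⟩).trans (le_max_left _ _)
    have h2 : 0 ≤ 1 - τ ^ 2 := by nlinarith [hτ'.1, hτ'.2]
    rw [norm_mul, norm_mul, norm_pow, norm_pow, Complex.norm_real, Complex.norm_real,
      Real.norm_of_nonneg hτ'.1, Real.norm_of_nonneg h2, mul_comm (max C 0)]
    exact mul_le_mul_of_nonneg_left h1 (mul_nonneg (pow_nonneg hτ'.1 _) (pow_nonneg h2 _))
  rw [intervalIntegral.integral_const_mul] at hb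
  change _ ≤ _ * moment 4 N at hb
  have hm4 := moment_four_le N
  have hC0 : 0 ≤ max C 0 := le_max_right _ _
  calc ‖q‖ ^ 4 * _ / moment 0 N ≤ ‖q‖ ^ 4 * (max C 0 * (moment 0 N / (N + 1) ^ 2)) / moment 0 N := by
        gcongr
        exact hb.trans (mul_le_mul_of_nonneg_left hm4 hC0)
    _ = max C 0 * ‖q‖ ^ 4 / (N + 1) ^ 2 := by
        field_simp

/-! ### The staircase basis vanishing to high order at X = 2. -/

/-- The order of the hyperbolic sines attached to the staircase of length `N + 1`. -/
def stairOrder (N : ℕ) : ℂ := if Even N then 2 / 3 else 1 / 3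

theorem int_add_stairOrder_ne_zero (N : ℕ) (j : ℤ) : (j : ℂ) + stairOrder N ≠ 0 := by
  intro h
  rw [stairOrder] at h
  split_ifs at h
  · have h1 : (3 * (j : ℂ) + 2) = 0 := by linear_combination 3 * h
    have h2 : 3 * j + 2 = 0 := by exact_mod_cast h1
    omega
  · have h1 : (3 * (j : ℂ) + 1) = 0 := by linear_combination 3 * h
    have h2 : 3 * j + 1 = 0 := by exact_mod_cast h1
    omega

theorem two_mul_stairExp (N : ℕ) : (2 * stairExp N : ℂ) = 3 * N + 3 * stairOrder N := by
  rw [stairOrder]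
  split_ifs with h
  · obtain ⟨n, rfl⟩ := h
    have : stairExp (n + n) = 3 * n + 1 := by rw [stairExp]; omega
    rw [this]
    push_cast
    ring
  · obtain ⟨n, rfl⟩ := Nat.not_even_iff_odd.1 h
    have : stairExp (2 * n + 1) = 3 * n + 2 := by rw [stairExp]; omega
    rw [this]
    push_cast
    ring

/-- The polynomial whose value at `2 cosh (2 t / 3)` is
`sinhSum (stairOrder N) N t / sinh (2 t / 3)`. -/
def stairSum (N : ℕ) : Polynomial ℂ :=
  ∑ i ∈ Finset.range (N + 1), Polynomial.C (sinhCoeff (stairOrder N) N i) *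
    Polynomial.Chebyshev.S ℂ ((stairExp N : ℤ) - 3 * (N - i) - 1)

theorem sinh_mul_stairSum_eval (N : ℕ) (t : ℂ) :
    Complex.sinh (2 * t / 3) * (stairSum N).eval (2 * Complex.cosh (2 * t / 3)) =
      sinhSum (stairOrder N) N t := by
  have hx := Complex.exp_ne_zero (2 * t / 3)
  have h1 : Complex.exp (2 * t / 3) + (Complex.exp (2 * t / 3))⁻¹ =
      2 * Complex.cosh (2 * t / 3) := by
    rw [← Complex.exp_neg, Complex.cosh]; ring
  have h2 : Complex.exp (2 * t / 3) - (Complex.exp (2 * t / 3))⁻¹ =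
      2 * Complex.sinh (2 * t / 3) := by
    rw [← Complex.exp_neg, Complex.sinh]; ring
  rw [stairSum, Polynomial.eval_finsetSum, Finset.mul_sum, sinhSum]
  refine Finset.sum_congr rfl fun i _ => ?_
  rw [Polynomial.eval_mul, Polynomial.eval_C, mul_left_comm]
  congr 1
  have h3 := S_eval_add_inv hx ((stairExp N : ℤ) - 3 * (N - i))
  rw [h1, h2, ← Complex.exp_int_mul, ← Complex.exp_int_mul] at h3
  have h4 : (2 * i - N + stairOrder N) * t =
      (((stairExp N : ℤ) - 3 * (N - i) : ℤ) : ℂ) * (2 * t / 3) := by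
    have := two_mul_stairExp N
    push_cast
    linear_combination -(t / 3) * this
  rw [h4]
  have h5 : ((-((stairExp N : ℤ) - 3 * (N - i)) : ℤ) : ℂ) * (2 * t / 3) =
      -((((stairExp N : ℤ) - 3 * (N - i) : ℤ) : ℂ) * (2 * t / 3)) := by
    push_cast; ring
  rw [h5] at h3
  have h6 : ∀ u, Complex.sinh u = (Complex.exp u - Complex.exp (-u)) / 2 := fun _ => rfl
  linear_combination h3 / 2 - h6 ((((stairExp N : ℤ) - 3 * (N - i) : ℤ) : ℂ) * (2 * t / 3))

/-- The position of the exponent `|m|` in the sequence `1, 2, 4, 5, ...` -/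
def stairIdx (m : ℤ) : ℕ := (2 * m.natAbs - 1) / 3

/-- Chebyshev polynomials of negative index fold back onto positive index with a minus sign, and |m|
is a staircase exponent exactly because 3 does not divide m. -/
theorem S_eq_stairPoly {m : ℤ} (hm : ¬ (3 : ℤ) ∣ m) :
    Polynomial.Chebyshev.S ℂ (m - 1) = Polynomial.C (m.sign : ℂ) * stairPoly (stairIdx m) := by
  have h1 : stairExp (stairIdx m) = m.natAbs := by
    rw [stairExp, stairIdx]
    have h2 : m.natAbs % 3 = 1 ∨ m.natAbs % 3 = 2 := by omega
    obtain ⟨j, hj | hj⟩ : ∃ j, m.natAbs = 3 * j + 1 ∨ m.natAbs = 3 * j + 2 :=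
      ⟨m.natAbs / 3, by omega⟩ <;> rw [hj] <;> omega
  rw [stairPoly, h1]
  rcases lt_trichotomy m 0 with h | h | h
  · have h2 : m = -(m.natAbs : ℤ) := by omega
    rw [Int.sign_eq_neg_one_of_neg h]
    conv_lhs => rw [h2]
    rw [Polynomial.Chebyshev.S_neg_sub_one]
    simp
  · omega
  · have h2 : (m.natAbs : ℤ) = m := by omega
    rw [Int.sign_eq_one_of_pos h, h2]
    simp

/-- The matrix expressing `stairSum` in terms of `stairPoly`. -/
def stairMatrix (k N : ℕ) : ℂ :=
  ∑ i ∈ Finset.range (N + 1),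
    if stairIdx ((stairExp N : ℤ) - 3 * (N - i)) = k then
      sinhCoeff (stairOrder N) N i * (((stairExp N : ℤ) - 3 * (N - i)).sign : ℂ) else 0

theorem stairIdx_self (N : ℕ) : stairIdx (stairExp N : ℤ) = N := by
  rw [stairIdx, stairExp]
  omega

/-- The frequencies run in steps of 3 from `stairExp N - 3 * N`, which is greater than `-stairExp
N`, up to `stairExp N`. Only the last one attains the largest absolute value, which makes the change
of basis triangular. -/
theorem stairIdx_lt {N i : ℕ} (h : i < N) :
    stairIdx ((stairExp N : ℤ) - 3 * (N - i)) < N := by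
  rw [stairIdx, stairExp]
  omega

theorem stairMatrix_self_ne_zero (N : ℕ) : stairMatrix N N ≠ 0 := by
  rw [stairMatrix, Finset.sum_eq_single N]
  · have h : 0 < (stairExp N : ℤ) := by rw [stairExp]; omega
    simp only [sub_self, mul_zero, sub_zero, stairIdx_self, if_true, Int.sign_eq_one_of_pos h]
    simpa using sinhCoeff_self_ne_zero (int_add_stairOrder_ne_zero N) N
  · intro i hi hiN
    have : i < N := by
      have := Finset.mem_range.1 hi
      omega
    rw [if_neg (stairIdx_lt this).ne]
  · intro h
    simp at h

theorem stairSum_eq_sum (N : ℕ) : stairSum N =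
    ∑ k ∈ Finset.range (N + 1), Polynomial.C (stairMatrix k N) * stairPoly k := by
  simp only [stairMatrix, map_sum, Finset.sum_mul]
  rw [Finset.sum_comm, stairSum]
  refine Finset.sum_congr rfl fun i hi => ?_
  have hi' := Finset.mem_range.1 hi
  have h3 : ¬ (3 : ℤ) ∣ (stairExp N : ℤ) - 3 * (N - i) := by
    rw [stairExp]
    omega
  rw [Finset.sum_eq_single (stairIdx ((stairExp N : ℤ) - 3 * (N - i)))]
  · rw [if_pos rfl, S_eq_stairPoly h3, map_mul, mul_assoc]
  · intro k _ hk
    rw [if_neg hk.symm]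
    simp
  · intro h
    exfalso
    apply h
    rw [Finset.mem_range]
    rcases lt_or_eq_of_le (Nat.lt_succ_iff.1 hi') with h | h
    · exact (stairIdx_lt h).trans (Nat.lt_succ_self N)
    · rw [h, sub_self, mul_zero, sub_zero, stairIdx_self]
      exact Nat.lt_succ_self N

/-! ### The variable Y = 2 cosh(t/3) and the order of the zero at X = 2. -/

/-- `cosh t - 1` as a function of `2 cosh (t / 3)`. -/
def profile (Y : ℂ) : ℂ := (Y ^ 3 - 3 * Y) / 2 - 1

/-- `(cosh t - 1) / (2 cosh (2 t / 3) - 2)` as a function of `2 cosh (t / 3)`. -/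
def growth (Y : ℂ) : ℂ := (Y + 1) ^ 2 / (2 * (Y + 2))

/-- `sinh (t / 2) / (2 sinh (2 t / 3))` as a function of `2 cosh (t / 3)`. -/
def prefactor (Y : ℂ) : ℂ := (Y + 1) / (2 * Y * (Y + 2) ^ (2⁻¹ : ℂ))

theorem ne_zero_of_re_pos {Y : ℂ} (hY : 0 < Y.re) : Y ≠ 0 := by
  rintro rfl; simp at hY

theorem add_ne_zero_of_re_pos {Y : ℂ} (hY : 0 < Y.re) {a : ℝ} (ha : 0 ≤ a) : Y + a ≠ 0 := by
  apply ne_zero_of_re_pos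
  simp
  linarith

theorem add_two_ne_zero {Y : ℂ} (hY : 0 < Y.re) : Y + 2 ≠ 0 := by
  simpa using add_ne_zero_of_re_pos hY (a := 2) (by norm_num)

theorem growth_ne_zero {Y : ℂ} (hY : 0 < Y.re) : growth Y ≠ 0 := by
  have h1 : Y + 1 ≠ 0 := by simpa using add_ne_zero_of_re_pos hY (a := 1) (by norm_num)
  exact div_ne_zero (pow_ne_zero _ h1) (mul_ne_zero two_ne_zero (add_two_ne_zero hY))

theorem prefactor_ne_zero {Y : ℂ} (hY : 0 < Y.re) : prefactor Y ≠ 0 := by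
  have h1 : Y + 1 ≠ 0 := by simpa using add_ne_zero_of_re_pos hY (a := 1) (by norm_num)
  refine div_ne_zero h1 (mul_ne_zero (mul_ne_zero two_ne_zero (ne_zero_of_re_pos hY)) ?_)
  rw [Complex.cpow_def_of_ne_zero (add_two_ne_zero hY)]
  exact Complex.exp_ne_zero _

theorem sub_mul_growth {Y : ℂ} (hY : 0 < Y.re) : (Y ^ 2 - 4) * growth Y = profile Y := by
  have := add_two_ne_zero hY
  rw [growth, profile]
  field_simp
  ring

theorem differentiableAt_growth {Y : ℂ} (hY : 0 < Y.re) : DifferentiableAt ℂ growth Y := by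
  unfold growth
  exact DifferentiableAt.div (by fun_prop) (by fun_prop)
    (mul_ne_zero two_ne_zero (add_two_ne_zero hY))

theorem differentiableAt_prefactor {Y : ℂ} (hY : 0 < Y.re) :
    DifferentiableAt ℂ prefactor Y := by
  unfold prefactor
  refine DifferentiableAt.div (by fun_prop) ?_ ?_
  · refine DifferentiableAt.mul (by fun_prop) (DifferentiableAt.cpow (by fun_prop) (by fun_prop) ?_)
    rw [Complex.mem_slitPlane_iff]
    left
    simp
    linarith
  · refine mul_ne_zero (mul_ne_zero two_ne_zero (ne_zero_of_re_pos hY)) ?_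
    rw [Complex.cpow_def_of_ne_zero (add_two_ne_zero hY)]
    exact Complex.exp_ne_zero _

theorem profile_two_cosh (t : ℂ) :
    profile (2 * Complex.cosh (t / 3)) = 2 * Complex.sinh (t / 2) ^ 2 := by
  have h1 : Complex.cosh t = 4 * Complex.cosh (t / 3) ^ 3 - 3 * Complex.cosh (t / 3) := by
    rw [← Complex.cosh_three_mul]
    congr 1; ring
  have h2 : Complex.cosh t = 1 + 2 * Complex.sinh (t / 2) ^ 2 := by
    rw [show t = 2 * (t / 2) by ring, Complex.cosh_two_mul, Complex.cosh_sq]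
    ring_nf
  rw [profile]
  linear_combination h2 - h1

theorem two_cosh_sq_sub_two (t : ℂ) :
    (2 * Complex.cosh (t / 3)) ^ 2 - 2 = 2 * Complex.cosh (2 * t / 3) := by
  rw [show 2 * t / 3 = 2 * (t / 3) by ring, Complex.cosh_two_mul, Complex.sinh_sq]
  ring

theorem two_cosh_re_pos {t : ℂ} (ht : |t.im| < 3 * Real.pi / 2) :
    0 < (2 * Complex.cosh (t / 3)).re := by
  have h1 : 0 < (Complex.cosh (t / 3)).re := by
    apply cosh_re_pos
    have : (t / 3).im = t.im / 3 := by simp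
    rw [this, abs_div, abs_of_pos (by norm_num : (0 : ℝ) < 3)]
    linarith
  have : (2 * Complex.cosh (t / 3)).re = 2 * (Complex.cosh (t / 3)).re := by simp
  linarith

/-- With t = 6u this is sinh 3u = (4 cosh² u - 1) sinh u together with the duplication formulas. The
range of Im t gives Re cosh u > 0, so that the principal root of Y + 2 = (2 cosh u)² is 2 cosh u. -/
theorem sinh_half_eq {t : ℂ} (ht : |t.im| < 3 * Real.pi / 2) :
    Complex.sinh (t / 2) =
      prefactor (2 * Complex.cosh (t / 3)) * (2 * Complex.sinh (2 * t / 3)) := by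
  have hY := two_cosh_re_pos ht
  obtain ⟨u, rfl⟩ : ∃ u, t = 6 * u := ⟨t / 6, by ring⟩
  have e1 : 6 * u / 3 = 2 * u := by ring
  have e2 : 6 * u / 2 = 3 * u := by ring
  have e3 : 2 * (6 * u) / 3 = 2 * (2 * u) := by ring
  rw [e1] at hY
  have hu : 0 < (Complex.cosh u).re := by
    apply cosh_re_pos
    have : (6 * u).im = 6 * u.im := by simp
    rw [this, abs_mul, abs_of_pos (by norm_num : (0 : ℝ) < 6)] at ht
    linarith [Real.pi_pos]
  have hc : 2 * Complex.cosh (2 * u) + 2 = (2 * Complex.cosh u) ^ 2 := by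
    rw [Complex.cosh_two_mul, Complex.sinh_sq]
    ring
  have hs : (2 * Complex.cosh (2 * u) + 2) ^ (2⁻¹ : ℂ) = 2 * Complex.cosh u := by
    rw [hc, Complex.sq_cpow_two_inv]
    have : (2 * Complex.cosh u).re = 2 * (Complex.cosh u).re := by simp
    linarith
  rw [e1, e2, e3, prefactor, hs, Complex.sinh_three_mul, Complex.sinh_two_mul (2 * u),
    Complex.sinh_two_mul u]
  have h0 := ne_zero_of_re_pos hu
  have h1 : Complex.cosh (2 * u) ≠ 0 := by
    intro h
    rw [h] at hY
    simp at hY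
  field_simp
  rw [Complex.cosh_two_mul, Complex.cosh_sq]
  ring

/-- Comparison of the sine sum with its integral representation: the power (2 sinh²(t/2))^N splits
as (X - 2)^N times `growth` to the N, and one factor sinh(2t/3) is cancelled. -/
theorem stairSum_eval_eq {N : ℕ} {t : ℂ} (ht : |t.im| < Real.pi) (h0 : Complex.sinh (t / 2) ≠ 0) :
    (stairSum N).eval (2 * Complex.cosh (2 * t / 3)) =
      (2 * Complex.cosh (2 * t / 3) - 2) ^ N *
        (4 * moment 0 N * prefactor (2 * Complex.cosh (t / 3)) *
          growth (2 * Complex.cosh (t / 3)) ^ N *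
          ampMean (stairOrder N) N (Complex.sinh (t / 2))) := by
  have ht' : |t.im| < 3 * Real.pi / 2 := by linarith [Real.pi_pos]
  have hY := two_cosh_re_pos ht'
  have h1 := sinh_mul_stairSum_eval N t
  rw [sinhSum_eq_ampMean (int_add_stairOrder_ne_zero N) N ht] at h1
  have h2 := sinh_half_eq ht'
  have hs : Complex.sinh (2 * t / 3) ≠ 0 := by
    intro h
    rw [h] at h2
    simp at h2
    exact h0 h2
  have h3 := sub_mul_growth hY
  rw [profile_two_cosh] at h3
  rw [← two_cosh_sq_sub_two, sub_sub, show (2 + 2 : ℂ) = 4 by norm_num]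
  rw [← two_cosh_sq_sub_two] at h1
  refine mul_left_cancel₀ hs ?_
  rw [h1, ← h3, mul_pow]
  nth_rewrite 1 [h2]
  ring

/-- A polynomial that behaves like a non-zero multiple of `(X - a) ^ N` along a sequence of points
tending to `a` has a zero of order exactly `N` at `a`. -/
theorem exists_eq_pow_mul_of_tendsto {ι : Type*} {l : Filter ι} [l.NeBot] {P : Polynomial ℂ}
    {a b : ℂ} {N : ℕ} {u B : ι → ℂ} (hu : Tendsto u l (𝓝 a)) (hua : ∀ᶠ i in l, u i ≠ a)
    (hB : Tendsto B l (𝓝 b)) (hb : b ≠ 0) (h : ∀ᶠ i in l, P.eval (u i) = (u i - a) ^ N * B i) :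
    ∃ Q : Polynomial ℂ, P = (Polynomial.X - Polynomial.C a) ^ N * Q ∧ Q.eval a ≠ 0 := by
  have hP : P ≠ 0 := by
    rintro rfl
    have : ∀ᶠ i in l, B i = 0 := by
      filter_upwards [hua, h] with i h1 h2
      simp only [Polynomial.eval_zero] at h2
      rcases mul_eq_zero.1 h2.symm with h3 | h3
      · exact absurd h3 (pow_ne_zero N (sub_ne_zero.2 h1))
      · exact h3
    exact hb (tendsto_nhds_unique (hB.congr' this) tendsto_const_nhds)
  obtain ⟨Q, hQ, hnd⟩ := Polynomial.exists_eq_pow_rootMultiplicity_mul_and_not_dvd P hP a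
  have hQa : Q.eval a ≠ 0 := fun h => hnd (Polynomial.dvd_iff_isRoot.2 h)
  set r := P.rootMultiplicity a
  have hQu : Tendsto (fun i => Q.eval (u i)) l (𝓝 (Q.eval a)) :=
    (Q.continuous.tendsto a).comp hu
  have hu0 : Tendsto (fun i => u i - a) l (𝓝 0) := by
    simpa using hu.sub_const a
  have hrel : ∀ᶠ i in l, (u i - a) ^ r * Q.eval (u i) = (u i - a) ^ N * B i := by
    filter_upwards [h] with i hi
    rw [← hi]
    conv_rhs => rw [hQ]
    simp
  have hrN : r = N := by
    -- If the multiplicity r differed from N, cancelling the smaller power of u - a would force one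
    -- of the two non-zero limits to be zero.
    rcases lt_trichotomy r N with hlt | heq | hgt
    · exfalso
      have h1 : ∀ᶠ i in l, (u i - a) ^ (N - r) * B i = Q.eval (u i) := by
        filter_upwards [hrel, hua] with i h2 h3
        refine mul_left_cancel₀ (pow_ne_zero r (sub_ne_zero.2 h3)) ?_
        rw [h2, ← mul_assoc, ← pow_add, Nat.add_sub_cancel' hlt.le]
      have h2 := ((hu0.pow (N - r)).mul hB).congr' h1
      rw [zero_pow (by omega), zero_mul] at h2
      exact hQa (tendsto_nhds_unique hQu h2)
    · exact heq
    · exfalso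
      have h1 : ∀ᶠ i in l, (u i - a) ^ (r - N) * Q.eval (u i) = B i := by
        filter_upwards [hrel, hua] with i h2 h3
        refine mul_left_cancel₀ (pow_ne_zero N (sub_ne_zero.2 h3)) ?_
        rw [← h2, ← mul_assoc, ← pow_add, Nat.add_sub_cancel' hgt.le]
      have h2 := ((hu0.pow (r - N)).mul hQu).congr' h1
      rw [zero_pow (by omega), zero_mul] at h2
      exact hb (tendsto_nhds_unique hB h2)
  rw [hrN] at hQ
  exact ⟨Q, hQ, hQa⟩

theorem sinh_half_ne_zero {t : ℂ} (ht : |t.im| < Real.pi) (h0 : t ≠ 0) :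
    Complex.sinh (t / 2) ≠ 0 := by
  intro h
  have hu : |(t / 2).im| < Real.pi / 2 := by
    have : (t / 2).im = t.im / 2 := by simp
    rw [this, abs_div, abs_two]
    linarith
  have := carsinh_sinh hu
  rw [h, carsinh_zero] at this
  exact h0 (by linear_combination -2 * this)

theorem tendsto_ampMean (κ : ℂ) (N : ℕ) : Tendsto (ampMean κ N) (𝓝 0) (𝓝 1) := by
  obtain ⟨r, hr, hrd⟩ := Metric.isOpen_iff.1 isOpen_arsinhDomain 0 zero_mem_arsinhDomain
  obtain ⟨C, -, hC⟩ := ampMean_estimate κ (isCompact_closedBall (0 : ℂ) (r / 2))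
    ((Metric.closedBall_subset_ball (by linarith)).trans hrd)
  have h1 : Tendsto (fun q : ℂ => ampMean κ N q - 1 - (2 * κ ^ 2 - 1 / 2) / (2 * N + 3) * q ^ 2)
      (𝓝 0) (𝓝 0) := by
    have hb : Tendsto (fun q : ℂ => C * ‖q‖ ^ 4 / ((N : ℝ) + 1) ^ 2) (𝓝 0) (𝓝 0) := by
      have : Continuous fun q : ℂ => C * ‖q‖ ^ 4 / ((N : ℝ) + 1) ^ 2 := by fun_prop
      simpa using this.tendsto 0
    refine squeeze_zero_norm' ?_ hb
    filter_upwards [Metric.closedBall_mem_nhds (0 : ℂ) (half_pos hr)] with q hq using hC q hq N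
  have h2 : Tendsto (fun q : ℂ => 1 + (2 * κ ^ 2 - 1 / 2) / (2 * N + 3) * q ^ 2) (𝓝 0) (𝓝 1) := by
    have : Continuous fun q : ℂ => 1 + (2 * κ ^ 2 - 1 / 2) / (2 * N + 3) * q ^ 2 := by fun_prop
    simpa using this.tendsto 0
  have h3 := h1.add h2
  rw [zero_add] at h3
  refine h3.congr fun q => ?_
  ring

/-- As t tends to 0, the sum divided by (X - 2)^N has a finite non-zero limit, because the
normalized integral tends to 1. This exhibits the order of the zero without inspecting coefficients.
-/
theorem exists_stairSum_eq (N : ℕ) : ∃ Q : Polynomial ℂ,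
    stairSum N = (Polynomial.X - Polynomial.C 2) ^ N * Q ∧ Q.eval 2 ≠ 0 := by
  have hc : Continuous fun t : ℂ => 2 * Complex.cosh (2 * t / 3) := by fun_prop
  have hY : Tendsto (fun t : ℂ => 2 * Complex.cosh (t / 3)) (𝓝[≠] 0) (𝓝 2) := by
    have : Continuous fun t : ℂ => 2 * Complex.cosh (t / 3) := by fun_prop
    have h := this.tendsto 0
    simp only [zero_div, Complex.cosh_zero, mul_one] at h
    exact h.mono_left nhdsWithin_le_nhds
  have hq : Tendsto (fun t : ℂ => Complex.sinh (t / 2)) (𝓝[≠] 0) (𝓝 0) := by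
    have : Continuous fun t : ℂ => Complex.sinh (t / 2) := by fun_prop
    have h := this.tendsto 0
    simp only [zero_div, Complex.sinh_zero] at h
    exact h.mono_left nhdsWithin_le_nhds
  have h2 : (0 : ℝ) < (2 : ℂ).re := by simp
  have hsmall : ∀ᶠ t : ℂ in 𝓝[≠] 0, |t.im| < Real.pi := by
    have h : Continuous fun t : ℂ => |t.im| := by fun_prop
    have h' := h.tendsto 0
    simp only [Complex.zero_im, abs_zero] at h'
    exact (h'.mono_left nhdsWithin_le_nhds).eventually_lt_const Real.pi_pos
  refine exists_eq_pow_mul_of_tendsto (l := 𝓝[≠] (0 : ℂ)) (a := 2)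
    (b := 4 * moment 0 N * prefactor 2 * growth 2 ^ N * 1)
    (u := fun t => 2 * Complex.cosh (2 * t / 3))
    (B := fun t => 4 * moment 0 N * prefactor (2 * Complex.cosh (t / 3)) *
          growth (2 * Complex.cosh (t / 3)) ^ N *
          ampMean (stairOrder N) N (Complex.sinh (t / 2))) ?_ ?_ ?_ ?_ ?_
  · have h := hc.tendsto 0
    simp only [mul_zero, zero_div, Complex.cosh_zero, mul_one] at h
    exact h.mono_left nhdsWithin_le_nhds
  · filter_upwards [self_mem_nhdsWithin, hsmall] with t ht0 ht h
    have ht' : |t.im| < 3 * Real.pi / 2 := by linarith [Real.pi_pos]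
    have h3 := sub_mul_growth (two_cosh_re_pos ht')
    rw [profile_two_cosh, show (4 : ℂ) = 2 + 2 by norm_num, ← sub_sub, two_cosh_sq_sub_two, h] at h3
    simp only [sub_self, zero_mul] at h3
    exact sinh_half_ne_zero ht ht0 (by simpa using h3.symm)
  · exact (((tendsto_const_nhds.mul
      ((differentiableAt_prefactor h2).continuousAt.tendsto.comp hY)).mul
      (((differentiableAt_growth h2).continuousAt.tendsto.comp hY).pow N))).mul
      ((tendsto_ampMean _ N).comp hq)
  · have h0 : (moment 0 N : ℂ) ≠ 0 := by exact_mod_cast (moment_zero_pos N).ne'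
    simp [h0, prefactor_ne_zero h2, growth_ne_zero h2]
  · filter_upwards [self_mem_nhdsWithin, hsmall] with t ht0 ht
    exact stairSum_eval_eq ht (sinh_half_ne_zero ht ht0)

/-! ### Reduction of the character with many coordinates equal to 1. -/

/-- The quotient of `stairSum N` by `(X - 2) ^ N`: up to a constant, the character with all but one
variable equal to `1`. -/
def stairQuot (N : ℕ) : Polynomial ℂ := (exists_stairSum_eq N).choose

theorem stairSum_eq (N : ℕ) : stairSum N = (Polynomial.X - Polynomial.C 2) ^ N * stairQuot N :=
  (exists_stairSum_eq N).choose_spec.1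

theorem stairQuot_eval_two_ne_zero (N : ℕ) : (stairQuot N).eval 2 ≠ 0 :=
  (exists_stairSum_eq N).choose_spec.2

/-- `τ` at a point with `m` coordinates equal to `1`. -/
theorem exists_tau_eq (m k : ℕ) : ∃ c : ℂ, c ≠ 0 ∧
    ∀ {n : ℕ} (z : Fin n → ℂ) (y : Fin k → ℂ), (∀ i, y i ≠ 0) →
      coords z = Multiset.replicate m 1 + coords y →
      tau z = c * MvPolynomial.eval (fun i => (y i + (y i)⁻¹) ^ 2 - 2)
        (altQuot (fun j => (Polynomial.X - Polynomial.C 2) ^ j * stairQuot (m + j)) k) := by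
  refine ⟨(∏ j ∈ Finset.range (m + k), stairMatrix j j)⁻¹ *
    ∏ l ∈ Finset.range m, (stairQuot l).eval 2, ?_, ?_⟩
  · exact mul_ne_zero (inv_ne_zero (Finset.prod_ne_zero_iff.2 fun j _ =>
      stairMatrix_self_ne_zero j)) (Finset.prod_ne_zero_iff.2 fun j _ =>
      stairQuot_eval_two_ne_zero j)
  · intro n z y hy hc
    have hn : n = m + k := by
      simpa [card_coords] using congrArg Multiset.card hc
    have hz : ∀ i, z i ≠ 0 := by
      intro i h
      have h0 : (0 : ℂ) ∈ coords z := by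
        rw [← h]
        exact Multiset.mem_map_of_mem _ (Finset.mem_univ_val i)
      rw [hc, Multiset.mem_add] at h0
      rcases h0 with h0 | h0
      · exact zero_ne_one (Multiset.eq_of_mem_replicate h0)
      · obtain ⟨i, -, hi⟩ := Multiset.mem_map.1 h0
        exact hy i hi
    rw [tau, symplecticChar_staircase (fun i => pow_ne_zero 2 (hz i))]
    have h1 := altQuot_triangular stairMatrix stairSum_eq_sum
      (fun i : Fin n => z i ^ 2 + (z i ^ 2)⁻¹)
    have hA : ∏ j ∈ Finset.range (m + k), stairMatrix j j ≠ 0 :=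
      Finset.prod_ne_zero_iff.2 fun j _ => stairMatrix_self_ne_zero j
    have h2 : stairSum = fun j => (Polynomial.X - Polynomial.C 2) ^ j * stairQuot j :=
      funext stairSum_eq
    have hc2 : coords (fun i : Fin n => z i ^ 2 + (z i ^ 2)⁻¹) =
        Multiset.replicate m 2 + coords (fun i => (y i + (y i)⁻¹) ^ 2 - 2) := by
      rw [coords_comp (fun w => w ^ 2 + (w ^ 2)⁻¹) z, hc, Multiset.map_add, Multiset.map_replicate]
      congr 1
      · norm_num
      · rw [← coords_comp]
        congr 1
        ext i
        have := hy i
        field_simp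
        ring
    rw [h2, altQuot_of_coords_eq_add_replicate 2 m _ stairQuot _ hc2] at h1
    have hr : ∏ j ∈ Finset.range n, stairMatrix j j = ∏ j ∈ Finset.range (m + k), stairMatrix j j := by
      rw [hn]
    rw [hr] at h1
    rw [mul_assoc, h1, inv_mul_cancel_left₀ hA]

/-- `stairQuot` in the variable `Y = z + z⁻¹`, divided by its leading asymptotics. -/
def normAmp (N : ℕ) (Y : ℂ) : ℂ :=
  (stairQuot N).eval (Y ^ 2 - 2) / (4 * moment 0 N * prefactor Y * growth Y ^ N)

theorem normAmp_denom_ne_zero (N : ℕ) {Y : ℂ} (hY : 0 < Y.re) :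
    4 * moment 0 N * prefactor Y * growth Y ^ N ≠ 0 := by
  have h0 : (moment 0 N : ℂ) ≠ 0 := by exact_mod_cast (moment_zero_pos N).ne'
  simp [h0, prefactor_ne_zero hY, growth_ne_zero hY]

theorem differentiableAt_normAmp (N : ℕ) {Y : ℂ} (hY : 0 < Y.re) :
    DifferentiableAt ℂ (normAmp N) Y := by
  unfold normAmp
  refine DifferentiableAt.div ?_ ?_ (normAmp_denom_ne_zero N hY)
  · exact ((stairQuot N).differentiable.comp
      (by fun_prop : Differentiable ℂ fun Y : ℂ => Y ^ 2 - 2)).differentiableAt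
  · exact ((differentiableAt_prefactor hY).const_mul _).mul ((differentiableAt_growth hY).pow N)

/-- Being algebraic in Y, this holds on the whole strip |Im t| < 3π/2, unlike the integral
representation. It is the link through which `normAmp` is evaluated beyond |Im t| = π. -/
theorem sinhSum_eq_normAmp (N : ℕ) {t : ℂ} (ht : |t.im| < 3 * Real.pi / 2) :
    sinhSum (stairOrder N) N t = 2 * moment 0 N * (2 * Complex.sinh (t / 2) ^ 2) ^ N *
      Complex.sinh (t / 2) * normAmp N (2 * Complex.cosh (t / 3)) := by
  have hY := two_cosh_re_pos ht
  have h1 := sinh_mul_stairSum_eval N t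
  have h3 := sub_mul_growth hY
  rw [profile_two_cosh] at h3
  have hp := prefactor_ne_zero hY
  have hg := growth_ne_zero hY
  have h0 : (moment 0 N : ℂ) ≠ 0 := by exact_mod_cast (moment_zero_pos N).ne'
  rw [← h1, ← h3, sinh_half_eq ht, normAmp, stairSum_eq, ← two_cosh_sq_sub_two]
  simp only [Polynomial.eval_mul, Polynomial.eval_pow, Polynomial.eval_sub, Polynomial.eval_X,
    Polynomial.eval_C]
  generalize 2 * Complex.cosh (t / 3) = Y at *
  rw [sub_sub, show (2 + 2 : ℂ) = 4 by norm_num, mul_pow]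
  field_simp
  ring

theorem normAmp_eq_ampMean (N : ℕ) {t : ℂ} (ht : |t.im| < Real.pi) (h0 : t ≠ 0) :
    normAmp N (2 * Complex.cosh (t / 3)) = ampMean (stairOrder N) N (Complex.sinh (t / 2)) := by
  have h1 := sinhSum_eq_normAmp N (t := t) (by linarith [Real.pi_pos])
  rw [sinhSum_eq_ampMean (int_add_stairOrder_ne_zero N) N ht] at h1
  have hs := sinh_half_ne_zero ht h0
  have hm : (moment 0 N : ℂ) ≠ 0 := by exact_mod_cast (moment_zero_pos N).ne'
  have : 2 * (moment 0 N : ℂ) * (2 * Complex.sinh (t / 2) ^ 2) ^ N * Complex.sinh (t / 2) ≠ 0 := by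
    simp [hm, hs]
  exact (mul_left_cancel₀ this h1).symm

/-! ### Continuation across the lines Im t = ±π. -/

/-- The three values of `sinhSum` at points shifted by `π i` add up to zero. -/
theorem sinhSum_shift (N : ℕ) (t : ℂ) :
    sinhSum (stairOrder N) N t =
      -sinhSum (stairOrder N) N (t - 2 * (Real.pi * Complex.I)) -
        sinhSum (stairOrder N) N (t - Real.pi * Complex.I) := by
  rw [sinhSum, sinhSum, sinhSum, ← Finset.sum_neg_distrib, ← Finset.sum_sub_distrib]
  refine Finset.sum_congr rfl fun i _ => ?_
  set a : ℂ := 2 * i - N + stairOrder N with ha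
  set u : ℂ := a * (t - Real.pi * Complex.I) with hu
  have e1 : a * t = u + a * Real.pi * Complex.I := by rw [hu]; ring
  have e2 : a * (t - 2 * (Real.pi * Complex.I)) = u - a * Real.pi * Complex.I := by rw [hu]; ring
  -- Each frequency is ±2/3 modulo 2; this is where the parity rule for `stairOrder` enters. Then
  -- sinh(u + iaπ) + sinh(u - iaπ) = 2 cos(aπ) sinh u = -sinh u.
  have hcos : Complex.cos (a * Real.pi) = -1 / 2 := by
    rw [ha, stairOrder]
    split_ifs with h
    · obtain ⟨n, rfl⟩ := h
      have : (2 * (i : ℂ) - (n + n : ℕ) + 2 / 3) * Real.pi =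
          ((Real.pi - Real.pi / 3 : ℝ) : ℂ) + ((i - n : ℤ) : ℂ) * (2 * Real.pi) := by
        push_cast; ring
      rw [this, Complex.cos_add_int_mul_two_pi, ← Complex.ofReal_cos, Real.cos_pi_sub,
        Real.cos_pi_div_three]
      push_cast; ring
    · obtain ⟨n, rfl⟩ := Nat.not_even_iff_odd.1 h
      have : (2 * (i : ℂ) - (2 * n + 1 : ℕ) + 1 / 3) * Real.pi =
          ((Real.pi / 3 + Real.pi : ℝ) : ℂ) + ((i - n - 1 : ℤ) : ℂ) * (2 * Real.pi) := by
        push_cast; ring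
      rw [this, Complex.cos_add_int_mul_two_pi, ← Complex.ofReal_cos, Real.cos_add_pi,
        Real.cos_pi_div_three]
      push_cast; ring
  rw [e1, e2, Complex.sinh_add, Complex.sinh_sub, Complex.cosh_mul_I, hcos]
  ring

/-- Both shifted points lie in the strip |Im| < π, where the integral representation applies. The
shifts by 2πi and πi replace sinh(t/2) by -sinh(t/2) and by -i cosh(t/2). -/
theorem normAmp_eq_of_pi_lt (N : ℕ) {t : ℂ} (h1 : Real.pi < t.im) (h2 : t.im < 3 * Real.pi / 2)
    (h0 : Complex.sinh (t / 2) ≠ 0) :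
    normAmp N (2 * Complex.cosh (t / 3)) = ampMean (stairOrder N) N (-Complex.sinh (t / 2)) -
      (-(Complex.I * Complex.cosh (t / 2)) / Complex.sinh (t / 2)) ^ (2 * N + 1) *
        ampMean (stairOrder N) N (-(Complex.I * Complex.cosh (t / 2))) := by
  have hpi := Real.pi_pos
  have i1 : (t - 2 * (Real.pi * Complex.I)).im = t.im - 2 * Real.pi := by simp
  have i2 : (t - Real.pi * Complex.I).im = t.im - Real.pi := by simp
  have hs1 : Complex.sinh ((t - 2 * (Real.pi * Complex.I)) / 2) = -Complex.sinh (t / 2) := by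
    rw [show (t - 2 * (Real.pi * Complex.I)) / 2 = t / 2 - Real.pi * Complex.I by ring,
      Complex.sinh_sub, Complex.cosh_mul_I, Complex.sinh_mul_I]
    simp
  have hs2 : Complex.sinh ((t - Real.pi * Complex.I) / 2) =
      -(Complex.I * Complex.cosh (t / 2)) := by
    rw [show (t - Real.pi * Complex.I) / 2 = t / 2 - (Real.pi / 2 : ℂ) * Complex.I by ring,
      Complex.sinh_sub, Complex.cosh_mul_I, Complex.sinh_mul_I]
    simp
    ring
  have key := sinhSum_shift N t
  rw [sinhSum_eq_normAmp N (t := t) (by rw [abs_of_pos (by linarith)]; exact h2),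
    sinhSum_eq_ampMean (int_add_stairOrder_ne_zero N) N
      (t := t - 2 * (Real.pi * Complex.I)) (by rw [i1, abs_lt]; constructor <;> linarith),
    sinhSum_eq_ampMean (int_add_stairOrder_ne_zero N) N
      (t := t - Real.pi * Complex.I) (by rw [i2, abs_lt]; constructor <;> linarith),
    hs1, hs2] at key
  generalize ampMean (stairOrder N) N (-Complex.sinh (t / 2)) = J1 at key ⊢
  set q' := -(Complex.I * Complex.cosh (t / 2)) with hq'
  generalize ampMean (stairOrder N) N q' = J2 at key ⊢
  set q := Complex.sinh (t / 2) with hq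
  have hm : (moment 0 N : ℂ) ≠ 0 := by exact_mod_cast (moment_zero_pos N).ne'
  have hne : 2 * (moment 0 N : ℂ) * (2 * q ^ 2) ^ N * q ≠ 0 := by simp [hm, h0]
  refine mul_left_cancel₀ hne (key.trans ?_)
  have e : (2 * q ^ 2) ^ N * q * (q' / q) ^ (2 * N + 1) = (2 * q' ^ 2) ^ N * q' := by
    rw [div_pow, mul_pow, mul_pow, ← pow_mul, ← pow_mul]
    field_simp
    ring
  linear_combination -(2 * (moment 0 N : ℂ) * J2) * (-e)

/-- Solve z + z⁻¹ = Y. As z and z⁻¹ have real parts of the same sign, Re z > 0, and t = 3 log z has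
|Im t| < 3π/2. -/
theorem exists_two_cosh_eq {Y : ℂ} (hY : 0 < Y.re) :
    ∃ t : ℂ, |t.im| < 3 * Real.pi / 2 ∧ 2 * Complex.cosh (t / 3) = Y := by
  obtain ⟨d, hd⟩ : ∃ d : ℂ, d ^ 2 = Y ^ 2 - 4 := by
    refine ⟨(Y ^ 2 - 4) ^ (2⁻¹ : ℂ), ?_⟩
    rw [← Complex.cpow_nat_mul]
    simp
  set z := (Y + d) / 2 with hz
  have hinv : z * ((Y - d) / 2) = 1 := by
    rw [hz]
    linear_combination -hd / 4
  have hz0 : z ≠ 0 := left_ne_zero_of_mul_eq_one hinv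
  have hzi : z⁻¹ = (Y - d) / 2 := inv_eq_of_mul_eq_one_right hinv
  have hsum : z + z⁻¹ = Y := by rw [hzi, hz]; ring
  have hzre : 0 < z.re := by
    have h := congrArg Complex.re hsum
    rw [Complex.add_re, Complex.inv_re] at h
    have hn := Complex.normSq_pos.2 hz0
    by_contra! hc
    have : z.re / Complex.normSq z ≤ 0 := div_nonpos_of_nonpos_of_nonneg hc hn.le
    linarith
  refine ⟨3 * Complex.log z, ?_, ?_⟩
  · have h1 : |Complex.arg z| < Real.pi / 2 := Complex.abs_arg_lt_pi_div_two_iff.2 (Or.inl hzre)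
    have : (3 * Complex.log z).im = 3 * Complex.arg z := by simp [Complex.log_im]
    rw [this, abs_mul, abs_of_pos (by norm_num : (0 : ℝ) < 3)]
    linarith
  · rw [mul_div_cancel_left₀ _ (by norm_num : (3 : ℂ) ≠ 0), Complex.cosh, Complex.exp_neg,
      Complex.exp_log hz0, hsum]
    ring

/-- The hyperbola `a ^ 2 - b ^ 2 / 3 = 1` is the image of the lines `Im t = ± π`. -/
def sheet (Y : ℂ) : ℝ := Y.re ^ 2 - Y.im ^ 2 / 3 - 1

theorem sheet_two_cosh (t : ℂ) : sheet (2 * Complex.cosh (t / 3)) =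
    (4 * Real.cos (t.im / 3) ^ 2 - 1) * (1 + 4 / 3 * Real.sinh (t.re / 3) ^ 2) := by
  have h1 : Complex.cosh (t / 3) =
      ((Real.cosh (t.re / 3) * Real.cos (t.im / 3) : ℝ) : ℂ) +
        ((Real.sinh (t.re / 3) * Real.sin (t.im / 3) : ℝ) : ℂ) * Complex.I := by
    have : t / 3 = ((t.re / 3 : ℝ) : ℂ) + ((t.im / 3 : ℝ) : ℂ) * Complex.I := by
      conv_lhs => rw [← Complex.re_add_im t]
      push_cast; ring
    rw [this, Complex.cosh_add, Complex.cosh_mul_I, Complex.sinh_mul_I]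
    push_cast; ring
  have hre : (2 * Complex.cosh (t / 3)).re = 2 * (Real.cosh (t.re / 3) * Real.cos (t.im / 3)) := by
    rw [h1, show (2 : ℂ) = ((2 : ℝ) : ℂ) by norm_num, Complex.re_ofReal_mul, Complex.add_re,
      Complex.re_ofReal_mul, Complex.ofReal_re, Complex.I_re]
    ring
  have him : (2 * Complex.cosh (t / 3)).im = 2 * (Real.sinh (t.re / 3) * Real.sin (t.im / 3)) := by
    rw [h1, show (2 : ℂ) = ((2 : ℝ) : ℂ) by norm_num, Complex.im_ofReal_mul, Complex.add_im,
      Complex.im_ofReal_mul, Complex.ofReal_im, Complex.I_im]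
    ring
  rw [sheet, hre, him]
  have h2 := Real.cosh_sq (t.re / 3)
  have h3 := Real.sin_sq (t.im / 3)
  rw [mul_pow, mul_pow, mul_pow, mul_pow, h2, h3]
  ring

/-- The set of `Y = 2 cosh (t / 3)` at which the univariate asymptotics holds. -/
def goodSet : Set ℂ := {Y | 0 < Y.re ∧ 1 + profile Y / 2 ∈ Complex.slitPlane}

/-- On the hyperbola Im Y² = 3 Re Y² - 3 (squares of real and imaginary parts), the number 1 + (cosh
t - 1)/2 is real and equals (1 + 3a - 4a³)/2 with a = Re Y ≥ 1, hence is non-positive. -/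
theorem sheet_ne_zero {Y : ℂ} (hY : Y ∈ goodSet) : sheet Y ≠ 0 := by
  obtain ⟨hre, hp⟩ := hY
  intro h
  rw [sheet] at h
  have e : 1 + profile Y / 2 = (((Y.re ^ 3 - 3 * Y.re * Y.im ^ 2 - 3 * Y.re) / 4 + 1 / 2 : ℝ) : ℂ) +
      (((3 * Y.re ^ 2 * Y.im - Y.im ^ 3 - 3 * Y.im) / 4 : ℝ) : ℂ) * Complex.I := by
    rw [profile]
    conv_lhs => rw [← Complex.re_add_im Y]
    push_cast
    linear_combination ((3 * (Y.re : ℂ) * Y.im ^ 2 + Y.im ^ 3 * Complex.I) / 4) * Complex.I_sq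
  rw [Complex.mem_slitPlane_iff, e] at hp
  simp only [Complex.add_re, Complex.add_im, Complex.ofReal_re, Complex.ofReal_im,
    Complex.re_ofReal_mul, Complex.im_ofReal_mul, Complex.I_re, Complex.I_im] at hp
  have hb : Y.im ^ 2 = 3 * Y.re ^ 2 - 3 := by linarith
  have ha : 1 ≤ Y.re ^ 2 := by nlinarith [sq_nonneg Y.im]
  have ha1 : 1 ≤ Y.re := by nlinarith
  rcases hp with hp | hp
  · rw [mul_assoc, hb] at hp
    nlinarith [mul_nonneg (sub_nonneg.2 ha1) (sub_nonneg.2 ha)]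
  · apply hp
    rw [pow_succ Y.im 2, hb]
    ring

theorem exists_normAmp_eq_of_sheet_pos {Y : ℂ} (hY : 0 < Y.re) (h : 0 < sheet Y) (h2 : Y ≠ 2) :
    ∃ q : ℂ, 2 * q ^ 2 = profile Y ∧ ∀ N, normAmp N Y = ampMean (stairOrder N) N q := by
  obtain ⟨t, ht, rfl⟩ := exists_two_cosh_eq hY
  rw [sheet_two_cosh] at h
  have hpos : 0 < 1 + 4 / 3 * Real.sinh (t.re / 3) ^ 2 := by positivity
  have hc : 0 < 4 * Real.cos (t.im / 3) ^ 2 - 1 := pos_of_mul_pos_left h hpos.le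
  have habs : |t.im / 3| < Real.pi / 2 := by
    rw [abs_div, abs_of_pos (by norm_num : (0 : ℝ) < 3)]
    linarith
  have hcos : 0 < Real.cos (t.im / 3) := Real.cos_pos_of_mem_Ioo (abs_lt.1 habs)
  have ht' : |t.im| < Real.pi := by
    by_contra! hge
    have h3 : Real.cos (|t.im / 3|) ≤ Real.cos (Real.pi / 3) := by
      refine Real.cos_le_cos_of_nonneg_of_le_pi (by positivity) (by linarith [Real.pi_pos]) ?_
      rw [abs_div, abs_of_pos (by norm_num : (0 : ℝ) < 3)]
      linarith
    rw [Real.cos_abs, Real.cos_pi_div_three] at h3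
    nlinarith
  refine ⟨Complex.sinh (t / 2), (profile_two_cosh t).symm, fun N => normAmp_eq_ampMean N ht' ?_⟩
  rintro rfl
  simp at h2

theorem exists_normAmp_eq_of_sheet_neg {Y : ℂ} (hY : 0 < Y.re) (h : sheet Y < 0) :
    profile Y ≠ 0 → ∃ q q' : ℂ, 2 * q ^ 2 = profile Y ∧ 2 * q' ^ 2 = -2 - profile Y ∧
      ∀ N, normAmp N Y = ampMean (stairOrder N) N q +
        (q' / q) ^ (2 * N + 1) * ampMean (stairOrder N) N q' := by
  intro hp
  obtain ⟨t, ht, rfl⟩ := exists_two_cosh_eq hY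
  -- The statement involves t only through the even function cosh(t/3), so t may be replaced by -t.
  wlog hpos : 0 ≤ t.im generalizing t
  · have e : 2 * Complex.cosh (-t / 3) = 2 * Complex.cosh (t / 3) := by
      rw [neg_div, Complex.cosh_neg]
    have := this (-t) (by simpa using ht)
    rw [e] at this
    exact this hY h hp (by simp; linarith)
  rw [sheet_two_cosh] at h
  have hpos' : 0 < 1 + 4 / 3 * Real.sinh (t.re / 3) ^ 2 := by positivity
  have hc : 4 * Real.cos (t.im / 3) ^ 2 - 1 < 0 := by
    by_contra! hge
    exact absurd h (not_lt.2 (mul_nonneg hge hpos'.le))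
  rw [abs_of_nonneg hpos] at ht
  have ht' : Real.pi < t.im := by
    by_contra! hle
    have h3 : Real.cos (Real.pi / 3) ≤ Real.cos (t.im / 3) :=
      Real.cos_le_cos_of_nonneg_of_le_pi (by positivity) (by linarith [Real.pi_pos]) (by linarith)
    rw [Real.cos_pi_div_three] at h3
    nlinarith
  rw [profile_two_cosh] at hp ⊢
  have h0 : Complex.sinh (t / 2) ≠ 0 := by
    intro h0
    simp [h0] at hp
  refine ⟨-Complex.sinh (t / 2), -(Complex.I * Complex.cosh (t / 2)), by ring, ?_, fun N => ?_⟩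
  · rw [neg_sq, mul_pow, Complex.I_sq, Complex.cosh_sq]
    ring
  · rw [normAmp_eq_of_pi_lt N ht' ht h0, div_neg,
      (odd_two_mul_add_one N).neg_pow (-(Complex.I * Complex.cosh (t / 2)) / Complex.sinh (t / 2))]
    ring

/-! ### First-order univariate asymptotics, locally uniform in Y. -/

/-- The coefficient of the first correction to `normAmp`. -/
def corr (N : ℕ) : ℂ := (stairOrder N ^ 2 - 1 / 4) / (2 * N + 3)

theorem norm_corr_le (N : ℕ) : ‖corr N‖ ≤ 1 / (N + 1) := by
  have h1 : ‖stairOrder N ^ 2 - 1 / 4‖ ≤ 1 := by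
    rw [stairOrder]
    split_ifs
    · rw [show ((2 / 3 : ℂ) ^ 2 - 1 / 4) = ((7 / 36 : ℝ) : ℂ) by push_cast; norm_num,
        Complex.norm_real, Real.norm_of_nonneg (by norm_num)]
      norm_num
    · rw [show ((1 / 3 : ℂ) ^ 2 - 1 / 4) = ((-5 / 36 : ℝ) : ℂ) by push_cast; norm_num,
        Complex.norm_real, Real.norm_of_nonpos (by norm_num)]
      norm_num
  have h2 : ‖(2 * (N : ℂ) + 3)‖ = 2 * N + 3 := by
    rw [show (2 * (N : ℂ) + 3) = ((2 * N + 3 : ℝ) : ℂ) by push_cast; rfl, Complex.norm_real,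
      Real.norm_of_nonneg (by positivity)]
  rw [corr, norm_div, h2]
  refine div_le_div₀ zero_le_one h1 (by positivity) ?_
  have : (0 : ℝ) ≤ N := Nat.cast_nonneg N
  linarith

theorem ampMean_stairOrder_estimate {Q : Set ℂ} (hQ : IsCompact Q) (hQd : Q ⊆ arsinhDomain) :
    ∃ C : ℝ, 0 ≤ C ∧ ∀ q ∈ Q, ∀ N : ℕ,
      ‖ampMean (stairOrder N) N q - 1 - corr N * (2 * q ^ 2)‖ ≤ C / (N + 1) ^ 2 := by
  obtain ⟨C1, h10, h1⟩ := ampMean_estimate (2 / 3) hQ hQd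
  obtain ⟨C2, h20, h2⟩ := ampMean_estimate (1 / 3) hQ hQd
  obtain ⟨R, hR⟩ := hQ.isBounded.exists_norm_le
  refine ⟨(C1 + C2) * (max R 0) ^ 4, by positivity, fun q hq N => ?_⟩
  have hqR : ‖q‖ ≤ max R 0 := (hR q hq).trans (le_max_left _ _)
  have e : ∀ κ : ℂ, (κ ^ 2 - 1 / 4) / (2 * N + 3) * (2 * q ^ 2) =
      (2 * κ ^ 2 - 1 / 2) / (2 * N + 3) * q ^ 2 := by intro κ; ring
  rw [corr, e, stairOrder]
  split_ifs
  · refine (h1 q hq N).trans ?_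
    gcongr
    linarith
  · refine (h2 q hq N).trans ?_
    gcongr
    linarith

theorem isCompact_sq_preimage {K : Set ℂ} (hK : IsCompact K) :
    IsCompact {q : ℂ | 2 * q ^ 2 ∈ K} := by
  refine Metric.isCompact_of_isClosed_isBounded (hK.isClosed.preimage (by fun_prop)) ?_
  obtain ⟨R, hR⟩ := hK.isBounded.exists_norm_le
  refine isBounded_iff_forall_norm_le.2 ⟨R + 1, fun q hq => ?_⟩
  have h := hR _ hq
  rw [norm_mul, norm_pow, Complex.norm_two] at h
  nlinarith [norm_nonneg q, sq_nonneg (‖q‖ - 1)]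

theorem exists_sq_mul_pow_le {θ : ℝ} (h0 : 0 ≤ θ) (h1 : θ < 1) :
    ∃ C : ℝ, 0 ≤ C ∧ ∀ N : ℕ, θ ^ N ≤ C / (N + 1) ^ 2 := by
  have ht : Tendsto (fun n : ℕ => ((n : ℝ) + 1) ^ 2 * θ ^ n) atTop (𝓝 0) := by
    have e1 := tendsto_pow_const_mul_const_pow_of_abs_lt_one 2 (r := θ) (by rwa [abs_of_nonneg h0])
    have e2 := tendsto_pow_const_mul_const_pow_of_abs_lt_one 1 (r := θ) (by rwa [abs_of_nonneg h0])
    have e3 := tendsto_pow_const_mul_const_pow_of_abs_lt_one 0 (r := θ) (by rwa [abs_of_nonneg h0])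
    have := (e1.add (e2.const_mul 2)).add e3
    simp only [mul_zero, add_zero] at this
    refine this.congr fun n => ?_
    ring
  obtain ⟨C, hC⟩ := ht.bddAbove_range
  refine ⟨C, ?_, fun N => ?_⟩
  · exact le_trans (by positivity) (hC ⟨0, rfl⟩)
  · rw [le_div_iff₀ (by positivity), mul_comm]
    exact hC ⟨N, rfl⟩

theorem continuous_profile : Continuous profile := by
  unfold profile; fun_prop

theorem continuous_sheet : Continuous sheet := by
  unfold sheet; fun_prop

/-- Beyond the lines Im t = ±π, within |Im t| < 3π/2, cosh t has negative real part. This makes the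
extra term decay and keeps its argument inside `arsinhDomain`. -/
theorem profile_re_lt {Y : ℂ} (hY : 0 < Y.re) (h : sheet Y < 0) : (profile Y).re < -1 := by
  have e : profile Y = (((Y.re ^ 3 - 3 * Y.re * Y.im ^ 2 - 3 * Y.re) / 2 - 1 : ℝ) : ℂ) +
      (((3 * Y.re ^ 2 * Y.im - Y.im ^ 3 - 3 * Y.im) / 2 : ℝ) : ℂ) * Complex.I := by
    rw [profile]
    conv_lhs => rw [← Complex.re_add_im Y]
    push_cast
    linear_combination ((3 * (Y.re : ℂ) * Y.im ^ 2 + Y.im ^ 3 * Complex.I) / 2) * Complex.I_sq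
  rw [e]
  simp only [Complex.add_re, Complex.ofReal_re, Complex.re_ofReal_mul, Complex.I_re]
  rw [sheet] at h
  have : Y.re * (Y.re ^ 2 - 3 * Y.im ^ 2 - 3) < 0 :=
    mul_neg_of_pos_of_neg hY (by nlinarith [sq_nonneg Y.im])
  nlinarith

/-- The asymptotics of `normAmp`, locally uniformly on `goodSet` and away from `2`. -/
theorem normAmp_estimate_aux {Y₀ : ℂ} (hY₀ : Y₀ ∈ goodSet) :
    ∃ C : ℝ, 0 ≤ C ∧ ∀ᶠ Y in 𝓝 Y₀, Y ≠ 2 → ∀ N : ℕ,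
      ‖normAmp N Y - 1 - corr N * profile Y‖ ≤ C / (N + 1) ^ 2 := by
  have o1 : ∀ᶠ Y in 𝓝 Y₀, 0 < Y.re := Complex.continuous_re.continuousAt.eventually_const_lt hY₀.1
  have o2 : ∀ᶠ Y in 𝓝 Y₀, 1 + profile Y / 2 ∈ Complex.slitPlane :=
    (((continuous_profile.div_const 2).const_add 1).continuousAt).eventually
      (Complex.isOpen_slitPlane.mem_nhds hY₀.2)
  have hdom : ∀ {K : Set ℂ}, (∀ p ∈ K, 1 + p / 2 ∈ Complex.slitPlane) →
      {q : ℂ | 2 * q ^ 2 ∈ K} ⊆ arsinhDomain := by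
    intro K hK q hq
    have := hK _ hq
    rwa [mul_div_cancel_left₀ _ two_ne_zero] at this
  rcases lt_or_gt_of_ne (sheet_ne_zero hY₀) with hs | hs
  · have o3 : ∀ᶠ Y in 𝓝 Y₀, sheet Y < 0 := continuous_sheet.continuousAt.eventually_lt_const hs
    obtain ⟨r, hr, hball⟩ := Metric.nhds_basis_closedBall.eventually_iff.1 (o1.and (o2.and o3))
    have hK := (isCompact_closedBall Y₀ r).image continuous_profile
    have hK' : IsCompact ((fun Y => -2 - profile Y) '' Metric.closedBall Y₀ r) :=
      (isCompact_closedBall Y₀ r).image (continuous_const.sub continuous_profile)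
    obtain ⟨C1, hC10, hC1⟩ := ampMean_stairOrder_estimate (isCompact_sq_preimage hK)
      (hdom (by rintro _ ⟨Y, hY, rfl⟩; exact (hball hY).2.1))
    obtain ⟨C2, hC20, hC2⟩ := ampMean_stairOrder_estimate (isCompact_sq_preimage hK')
      (hdom (by
        rintro _ ⟨Y, hY, rfl⟩
        have h := profile_re_lt (hball hY).1 (hball hY).2.2
        have e : 1 + (-2 - profile Y) / 2 = -profile Y / 2 := by ring
        change 1 + (-2 - profile Y) / 2 ∈ Complex.slitPlane
        rw [e, Complex.mem_slitPlane_iff]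
        left
        simp
        linarith))
    obtain ⟨R, hR⟩ := hK'.isBounded.exists_norm_le
    have hre : ∀ Y ∈ Metric.closedBall Y₀ r, (profile Y).re < -1 := fun Y hY =>
      profile_re_lt (hball hY).1 (hball hY).2.2
    have hp0 : ∀ Y ∈ Metric.closedBall Y₀ r, profile Y ≠ 0 := by
      intro Y hY h
      have := hre Y hY
      rw [h] at this
      norm_num at this
    -- For p = `profile Y` with Re p < -1 one has |-2 - p| < |p|. The maximum of the quotient over
    -- the compact ball is therefore a uniform θ < 1, which controls (q'/q)^(2N+1).
    obtain ⟨Ym, hYm, hmax⟩ := (isCompact_closedBall Y₀ r).exists_isMaxOn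
      ⟨Y₀, Metric.mem_closedBall_self hr.le⟩
      (f := fun Y => ‖-2 - profile Y‖ / ‖profile Y‖)
      (ContinuousOn.div (continuous_const.sub continuous_profile).norm.continuousOn
        continuous_profile.norm.continuousOn fun Y hY => norm_ne_zero_iff.2 (hp0 Y hY))
    set θ := ‖-2 - profile Ym‖ / ‖profile Ym‖ with hθ
    have hθ0 : 0 ≤ θ := by positivity
    have hθ1 : θ < 1 := by
      rw [hθ, div_lt_one (norm_pos_iff.2 (hp0 Ym hYm))]
      have h := hre Ym hYm
      rw [← sq_lt_sq₀ (norm_nonneg _) (norm_nonneg _), Complex.sq_norm, Complex.sq_norm,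
        Complex.normSq_apply, Complex.normSq_apply]
      simp
      nlinarith
    obtain ⟨C3, hC30, hC3⟩ := exists_sq_mul_pow_le hθ0 hθ1
    refine ⟨C1 + C3 * (C2 + 1 + max R 0), by positivity, ?_⟩
    filter_upwards [Metric.closedBall_mem_nhds Y₀ hr] with Y hY _ N
    obtain ⟨q, q', hq, hq', heq⟩ := exists_normAmp_eq_of_sheet_neg (hball hY).1 (hball hY).2.2
      (hp0 Y hY)
    have b1 := hC1 q ⟨Y, hY, hq.symm⟩ N
    have b2 := hC2 q' ⟨Y, hY, hq'.symm⟩ N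
    rw [hq] at b1
    rw [hq'] at b2
    have hN1 : (1 : ℝ) ≤ (N : ℝ) + 1 := by
      have : (0 : ℝ) ≤ N := Nat.cast_nonneg N
      linarith
    have b3 : ‖ampMean (stairOrder N) N q'‖ ≤ C2 + 1 + max R 0 := by
      have e : ampMean (stairOrder N) N q' = (ampMean (stairOrder N) N q' - 1 -
        corr N * (-2 - profile Y)) + (1 + corr N * (-2 - profile Y)) := by ring
      rw [e]
      have c1 : C2 / ((N : ℝ) + 1) ^ 2 ≤ C2 := div_le_self hC20 (one_le_pow₀ hN1)
      have c2 : ‖corr N * (-2 - profile Y)‖ ≤ max R 0 := by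
        rw [norm_mul]
        have d1 : ‖corr N‖ ≤ 1 := (norm_corr_le N).trans (div_le_self zero_le_one hN1)
        have d2 : ‖-2 - profile Y‖ ≤ max R 0 := (hR _ ⟨Y, hY, rfl⟩).trans (le_max_left _ _)
        calc _ ≤ 1 * max R 0 := by gcongr
          _ = _ := one_mul _
      calc _ ≤ _ := norm_add_le _ _
        _ ≤ C2 + (1 + max R 0) := by
          refine add_le_add (b2.trans c1) ((norm_add_le _ _).trans ?_)
          rw [norm_one]
          linarith
        _ = _ := by ring
    have b4 : ‖(q' / q) ^ (2 * N + 1)‖ ≤ C3 / (N + 1) ^ 2 := by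
      have hsq : ‖q' / q‖ ^ 2 ≤ θ := by
        have : ‖q' / q‖ ^ 2 = ‖-2 - profile Y‖ / ‖profile Y‖ := by
          rw [← hq', ← hq, norm_mul, norm_mul, norm_pow, norm_pow, norm_div, div_pow,
            mul_div_mul_left _ _ (by simp : ‖(2 : ℂ)‖ ≠ 0)]
        rw [this]
        exact hmax hY
      have hle : ‖q' / q‖ ≤ 1 := by
        rw [← sq_le_one_iff₀ (norm_nonneg _)]
        linarith
      refine le_trans ?_ (hC3 N)
      rw [norm_pow, pow_succ, pow_mul]
      calc (‖q' / q‖ ^ 2) ^ N * ‖q' / q‖ ≤ (‖q' / q‖ ^ 2) ^ N * 1 := by gcongr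
        _ ≤ θ ^ N := by rw [mul_one]; gcongr
    rw [heq N]
    have e : ampMean (stairOrder N) N q + (q' / q) ^ (2 * N + 1) * ampMean (stairOrder N) N q' - 1
        - corr N * profile Y = (ampMean (stairOrder N) N q - 1 - corr N * profile Y) +
        (q' / q) ^ (2 * N + 1) * ampMean (stairOrder N) N q' := by ring
    rw [e]
    calc _ ≤ _ := norm_add_le _ _
      _ ≤ C1 / (N + 1) ^ 2 + C3 / (N + 1) ^ 2 * (C2 + 1 + max R 0) := by
        rw [norm_mul]
        gcongr
      _ = _ := by ring
  · have o3 : ∀ᶠ Y in 𝓝 Y₀, 0 < sheet Y := continuous_sheet.continuousAt.eventually_const_lt hs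
    obtain ⟨r, hr, hball⟩ := Metric.nhds_basis_closedBall.eventually_iff.1 (o1.and (o2.and o3))
    have hK := (isCompact_closedBall Y₀ r).image continuous_profile
    obtain ⟨C, hC0, hC⟩ := ampMean_stairOrder_estimate (isCompact_sq_preimage hK)
      (hdom (by rintro _ ⟨Y, hY, rfl⟩; exact (hball hY).2.1))
    refine ⟨C, hC0, ?_⟩
    filter_upwards [Metric.closedBall_mem_nhds Y₀ hr] with Y hY hY2 N
    obtain ⟨q, hq, heq⟩ := exists_normAmp_eq_of_sheet_pos (hball hY).1 (hball hY).2.2 hY2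
    rw [heq N, ← hq]
    exact hC q ⟨Y, hY, hq.symm⟩ N

/-- The asymptotics of `normAmp`, locally uniformly on `goodSet`. -/
theorem normAmp_estimate {Y₀ : ℂ} (hY₀ : Y₀ ∈ goodSet) :
    ∃ C : ℝ, 0 ≤ C ∧ ∀ᶠ Y in 𝓝 Y₀, ∀ N : ℕ,
      ‖normAmp N Y - 1 - corr N * profile Y‖ ≤ C / (N + 1) ^ 2 := by
  obtain ⟨C, hC0, hC⟩ := normAmp_estimate_aux hY₀
  refine ⟨C, hC0, ?_⟩
  have o1 : ∀ᶠ Y in 𝓝 Y₀, 0 < Y.re := Complex.continuous_re.continuousAt.eventually_const_lt hY₀.1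
  filter_upwards [eventually_eventually_nhds.2 hC, o1] with Y hY hYre N
  have hcont : ContinuousAt (fun Y => ‖normAmp N Y - 1 - corr N * profile Y‖) Y :=
    (((differentiableAt_normAmp N hYre).continuousAt.sub continuousAt_const).sub
      (continuous_profile.continuousAt.const_mul _)).norm
  -- The exceptional value Y = 2, where t = 0 and the sine sum cannot be divided out, is recovered
  -- by continuity from punctured neighbourhoods.
  refine le_of_tendsto (hcont.tendsto.mono_left nhdsWithin_le_nhds : Tendsto _ (𝓝[≠] Y) _) ?_
  by_cases h2 : Y = 2
  · filter_upwards [nhdsWithin_le_nhds hY, self_mem_nhdsWithin] with Y' h hne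
    exact h (by rw [← h2]; exact hne) N
  · filter_upwards [nhdsWithin_le_nhds hY, nhdsWithin_le_nhds (isOpen_ne.mem_nhds h2)] with Y' h hne
    exact h hne N

/-! ### Perturbation of determinants and the maximum principle. -/

/-- The maximum principle on a polydisc. -/
theorem norm_le_of_forall_torus {k : ℕ} {F : (Fin k → ℂ) → ℂ} {c : Fin k → ℂ} {r : Fin k → ℝ}
    {M : ℝ} (hr : ∀ i, 0 < r i)
    (hF : ∀ Y : Fin k → ℂ, (∀ i, Y i ∈ Metric.closedBall (c i) (r i)) → DifferentiableAt ℂ F Y)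
    (hT : ∀ Y : Fin k → ℂ, (∀ i, Y i ∈ Metric.sphere (c i) (r i)) → ‖F Y‖ ≤ M)
    {Y : Fin k → ℂ} (hY : ∀ i, Y i ∈ Metric.closedBall (c i) (r i)) : ‖F Y‖ ≤ M := by
  -- The finite set s records the coordinates allowed off their circles; each induction step frees
  -- one more by the maximum principle in a single variable.
  suffices h : ∀ (s : Finset (Fin k)) (Y : Fin k → ℂ),
      (∀ i, Y i ∈ Metric.closedBall (c i) (r i)) →
      (∀ i, i ∉ s → Y i ∈ Metric.sphere (c i) (r i)) → ‖F Y‖ ≤ M from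
    h Finset.univ Y hY fun i hi => absurd (Finset.mem_univ i) hi
  intro s
  induction s using Finset.induction_on with
  | empty => intro Y _ h2; exact hT Y fun i => h2 i (Finset.notMem_empty i)
  | insert a s ha ih =>
    intro Y h1 h2
    have hup : ∀ t ∈ Metric.closedBall (c a) (r a), ∀ i,
        Function.update Y a t i ∈ Metric.closedBall (c i) (r i) := by
      intro t ht i
      by_cases hi : i = a
      · subst hi; simpa using ht
      · simpa [hi] using h1 i
    have hd : DifferentiableOn ℂ (fun t => F (Function.update Y a t))
        (Metric.closedBall (c a) (r a)) := by
      intro t ht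
      refine DifferentiableAt.differentiableWithinAt ?_
      exact (hF _ (hup t ht)).comp t (hasFDerivAt_update Y t).differentiableAt
    have h3 := Complex.norm_le_of_forall_mem_frontier_norm_le (C := M) Metric.isBounded_ball
      (hd.diffContOnCl_ball subset_rfl) (z := Y a) (by
        intro t ht
        rw [frontier_ball _ (hr a).ne'] at ht
        refine ih _ (hup t (Metric.sphere_subset_closedBall ht)) fun i hi => ?_
        by_cases hia : i = a
        · subst hia; simpa using ht
        · rw [Function.update_of_ne hia]
          exact h2 i (by simp [hia, hi]))
      (by rw [closure_ball _ (hr a).ne']; exact h1 a)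
    simpa using h3

/-- The first-order expansion of a determinant near the identity matrix. -/
theorem exists_norm_det_one_add_sub_le (k : ℕ) : ∃ C : ℝ, 0 ≤ C ∧
    ∀ (M : Matrix (Fin k) (Fin k) ℂ) (δ : ℝ), 0 < δ → δ ≤ 1 → (∀ i j, ‖M i j‖ ≤ δ) →
      ‖(1 + M).det - 1 - M.trace‖ ≤ C * δ ^ 2 := by
  -- A bound for |det(1 + xB) - 1 - x tr B| on |x| = 1 when the entries of B are at most 1: the
  -- determinant has entries of size at most 2, and |tr B| ≤ k.
  refine ⟨(Fintype.card (Fin k)).factorial • (2 : ℝ) ^ Fintype.card (Fin k) + 1 + k,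
    by positivity, ?_⟩
  intro M δ h0 h1 hM
  have hδ : (δ : ℂ) ≠ 0 := by exact_mod_cast h0.ne'
  set B : Matrix (Fin k) (Fin k) ℂ := (δ : ℂ)⁻¹ • M with hB
  have hMB : M = (δ : ℂ) • B := by rw [hB, smul_smul, mul_inv_cancel₀ hδ, one_smul]
  have hBn : ∀ i j, ‖B i j‖ ≤ 1 := by
    intro i j
    rw [hB, Matrix.smul_apply, smul_eq_mul, norm_mul, norm_inv, Complex.norm_real,
      Real.norm_of_nonneg h0.le, inv_mul_le_iff₀ h0, mul_one]
    exact hM i j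
  have htr : ‖B.trace‖ ≤ k := by
    rw [Matrix.trace]
    refine (norm_sum_le _ _).trans ?_
    calc ∑ i, ‖B.diag i‖ ≤ ∑ _i : Fin k, (1 : ℝ) := Finset.sum_le_sum fun i _ => hBn i i
      _ = k := by simp
  set Q := (Matrix.det (1 + (Polynomial.X : Polynomial ℂ) • B.map Polynomial.C)).divX.divX with hQ
  have hdet : ∀ x : ℂ, (1 + x • B).det = 1 + B.trace * x + Q.eval x * x ^ 2 := fun x =>
    Matrix.det_one_add_smul x B
  have hbd : ∀ x : ℂ, ‖x‖ = 1 → ‖Q.eval x‖ ≤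
      (Fintype.card (Fin k)).factorial • (2 : ℝ) ^ Fintype.card (Fin k) + 1 + k := by
    intro x hx
    have e : ‖Q.eval x‖ = ‖(1 + x • B).det - 1 - B.trace * x‖ := by
      have e' : (1 + x • B).det - 1 - B.trace * x = Q.eval x * x ^ 2 := by rw [hdet x]; ring
      rw [e', norm_mul, norm_pow, hx]
      simp
    have hd : ‖(1 + x • B).det‖ ≤
        (Fintype.card (Fin k)).factorial • (2 : ℝ) ^ Fintype.card (Fin k) := by
      refine Matrix.det_le (abv := NormedField.toAbsoluteValue ℂ) fun i j => ?_
      change ‖(1 + x • B) i j‖ ≤ 2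
      rw [Matrix.add_apply, Matrix.smul_apply, smul_eq_mul]
      refine (norm_add_le _ _).trans ?_
      rw [norm_mul, hx, one_mul]
      have : ‖(1 : Matrix (Fin k) (Fin k) ℂ) i j‖ ≤ 1 := by
        rw [Matrix.one_apply]; split_ifs <;> simp
      linarith [hBn i j]
    rw [e]
    refine (norm_sub_le _ _).trans (add_le_add ((norm_sub_le _ _).trans ?_) ?_)
    · rw [norm_one]; linarith
    · rw [norm_mul, hx, mul_one]; exact htr
  -- The second-order remainder Q is a polynomial, so its bound on the unit circle carries over to
  -- the point δ inside.
  have hQδ : ‖Q.eval (δ : ℂ)‖ ≤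
      (Fintype.card (Fin k)).factorial • (2 : ℝ) ^ Fintype.card (Fin k) + 1 + k := by
    refine Complex.norm_le_of_forall_mem_frontier_norm_le (U := Metric.ball (0 : ℂ) 1)
      (f := fun x => Q.eval x) Metric.isBounded_ball Q.differentiable.diffContOnCl ?_ ?_
    · intro x hx
      rw [frontier_ball _ one_ne_zero] at hx
      exact hbd x (by simpa using hx)
    · rw [closure_ball _ one_ne_zero]
      simp [abs_of_pos h0, h1]
  have htr2 : M.trace = B.trace * δ := by
    rw [hMB, Matrix.trace_smul, smul_eq_mul, mul_comm]
  have e : (1 + M).det - 1 - M.trace = Q.eval (δ : ℂ) * (δ : ℂ) ^ 2 := by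
    rw [htr2, hMB, hdet]; ring
  rw [e, norm_mul, norm_pow, Complex.norm_real, Real.norm_of_nonneg h0.le]
  gcongr

/-- First-order asymptotics of a determinant that is a perturbation of a Vandermonde determinant,
uniformly on a compact set. -/
theorem vandermonde_det_estimate {k : ℕ} {T : Set (Fin (k + 1) → ℂ)} (hT : IsCompact T)
    {p : ℂ → ℂ} (hp : Continuous p) (hinj : ∀ Y ∈ T, Function.Injective fun i => p (Y i))
    {J : ℕ → ℂ → ℂ} {a : ℕ → ℂ} {C : ℝ} (hC : 0 ≤ C) (ha : ∀ N : ℕ, ‖a N‖ ≤ 1 / (N + 1))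
    (hJ : ∀ Y ∈ T, ∀ i, ∀ N : ℕ, ‖J N (Y i) - 1 - a N * p (Y i)‖ ≤ C / (N + 1) ^ 2) :
    ∃ C' : ℝ, 0 ≤ C' ∧ ∀ᶠ m : ℕ in atTop, ∀ Y ∈ T,
      ‖(Matrix.of fun i j : Fin (k + 1) => p (Y i) ^ (j : ℕ) * J (m + j) (Y i)).det /
          (Matrix.vandermonde fun i => p (Y i)).det - 1 - a (m + k) * ∑ i, p (Y i)‖ ≤
        C' / (m + 1) ^ 2 := by
  let A : (Fin (k + 1) → ℂ) → Matrix (Fin (k + 1)) (Fin (k + 1)) ℂ := fun Y =>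
    Matrix.vandermonde fun i => p (Y i)
  let V : (Fin (k + 1) → ℂ) → Matrix (Fin (k + 1)) (Fin (k + 1)) ℂ := fun Y =>
    (A Y).det⁻¹ • (A Y).adjugate
  have hA0 : ∀ Y ∈ T, (A Y).det ≠ 0 := fun Y hY => Matrix.det_vandermonde_ne_zero_iff.2 (hinj Y hY)
  have hVA : ∀ Y ∈ T, V Y * A Y = 1 := by
    intro Y hY
    simp only [V]
    rw [Matrix.smul_mul, Matrix.adjugate_mul, smul_smul, inv_mul_cancel₀ (hA0 Y hY), one_smul]
  have hAc : Continuous A := by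
    refine continuous_matrix fun i j => ?_
    simp only [A, Matrix.vandermonde_apply]
    fun_prop
  have hVc : ContinuousOn V T := fun Y hY =>
    ((hAc.matrix_det.continuousAt.inv₀ (hA0 Y hY)).smul
      hAc.matrix_adjugate.continuousAt).continuousWithinAt
  obtain ⟨D, hD⟩ := hT.exists_bound_of_continuousOn
    (f := fun Y => (∑ i, ∑ j, ‖V Y i j‖) + (∑ i, ∑ j, ‖A Y i j‖) + ∑ i, ‖p (Y i)‖) (by
      refine ContinuousOn.add (ContinuousOn.add ?_ ?_) ?_
      · exact continuousOn_finsetSum _ fun i _ => continuousOn_finsetSum _ fun j _ =>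
          (((continuous_apply_apply i j).comp_continuousOn hVc).norm)
      · exact continuousOn_finsetSum _ fun i _ => continuousOn_finsetSum _ fun j _ =>
          (((continuous_apply_apply i j).comp hAc).norm).continuousOn
      · exact Continuous.continuousOn (by fun_prop))
  have hsum : ∀ (f : Fin (k + 1) → Fin (k + 1) → ℝ), (∀ i j, 0 ≤ f i j) → ∀ i j,
      f i j ≤ ∑ i, ∑ j, f i j := fun f hf i j =>
    (Finset.single_le_sum (f := fun j => f i j) (fun j _ => hf i j) (Finset.mem_univ j)).trans
      (Finset.single_le_sum (f := fun i => ∑ j, f i j)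
        (fun i _ => Finset.sum_nonneg fun j _ => hf i j) (Finset.mem_univ i))
  have hbd : ∀ Y ∈ T, (∀ i j, ‖V Y i j‖ ≤ max D 0) ∧ (∀ i j, ‖A Y i j‖ ≤ max D 0) ∧
      ∀ i, ‖p (Y i)‖ ≤ max D 0 := by
    intro Y hY
    have h := (Real.le_norm_self _).trans (hD Y hY)
    have n1 : 0 ≤ ∑ i, ∑ j, ‖V Y i j‖ := by positivity
    have n2 : 0 ≤ ∑ i, ∑ j, ‖A Y i j‖ := by positivity
    have n3 : 0 ≤ ∑ i, ‖p (Y i)‖ := by positivity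
    have hm := le_max_left D 0
    refine ⟨fun i j => ?_, fun i j => ?_, fun i => ?_⟩
    · have := hsum (fun i j => ‖V Y i j‖) (fun _ _ => norm_nonneg _) i j
      linarith
    · have := hsum (fun i j => ‖A Y i j‖) (fun _ _ => norm_nonneg _) i j
      linarith
    · have := Finset.single_le_sum (f := fun i => ‖p (Y i)‖) (fun i _ => norm_nonneg _)
        (Finset.mem_univ i)
      linarith
  set B := max D 0 with hBdef
  have hB0 : 0 ≤ B := le_max_right _ _
  obtain ⟨K, hK0, hK⟩ := exists_norm_det_one_add_sub_le (k + 1)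
  set S : ℝ := (k + 1) * (B * (B * (B + C))) + 1 with hS
  have hS0 : 0 < S := by positivity
  refine ⟨K * S ^ 2 + (k + 1) * ((k + 1) * (B * (B * C))), by positivity, ?_⟩
  filter_upwards [eventually_ge_atTop ⌈S⌉₊] with m hm Y hY
  obtain ⟨bV, bA, bp⟩ := hbd Y hY
  have hm1 : (0 : ℝ) < (m : ℝ) + 1 := by positivity
  have hSm : S / (m + 1) ≤ 1 := by
    rw [div_le_one hm1]
    have := (Nat.le_ceil S).trans (Nat.cast_le.2 hm)
    linarith
  let E : Matrix (Fin (k + 1)) (Fin (k + 1)) ℂ :=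
    Matrix.of fun i j => A Y i j * (J (m + j) (Y i) - 1)
  have hAE : (Matrix.of fun i j : Fin (k + 1) => p (Y i) ^ (j : ℕ) * J (m + j) (Y i)) =
      A Y + E := by
    ext i j
    simp only [Matrix.add_apply, E, Matrix.of_apply, A, Matrix.vandermonde_apply]
    ring
  have hmj : ∀ j : Fin (k + 1), (m : ℝ) + 1 ≤ ((m + j : ℕ) : ℝ) + 1 := by
    intro j
    push_cast
    have : (0 : ℝ) ≤ ((j : ℕ) : ℝ) := Nat.cast_nonneg _
    linarith
  have herr : ∀ i j : Fin (k + 1), ‖J (m + j) (Y i) - 1 - a (m + j) * p (Y i)‖ ≤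
      C / (m + 1) ^ 2 := fun i j => (hJ Y hY i (m + j)).trans (by
        have := hmj j
        gcongr)
  have haj : ∀ j : Fin (k + 1), ‖a (m + j)‖ ≤ 1 / (m + 1) := fun j =>
    (ha (m + j)).trans (one_div_le_one_div_of_le hm1 (hmj j))
  have hJ1 : ∀ i j : Fin (k + 1), ‖J (m + j) (Y i) - 1‖ ≤ (B + C) / (m + 1) := by
    intro i j
    have e : J (m + j) (Y i) - 1 = a (m + j) * p (Y i) +
      (J (m + j) (Y i) - 1 - a (m + j) * p (Y i)) := by ring
    rw [e]
    refine (norm_add_le _ _).trans ?_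
    rw [norm_mul, add_div]
    refine add_le_add ?_ ((herr i j).trans ?_)
    · calc _ ≤ 1 / ((m : ℝ) + 1) * B := mul_le_mul (haj j) (bp i) (norm_nonneg _) (by positivity)
        _ = _ := by ring
    · refine div_le_div_of_nonneg_left hC hm1 ?_
      nlinarith
  have hE : ∀ i j, ‖E i j‖ ≤ B * ((B + C) / (m + 1)) := by
    intro i j
    simp only [E, Matrix.of_apply, norm_mul]
    exact mul_le_mul (bA i j) (hJ1 i j) (norm_nonneg _) hB0
  have hVE : ∀ i j, ‖(V Y * E) i j‖ ≤ S / (m + 1) := by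
    intro i j
    rw [Matrix.mul_apply]
    refine (norm_sum_le _ _).trans ?_
    calc ∑ l, ‖V Y i l * E l j‖ ≤ ∑ _l : Fin (k + 1), B * (B * ((B + C) / (m + 1))) := by
          refine Finset.sum_le_sum fun l _ => ?_
          rw [norm_mul]
          exact mul_le_mul (bV i l) (hE l j) (norm_nonneg _) hB0
      _ = (k + 1) * (B * (B * (B + C))) / (m + 1) := by
          rw [Finset.sum_const, Finset.card_univ, Fintype.card_fin, nsmul_eq_mul]
          push_cast
          ring
      _ ≤ S / (m + 1) := by
          gcongr
          rw [hS]
          linarith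
  have hdet : (Matrix.of fun i j : Fin (k + 1) => p (Y i) ^ (j : ℕ) * J (m + j) (Y i)).det /
      (A Y).det = (1 + V Y * E).det := by
    rw [hAE, div_eq_iff (hA0 Y hY), ← hVA Y hY, ← Matrix.mul_add, Matrix.det_mul]
    have : (V Y).det * (A Y).det = 1 := by
      rw [← Matrix.det_mul, hVA Y hY, Matrix.det_one]
    linear_combination -(A Y + E).det * this
  have hmain := hK (V Y * E) (S / (m + 1)) (by positivity) hSm hVE
  rw [← hdet] at hmain
  have htr : ‖(V Y * E).trace - a (m + k) * ∑ i, p (Y i)‖ ≤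
      (k + 1) * ((k + 1) * (B * (B * C))) / (m + 1) ^ 2 := by
    -- G i is the i-th diagonal entry of V · diag(p) · A with V = A⁻¹. Multiplying a Vandermonde
    -- column by p gives the next column, so the entry vanishes except in the last column. The total
    -- is the trace, ∑ p(Y_i), which leaves only the coefficient of index m + k.
    let G : Fin (k + 1) → ℂ := fun i => ∑ l, V Y i l * (A Y l i * p (Y l))
    have hG0 : ∀ i, i ≠ Fin.last k → G i = 0 := by
      intro i hi
      obtain ⟨i', rfl⟩ := Fin.exists_castSucc_eq.2 hi
      have h1 : G i'.castSucc = (V Y * A Y) i'.castSucc i'.succ := by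
        rw [Matrix.mul_apply]
        refine Finset.sum_congr rfl fun l _ => ?_
        simp only [A, Matrix.vandermonde_apply, Fin.val_castSucc, Fin.val_succ, pow_succ]
      rw [h1, hVA Y hY, Matrix.one_apply_ne (Fin.castSucc_lt_succ).ne]
    have hGs : ∑ i, G i = ∑ i, p (Y i) := by
      have h1 : A Y * V Y = 1 := mul_eq_one_comm.1 (hVA Y hY)
      have h2 : ∀ l, ∑ i, V Y i l * (A Y l i * p (Y l)) = p (Y l) := by
        intro l
        have h3 := congrFun (congrFun h1 l) l
        rw [Matrix.mul_apply, Matrix.one_apply_eq] at h3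
        calc _ = (∑ i, A Y l i * V Y i l) * p (Y l) := by
              rw [Finset.sum_mul]
              exact Finset.sum_congr rfl fun i _ => by ring
          _ = _ := by rw [h3, one_mul]
      simp only [G]
      rw [Finset.sum_comm]
      exact Finset.sum_congr rfl fun l _ => h2 l
    have hGa : ∑ i : Fin (k + 1), a (m + i) * G i = a (m + k) * ∑ i, p (Y i) := by
      rw [← hGs, Finset.mul_sum]
      refine Finset.sum_congr rfl fun i _ => ?_
      by_cases hi : i = Fin.last k
      · rw [hi, Fin.val_last]
      · rw [hG0 i hi, mul_zero, mul_zero]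
    have e : (V Y * E).trace - a (m + k) * ∑ i, p (Y i) = ∑ i : Fin (k + 1), ∑ l : Fin (k + 1),
        V Y i l * (A Y l i * (J (m + i) (Y l) - 1 - a (m + i) * p (Y l))) := by
      rw [← hGa, Matrix.trace, ← Finset.sum_sub_distrib]
      refine Finset.sum_congr rfl fun i _ => ?_
      rw [Matrix.diag_apply, Matrix.mul_apply, Finset.mul_sum, ← Finset.sum_sub_distrib]
      refine Finset.sum_congr rfl fun l _ => ?_
      simp only [E, Matrix.of_apply]
      ring
    rw [e]
    refine (norm_sum_le _ _).trans ?_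
    calc _ ≤ ∑ _i : Fin (k + 1), ∑ _l : Fin (k + 1), B * (B * (C / (m + 1) ^ 2)) := by
          refine Finset.sum_le_sum fun i _ => (norm_sum_le _ _).trans
            (Finset.sum_le_sum fun l _ => ?_)
          rw [norm_mul, norm_mul]
          exact mul_le_mul (bV i l) (mul_le_mul (bA l i) (herr l i) (norm_nonneg _) hB0)
            (by positivity) hB0
      _ = _ := by
          simp only [Finset.sum_const, Finset.card_univ, Fintype.card_fin, nsmul_eq_mul]
          push_cast
          ring
  have e : (Matrix.of fun i j : Fin (k + 1) => p (Y i) ^ (j : ℕ) * J (m + j) (Y i)).det /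
          (A Y).det - 1 - a (m + k) * ∑ i, p (Y i) =
      ((Matrix.of fun i j : Fin (k + 1) => p (Y i) ^ (j : ℕ) * J (m + j) (Y i)).det /
          (A Y).det - 1 - (V Y * E).trace) +
        ((V Y * E).trace - a (m + k) * ∑ i, p (Y i)) := by ring
  change ‖_ / (A Y).det - 1 - _‖ ≤ _
  rw [e]
  refine (norm_add_le _ _).trans ((add_le_add hmain htr).trans (le_of_eq ?_))
  rw [div_pow]
  ring

/-! ### Multivariate asymptotics of the character. -/

/-- The quotient `(cosh t - cosh t') / (2 cosh (2 t / 3) - 2 cosh (2 t' / 3))` in terms of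
`x = 2 cosh (t / 3)` and `y = 2 cosh (t' / 3)`. -/
def resonance (x y : ℂ) : ℂ := (x ^ 2 + x * y + y ^ 2 - 3) / (2 * (x + y))

theorem add_ne_zero_of_re_pos_of_re_pos {x y : ℂ} (hx : 0 < x.re) (hy : 0 < y.re) : x + y ≠ 0 :=
  ne_zero_of_re_pos (by simpa using add_pos hx hy)

theorem resonance_comm (x y : ℂ) : resonance x y = resonance y x := by
  rw [resonance, resonance, add_comm x y]
  congr 1
  ring

theorem resonance_mul {x y : ℂ} (hx : 0 < x.re) (hy : 0 < y.re) :
    resonance x y * ((x ^ 2 - 2) - (y ^ 2 - 2)) = profile x - profile y := by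
  have := add_ne_zero_of_re_pos_of_re_pos hx hy
  rw [resonance, profile, profile]
  field_simp
  ring

/-- The leading asymptotics of the character with `m` coordinates equal to `1`. -/
def leadingTerm (m : ℕ) {n : ℕ} (Y : Fin n → ℂ) : ℂ :=
  (∏ j : Fin n, 4 * (moment 0 (m + j) : ℂ)) * (∏ i, prefactor (Y i) * growth (Y i) ^ m) *
    ∏ i : Fin n, ∏ j ∈ Finset.Ioi i, resonance (Y j) (Y i)

/-- The character with `m` coordinates equal to `1`, in the variables `Y = z + z⁻¹`. -/
def reducedChar (m : ℕ) {n : ℕ} (Y : Fin n → ℂ) : ℂ :=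
  MvPolynomial.eval (fun i => Y i ^ 2 - 2)
    (altQuot (fun j => (Polynomial.X - Polynomial.C 2) ^ j * stairQuot (m + j)) n)

theorem stairQuot_eval (N : ℕ) {Y : ℂ} (hY : 0 < Y.re) :
    (stairQuot N).eval (Y ^ 2 - 2) =
      4 * moment 0 N * prefactor Y * growth Y ^ N * normAmp N Y := by
  rw [normAmp, mul_div_cancel₀ _ (normAmp_denom_ne_zero N hY)]

/-- Since (Y² - 4) · `growth Y` = `profile Y`, the powers of X - 2 combine with the growth factors
into powers of `profile`. The Vandermonde determinants in `profile` and in X differ by the product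
of resonances. The product form avoids division where variables coincide. -/
theorem reducedChar_mul (m : ℕ) {n : ℕ} {Y : Fin n → ℂ} (hY : ∀ i, 0 < (Y i).re) :
    reducedChar m Y * (Matrix.vandermonde fun i => profile (Y i)).det =
      leadingTerm m Y *
        (Matrix.of fun i j : Fin n => profile (Y i) ^ (j : ℕ) * normAmp (m + j) (Y i)).det := by
  have h1 := altQuot_mul (fun j => (Polynomial.X - Polynomial.C 2) ^ j * stairQuot (m + j))
    (fun i => Y i ^ 2 - 2)
  have h2 : (valueMatrix (fun j => (Polynomial.X - Polynomial.C 2) ^ j * stairQuot (m + j))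
      (fun i => Y i ^ 2 - 2)).det = (∏ j : Fin n, 4 * (moment 0 (m + j) : ℂ)) *
      ((∏ i, prefactor (Y i) * growth (Y i) ^ m) *
        (Matrix.of fun i j : Fin n => profile (Y i) ^ (j : ℕ) * normAmp (m + j) (Y i)).det) := by
    rw [← Matrix.det_mul_column, ← Matrix.det_mul_row]
    congr 1
    ext i j
    simp only [valueMatrix, Matrix.of_apply, Polynomial.eval_mul, Polynomial.eval_pow,
      Polynomial.eval_sub, Polynomial.eval_X, Polynomial.eval_C]
    rw [stairQuot_eval _ (hY i), ← sub_mul_growth (hY i), sub_sub,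
      show (2 + 2 : ℂ) = 4 by norm_num, mul_pow, pow_add]
    ring
  have h3 : (Matrix.vandermonde fun i => profile (Y i)).det =
      (∏ i : Fin n, ∏ j ∈ Finset.Ioi i, resonance (Y j) (Y i)) *
        (Matrix.vandermonde fun i => Y i ^ 2 - 2).det := by
    rw [Matrix.det_vandermonde, Matrix.det_vandermonde, ← Finset.prod_mul_distrib]
    refine Finset.prod_congr rfl fun i _ => ?_
    rw [← Finset.prod_mul_distrib]
    exact Finset.prod_congr rfl fun j _ => (resonance_mul (hY j) (hY i)).symm
  rw [h2] at h1
  rw [h3, leadingTerm, reducedChar]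
  linear_combination (∏ i : Fin n, ∏ j ∈ Finset.Ioi i, resonance (Y j) (Y i)) * h1

theorem leadingTerm_ne_zero (m : ℕ) {n : ℕ} {Y : Fin n → ℂ} (hY : ∀ i, 0 < (Y i).re)
    (hr : ∀ i j, i ≠ j → resonance (Y i) (Y j) ≠ 0) : leadingTerm m Y ≠ 0 := by
  refine mul_ne_zero (mul_ne_zero ?_ ?_) ?_
  · refine Finset.prod_ne_zero_iff.2 fun j _ => mul_ne_zero (by norm_num) ?_
    exact_mod_cast (moment_zero_pos _).ne'
  · exact Finset.prod_ne_zero_iff.2 fun i _ =>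
      mul_ne_zero (prefactor_ne_zero (hY i)) (pow_ne_zero _ (growth_ne_zero (hY i)))
  · refine Finset.prod_ne_zero_iff.2 fun i _ => Finset.prod_ne_zero_iff.2 fun j hj => hr _ _ ?_
    exact (Finset.mem_Ioi.1 hj).ne'

theorem differentiable_reducedChar (m n : ℕ) :
    Differentiable ℂ (reducedChar m : (Fin n → ℂ) → ℂ) := by
  have h := AnalyticOnNhd.eval_mvPolynomial (𝕜 := ℂ)
    (altQuot (fun j => (Polynomial.X - Polynomial.C 2) ^ j * stairQuot (m + j)) n)
  have h1 : Differentiable ℂ fun x : Fin n → ℂ => MvPolynomial.eval x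
      (altQuot (fun j => (Polynomial.X - Polynomial.C 2) ^ j * stairQuot (m + j)) n) :=
    fun x => (h x (Set.mem_univ x)).differentiableAt
  exact h1.comp (by fun_prop : Differentiable ℂ fun (Y : Fin n → ℂ) i => Y i ^ 2 - 2)

theorem differentiableAt_prod {E ι : Type*} [NormedAddCommGroup E] [NormedSpace ℂ E]
    {s : Finset ι} {f : ι → E → ℂ} {x : E} (h : ∀ i ∈ s, DifferentiableAt ℂ (f i) x) :
    DifferentiableAt ℂ (fun x => ∏ i ∈ s, f i x) x := by
  classical
  induction s using Finset.induction_on with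
  | empty => simp
  | insert a s ha ih =>
    simp only [Finset.prod_insert ha]
    exact (h a (Finset.mem_insert_self a s)).mul
      (ih fun i hi => h i (Finset.mem_insert_of_mem hi))

theorem differentiableAt_resonance {n : ℕ} {Y : Fin n → ℂ} (hY : ∀ i, 0 < (Y i).re)
    (i j : Fin n) : DifferentiableAt ℂ (fun Y : Fin n → ℂ => resonance (Y i) (Y j)) Y := by
  have h : 2 * (Y i + Y j) ≠ 0 :=
    mul_ne_zero two_ne_zero (add_ne_zero_of_re_pos_of_re_pos (hY i) (hY j))
  unfold resonance
  fun_prop (disch := exact h)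

theorem differentiableAt_leadingTerm (m : ℕ) {n : ℕ} {Y : Fin n → ℂ} (hY : ∀ i, 0 < (Y i).re) :
    DifferentiableAt ℂ (leadingTerm m : (Fin n → ℂ) → ℂ) Y := by
  unfold leadingTerm
  refine ((differentiableAt_prod fun i _ => ?_).const_mul _).mul
    (differentiableAt_prod fun i _ => differentiableAt_prod fun j _ =>
      differentiableAt_resonance hY j i)
  have hi : DifferentiableAt ℂ (fun Y : Fin n → ℂ => Y i) Y := by fun_prop
  exact ((differentiableAt_prefactor (hY i)).comp Y hi).mul
    (((differentiableAt_growth (hY i)).comp Y hi).pow m)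

/-- The asymptotics of the character with `m` coordinates equal to `1` and `k + 1` other
coordinates, locally uniformly in the latter. -/
theorem reducedChar_estimate {k : ℕ} {Y₀ : Fin (k + 1) → ℂ} (hY₀ : ∀ i, Y₀ i ∈ goodSet)
    (hres : ∀ i j, i ≠ j → resonance (Y₀ i) (Y₀ j) ≠ 0) :
    ∃ r : ℝ, 0 < r ∧ ∃ C : ℝ, 0 ≤ C ∧
      (∀ Y ∈ Metric.closedBall Y₀ r, (∀ i, 0 < (Y i).re) ∧
        ∀ i j, i ≠ j → resonance (Y i) (Y j) ≠ 0) ∧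
      ∀ᶠ m : ℕ in atTop, ∀ Y ∈ Metric.closedBall Y₀ r,
        ‖reducedChar m Y / leadingTerm m Y - 1 - corr (m + k) * ∑ i, profile (Y i)‖ ≤
          C / (m + 1) ^ 2 := by
  choose c hc0 hc using fun i => normAmp_estimate (hY₀ i)
  have hproj : ∀ i, Tendsto (fun Y : Fin (k + 1) → ℂ => Y i) (𝓝 Y₀) (𝓝 (Y₀ i)) := fun i =>
    (continuous_apply i).tendsto Y₀
  have o1 : ∀ᶠ Y in 𝓝 Y₀, ∀ i, 0 < (Y i).re := Filter.eventually_all.2 fun i =>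
    (hproj i).eventually (Complex.continuous_re.continuousAt.eventually_const_lt (hY₀ i).1)
  have o2 : ∀ᶠ Y in 𝓝 Y₀, ∀ i, ∀ N : ℕ, ‖normAmp N (Y i) - 1 - corr N * profile (Y i)‖ ≤
      c i / (N + 1) ^ 2 := Filter.eventually_all.2 fun i => (hproj i).eventually (hc i)
  have o3 : ∀ᶠ Y in 𝓝 Y₀, ∀ i j, i ≠ j → resonance (Y i) (Y j) ≠ 0 := by
    refine Filter.eventually_all.2 fun i => Filter.eventually_all.2 fun j => ?_
    by_cases hij : i = j
    · simp [hij]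
    · filter_upwards [(differentiableAt_resonance (fun i => (hY₀ i).1) i
        j).continuousAt.eventually_ne (hres i j hij)] with Y h _ using h
  have o4 : ∀ᶠ Y in 𝓝 Y₀, ∀ i j, Y₀ i ≠ Y₀ j → Y i ≠ Y j := by
    refine Filter.eventually_all.2 fun i => Filter.eventually_all.2 fun j => ?_
    by_cases hij : Y₀ i = Y₀ j
    · simp [hij]
    · have : Continuous fun Y : Fin (k + 1) → ℂ => Y i - Y j := by fun_prop
      filter_upwards [this.continuousAt.eventually_ne (sub_ne_zero.2 hij)] with Y h _
        using sub_ne_zero.1 h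
  obtain ⟨R, hR, hball⟩ := Metric.nhds_basis_closedBall.eventually_iff.1
    (o1.and (o2.and (o3.and o4)))
  -- The radii are pairwise distinct: on the torus, variables with a common centre have different
  -- distances to it, and variables with different centres are kept apart by `o4`. So the
  -- Vandermonde determinant never vanishes there.
  let ρ : Fin (k + 1) → ℝ := fun i => R * ((i : ℕ) + 1) / (k + 1)
  have hk : (0 : ℝ) < (k : ℝ) + 1 := by positivity
  have hρ0 : ∀ i, 0 < ρ i := fun i => by positivity
  have hρR : ∀ i, ρ i ≤ R := by
    intro i
    simp only [ρ]
    rw [div_le_iff₀ hk]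
    have : ((i : ℕ) : ℝ) ≤ k := by exact_mod_cast Nat.lt_succ_iff.1 i.isLt
    gcongr
  have hρr : ∀ i, R / (k + 1) ≤ ρ i := by
    intro i
    simp only [ρ]
    gcongr
    have : (0 : ℝ) ≤ ((i : ℕ) : ℝ) := Nat.cast_nonneg _
    nlinarith
  have hρinj : ∀ i j, ρ i = ρ j → i = j := by
    intro i j h
    simp only [ρ] at h
    field_simp at h
    have h' : ((i : ℕ) : ℝ) = (j : ℕ) := by linarith
    exact Fin.ext (by exact_mod_cast h')
  have hpoly : ∀ Y : Fin (k + 1) → ℂ, (∀ i, Y i ∈ Metric.closedBall (Y₀ i) (ρ i)) →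
      Y ∈ Metric.closedBall Y₀ R := by
    intro Y hY
    rw [Metric.mem_closedBall, dist_pi_le_iff hR.le]
    exact fun i => (Metric.mem_closedBall.1 (hY i)).trans (hρR i)
  let T : Set (Fin (k + 1) → ℂ) := Set.univ.pi fun i => Metric.sphere (Y₀ i) (ρ i)
  have hT : IsCompact T := isCompact_univ_pi fun i => isCompact_sphere _ _
  have hTb : ∀ Y ∈ T, Y ∈ Metric.closedBall Y₀ R := fun Y hY => hpoly Y fun i =>
    Metric.sphere_subset_closedBall (hY i (Set.mem_univ i))
  have hinj : ∀ Y ∈ T, Function.Injective fun i => profile (Y i) := by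
    intro Y hY i j hij
    by_contra hne
    obtain ⟨h1, -, h3, h4⟩ := hball (hTb Y hY)
    have h5 := resonance_mul (h1 i) (h1 j)
    rw [sub_eq_zero.2 hij] at h5
    have h6 := (mul_eq_zero.1 h5).resolve_left (h3 i j hne)
    have h7 : (Y i - Y j) * (Y i + Y j) = 0 := by linear_combination h6
    have h8 := sub_eq_zero.1 ((mul_eq_zero.1 h7).resolve_right
      (add_ne_zero_of_re_pos_of_re_pos (h1 i) (h1 j)))
    have h9 : Y₀ i = Y₀ j := by
      by_contra h
      exact h4 i j h h8
    apply hne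
    apply hρinj
    rw [← Metric.mem_sphere.1 (hY i (Set.mem_univ i)),
      ← Metric.mem_sphere.1 (hY j (Set.mem_univ j)), h8, h9]
  obtain ⟨C, hC0, hC⟩ := vandermonde_det_estimate hT continuous_profile hinj
    (J := normAmp) (a := corr) (C := ∑ i, c i) (Finset.sum_nonneg fun i _ => hc0 i) norm_corr_le
    (fun Y hY i N => ((hball (hTb Y hY)).2.1 i N).trans (by
      gcongr
      exact Finset.single_le_sum (fun i _ => hc0 i) (Finset.mem_univ i)))
  refine ⟨R / (k + 1), by positivity, C, hC0, ?_, ?_⟩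
  · intro Y hY
    have h := hball (hpoly Y fun i => Metric.mem_closedBall.2
      (((dist_le_pi_dist Y Y₀ i).trans (Metric.mem_closedBall.1 hY)).trans (hρr i)))
    exact ⟨h.1, h.2.2.1⟩
  · filter_upwards [hC] with m hm Y hY
    -- The quotient by `leadingTerm` is holomorphic on the whole polydisc, so the estimate from the
    -- torus extends to coinciding variables.
    refine norm_le_of_forall_torus (c := Y₀) (r := ρ)
      (F := fun Y => reducedChar m Y / leadingTerm m Y - 1 - corr (m + k) * ∑ i, profile (Y i))
      hρ0 ?_ ?_ ?_
    · intro Y hY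
      obtain ⟨h1, -, h3, -⟩ := hball (hpoly Y hY)
      simp only [div_eq_mul_inv]
      refine ((((differentiable_reducedChar m (k + 1)) Y).mul ((differentiableAt_leadingTerm m h1).inv
        (leadingTerm_ne_zero m h1 h3))).sub_const 1).sub (DifferentiableAt.const_mul ?_ _)
      unfold profile
      fun_prop
    · intro Y hY
      have hYT : Y ∈ T := fun i _ => hY i
      obtain ⟨h1, -, h3, -⟩ := hball (hTb Y hYT)
      have h5 := reducedChar_mul m h1
      have hL := leadingTerm_ne_zero m h1 h3
      have hV := Matrix.det_vandermonde_ne_zero_iff.2 (hinj Y hYT)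
      have h6 := hm Y hYT
      have e : reducedChar m Y / leadingTerm m Y =
          (Matrix.of fun i j : Fin (k + 1) => profile (Y i) ^ (j : ℕ) *
            normAmp (m + j) (Y i)).det / (Matrix.vandermonde fun i => profile (Y i)).det := by
        rw [div_eq_div_iff hL hV, h5]
        ring
      simp only [e]
      exact h6
    · intro i
      exact Metric.mem_closedBall.2
        (((dist_le_pi_dist Y Y₀ i).trans (Metric.mem_closedBall.1 hY)).trans (hρr i))

theorem comp_vecCons {n : ℕ} (f : ℂ → ℂ) (a : ℂ) (y : Fin n → ℂ) :
    (fun i => f (Matrix.vecCons a y i)) = Matrix.vecCons (f a) fun i => f (y i) := by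
  funext i
  refine Fin.cases ?_ (fun i => ?_) i <;> simp

/-! ### Regular points and logarithmic derivatives. -/

/-- The points where the uniform asymptotics holds. -/
def Regular {n : ℕ} (Y : Fin n → ℂ) : Prop :=
  (∀ i, Y i ∈ goodSet) ∧ ∀ i j, i ≠ j → resonance (Y i) (Y j) ≠ 0

theorem regular_vecCons {n : ℕ} {a : ℂ} {Y : Fin n → ℂ} :
    Regular (Matrix.vecCons a Y) ↔ a ∈ goodSet ∧ (∀ i, resonance a (Y i) ≠ 0) ∧ Regular Y := by
  simp only [Regular, Fin.forall_fin_succ, Matrix.cons_val_zero, Matrix.cons_val_succ,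
    resonance_comm _ a, ne_eq, not_true_eq_false, false_implies, true_and, Fin.succ_ne_zero,
    not_false_eq_true, true_implies, (Fin.succ_ne_zero _).symm, Fin.succ_inj]
  constructor
  · rintro ⟨⟨h1, h2⟩, h3, h4⟩
    exact ⟨h1, h3, h2, fun i j => (h4 i).2 j⟩
  · rintro ⟨h1, h2, h3, h4⟩
    exact ⟨⟨h1, h3⟩, h2, fun i => ⟨h2 i, h4 i⟩⟩

/-- Isolates the dependence on one variable: factors free of t form a non-zero constant, which
disappears in the logarithmic derivative. -/
theorem leadingTerm_vecCons (m : ℕ) {k : ℕ} {y : Fin k → ℂ}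
    (hy : ∀ i, 0 < (y i).re) (hr : ∀ i j, i ≠ j → resonance (y i) (y j) ≠ 0) :
    ∃ c : ℂ, c ≠ 0 ∧ ∀ t, leadingTerm m (Matrix.vecCons t y) =
      c * (prefactor t * growth t ^ m * ∏ i, resonance (y i) t) := by
  refine ⟨4 * (moment 0 (m + k) : ℂ) * leadingTerm m y, mul_ne_zero (mul_ne_zero (by norm_num) ?_)
    (leadingTerm_ne_zero m hy hr), fun t => ?_⟩
  · exact_mod_cast (moment_zero_pos _).ne'
  · rw [leadingTerm, leadingTerm, Fin.prod_univ_castSucc, Fin.prod_univ_succ (n := k),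
      Fin.prod_univ_succ (n := k)]
    simp only [Fin.Ioi_zero_eq_map, Finset.prod_map, Fin.Ioi_succ, Fin.coe_succEmb,
      Matrix.cons_val_zero, Matrix.cons_val_succ, Fin.val_castSucc, Fin.val_last]
    ring

/-- Cauchy's estimate on a fixed circle passes the O(m⁻²) error to the derivative, and the constant
b drops out. Dividing by f m costs only o(1/m), because f m tends to 1 and a m is O(1/m). -/
theorem logDeriv_estimate {f : ℕ → ℂ → ℂ} {a : ℕ → ℂ} {p : ℂ → ℂ} {b t₀ : ℂ} {r C : ℝ} (hr : 0 < r)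
    (hf : ∀ᶠ m in atTop, ∀ t ∈ Metric.closedBall t₀ r, DifferentiableAt ℂ (f m) t)
    (hp : Differentiable ℂ p) (ha : ∀ m : ℕ, ‖a m‖ ≤ 1 / (m + 1))
    (h : ∀ᶠ m : ℕ in atTop, ∀ t ∈ Metric.closedBall t₀ r,
      ‖f m t - 1 - a m * (p t + b)‖ ≤ C / (m + 1) ^ 2) :
    (∀ᶠ m in atTop, f m t₀ ≠ 0) ∧
      Tendsto (fun m : ℕ => ((m : ℂ) + 1) * (logDeriv (f m) t₀ - a m * deriv p t₀)) atTop (𝓝 0) := by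
  have hn : Tendsto (fun m : ℕ => (1 : ℝ) / ((m : ℝ) + 1)) atTop (𝓝 0) :=
    tendsto_one_div_add_atTop_nhds_zero_nat
  have hmem : t₀ ∈ Metric.closedBall t₀ r := Metric.mem_closedBall_self hr.le
  have ha0 : Tendsto a atTop (𝓝 0) := squeeze_zero_norm ha hn
  have hC : Tendsto (fun m : ℕ => C / ((m : ℝ) + 1) ^ 2) atTop (𝓝 0) := by
    have := (hn.pow 2).const_mul C
    simpa [div_eq_mul_inv] using this
  have hf1 : Tendsto (fun m => f m t₀) atTop (𝓝 1) := by
    have h1 : Tendsto (fun m => f m t₀ - 1 - a m * (p t₀ + b)) atTop (𝓝 0) :=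
      squeeze_zero_norm' (h.mono fun m hm => hm t₀ hmem) hC
    have h2 := (h1.add (ha0.mul_const (p t₀ + b))).add_const 1
    simpa using h2
  have hf0 : ∀ᶠ m in atTop, f m t₀ ≠ 0 := hf1.eventually_ne one_ne_zero
  refine ⟨hf0, ?_⟩
  have hder : Tendsto (fun m : ℕ => ((m : ℂ) + 1) * (deriv (f m) t₀ - a m * deriv p t₀)) atTop
      (𝓝 0) := by
    have hlim : Tendsto (fun m : ℕ => C / r * (1 / ((m : ℝ) + 1))) atTop (𝓝 0) := by
      simpa using hn.const_mul (C / r)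
    refine squeeze_zero_norm' ?_ hlim
    filter_upwards [h, hf] with m hm hfm
    have hd : ∀ t ∈ Metric.closedBall t₀ r,
        HasDerivAt (fun t => f m t - 1 - a m * (p t + b)) (deriv (f m) t - a m * deriv p t) t := by
      intro t ht
      exact (((hfm t ht).hasDerivAt).sub_const 1).sub
        ((((hp t).hasDerivAt).add_const b).const_mul (a m))
    have hcl : DiffContOnCl ℂ (fun t => f m t - 1 - a m * (p t + b)) (Metric.ball t₀ r) := by
      refine DifferentiableOn.diffContOnCl fun t ht => ?_
      rw [closure_ball t₀ hr.ne'] at ht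
      exact (hd t ht).differentiableAt.differentiableWithinAt
    have h1 := Complex.norm_deriv_le_of_forall_mem_sphere_norm_le hr hcl
      fun t ht => hm t (Metric.sphere_subset_closedBall ht)
    rw [(hd t₀ hmem).deriv] at h1
    have hpos : (0 : ℝ) < (m : ℝ) + 1 := by positivity
    have e : ‖(m : ℂ) + 1‖ = (m : ℝ) + 1 := by
      rw [show (m : ℂ) + 1 = (((m : ℝ) + 1 : ℝ) : ℂ) by push_cast; rfl, Complex.norm_real,
        Real.norm_of_nonneg hpos.le]
    rw [norm_mul, e]
    calc _ ≤ ((m : ℝ) + 1) * (C / (m + 1) ^ 2 / r) := by gcongr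
      _ = _ := by field_simp
  have hbd : Tendsto (fun m : ℕ => (((m : ℂ) + 1) * a m) * (deriv p t₀ * (1 - f m t₀))) atTop
      (𝓝 0) := by
    refine squeeze_zero_norm (a := fun m => ‖deriv p t₀ * (1 - f m t₀)‖) (fun m => ?_) ?_
    · have hpos : (0 : ℝ) < (m : ℝ) + 1 := by positivity
      have e : ‖(m : ℂ) + 1‖ = (m : ℝ) + 1 := by
        rw [show (m : ℂ) + 1 = (((m : ℝ) + 1 : ℝ) : ℂ) by push_cast; rfl, Complex.norm_real,
          Real.norm_of_nonneg hpos.le]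
      rw [norm_mul, norm_mul, e]
      have h1 : ((m : ℝ) + 1) * ‖a m‖ ≤ 1 := by
        calc _ ≤ ((m : ℝ) + 1) * (1 / (m + 1)) := by gcongr; exact ha m
          _ = 1 := by field_simp
      exact mul_le_of_le_one_left (norm_nonneg _) h1
    · have := ((hf1.const_sub 1).const_mul (deriv p t₀)).norm
      simpa using this
  have hfin := (hder.add hbd).div hf1 one_ne_zero
  simp only [add_zero, zero_div] at hfin
  refine hfin.congr' ?_
  filter_upwards [hf0] with m hm
  rw [logDeriv_apply, Pi.div_apply]
  field_simp
  ring

theorem differentiable_vecCons {k : ℕ} (y : Fin k → ℂ) :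
    Differentiable ℂ fun t : ℂ => Matrix.vecCons t y := by
  rw [differentiable_pi]
  refine Fin.cases ?_ fun i => ?_ <;> simp

theorem logDeriv_reducedChar {k : ℕ} {t₀ : ℂ} {y : Fin k → ℂ}
    (h : Regular (Matrix.vecCons t₀ y)) :
    (∀ᶠ m in atTop, reducedChar m (Matrix.vecCons t₀ y) ≠ 0) ∧
      Tendsto (fun m : ℕ => ((m : ℂ) + 1) *
        (logDeriv (fun t => reducedChar m (Matrix.vecCons t y)) t₀ -
          (logDeriv prefactor t₀ + m * logDeriv growth t₀ +
            ∑ i, logDeriv (fun t => resonance (y i) t) t₀ + corr (m + k) * deriv profile t₀)))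
        atTop (𝓝 0) := by
  obtain ⟨r, hr, C, -, hball, hest⟩ := reducedChar_estimate h.1 h.2
  have hmem : ∀ {t}, t ∈ Metric.closedBall t₀ r →
      Matrix.vecCons t y ∈ Metric.closedBall (Matrix.vecCons t₀ y) r := by
    intro t ht
    rw [Metric.mem_closedBall, dist_pi_le_iff hr.le]
    refine Fin.cases ?_ fun i => ?_
    · simpa using ht
    · simp [hr.le]
  have hself : t₀ ∈ Metric.closedBall t₀ r := Metric.mem_closedBall_self hr.le
  have hvec : Differentiable ℂ fun t : ℂ => Matrix.vecCons t y := differentiable_vecCons y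
  have hred : ∀ m, Differentiable ℂ fun t => reducedChar m (Matrix.vecCons t y) := fun m =>
    (differentiable_reducedChar m (k + 1)).comp hvec
  have hlead : ∀ m, ∀ t ∈ Metric.closedBall t₀ r,
      DifferentiableAt ℂ (fun t => leadingTerm m (Matrix.vecCons t y)) t := fun m t ht =>
    DifferentiableAt.fun_comp' t (differentiableAt_leadingTerm m (hball _ (hmem ht)).1) (hvec t)
  have hlead0 : ∀ m, ∀ t ∈ Metric.closedBall t₀ r, leadingTerm m (Matrix.vecCons t y) ≠ 0 :=
    fun m t ht => leadingTerm_ne_zero m (hball _ (hmem ht)).1 (hball _ (hmem ht)).2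
  have hprof : Differentiable ℂ profile := by unfold profile; fun_prop
  obtain ⟨h1, h2⟩ := logDeriv_estimate
    (f := fun m t => reducedChar m (Matrix.vecCons t y) / leadingTerm m (Matrix.vecCons t y))
    (a := fun m => corr (m + k)) (p := profile) (b := ∑ i, profile (y i)) (t₀ := t₀) (C := C) hr
    (Eventually.of_forall fun m t ht => (hred m t).div (hlead m t ht) (hlead0 m t ht)) hprof
    (fun m => (norm_corr_le _).trans (by push_cast; gcongr; linarith [Nat.cast_nonneg (α := ℝ) k]))
    (hest.mono fun m hm t ht => by simpa [Fin.sum_univ_succ] using hm _ (hmem ht))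
  have hne : ∀ᶠ m in atTop, reducedChar m (Matrix.vecCons t₀ y) ≠ 0 :=
    h1.mono fun m hm h0 => hm (by simp [h0])
  refine ⟨hne, h2.congr' ?_⟩
  filter_upwards [hne] with m hm
  have hY := h
  rw [regular_vecCons] at hY
  obtain ⟨ht, hres, hy⟩ := hY
  obtain ⟨c, hc, hcl⟩ := leadingTerm_vecCons m (fun i => (hy.1 i).1) hy.2
  have d1 := differentiableAt_prefactor ht.1
  have d2 := differentiableAt_growth ht.1
  have d3 : ∀ i, DifferentiableAt ℂ (fun t => resonance (y i) t) t₀ := by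
    intro i
    unfold resonance
    exact DifferentiableAt.div (by fun_prop) (by fun_prop) (mul_ne_zero two_ne_zero
      (add_ne_zero_of_re_pos_of_re_pos (hy.1 i).1 ht.1))
  have n3 : ∀ i, resonance (y i) t₀ ≠ 0 := fun i => by
    rw [resonance_comm]
    exact hres i
  rw [logDeriv_div (f := fun t => reducedChar m (Matrix.vecCons t y)) t₀ hm (hlead0 m t₀ hself) (hred m t₀) (hlead m t₀ hself)]
  simp only [hcl]
  rw [logDeriv_const_mul _ _ hc, logDeriv_mul (f := fun t => prefactor t * growth t ^ m) t₀
    (mul_ne_zero (prefactor_ne_zero ht.1) (pow_ne_zero _ (growth_ne_zero ht.1)))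
    (Finset.prod_ne_zero_iff.2 fun i _ => n3 i) (d1.mul (d2.pow m))
    (DifferentiableAt.fun_finsetProd fun i _ => d3 i),
    logDeriv_mul (f := prefactor) (g := fun t => growth t ^ m) t₀ (prefactor_ne_zero ht.1) (pow_ne_zero _ (growth_ne_zero ht.1)) d1 (d2.pow m),
    logDeriv_fun_pow d2, logDeriv_prod (fun i _ => n3 i) (fun i _ => d3 i)]
  ring

/-! ### The cross ratio and its oscillating correction. -/

/-- The variable `z + z⁻¹`. -/
def joukowski (z : ℂ) : ℂ := z + z⁻¹

theorem hasDerivAt_joukowski {z : ℂ} (hz : z ≠ 0) :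
    HasDerivAt joukowski (1 - (z ^ 2)⁻¹) z := by
  have h : HasDerivAt joukowski (1 + -(z ^ 2)⁻¹) z := (hasDerivAt_id z).add (hasDerivAt_inv hz)
  simpa [sub_eq_add_neg] using h

theorem deriv_profile (Y : ℂ) : deriv profile Y = 3 / 2 * (Y ^ 2 - 1) := by
  have h : HasDerivAt profile ((3 * Y ^ 2 - 3 * 1) / 2) Y := by
    have h1 : HasDerivAt profile _ Y :=
      ((((hasDerivAt_id Y).pow 3).sub ((hasDerivAt_id Y).const_mul 3)).div_const 2).sub_const 1
    simpa using h1
  rw [h.deriv]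
  ring

theorem deriv_profile_joukowski {z : ℂ} (hz : z ≠ 0) :
    z * (deriv profile (joukowski z) * (1 - (z ^ 2)⁻¹)) = 3 / 2 * (z ^ 3 - (z ^ 3)⁻¹) := by
  rw [deriv_profile, joukowski]
  field_simp
  ring

theorem corr_eq (N : ℕ) : corr N = (1 / 36 + (-1) ^ N / 6) * (2 * (N : ℂ) + 3)⁻¹ := by
  rw [corr, stairOrder, div_eq_mul_inv]
  split_ifs with h
  · rw [h.neg_one_pow]
    norm_num
  · rw [(Nat.not_even_iff_odd.1 h).neg_one_pow]
    norm_num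

/-- Each m/(2m + const) tends to 1/2. The parts with 1/36 enter with weights 2, -1, -1 and cancel;
in the alternating parts the signs align to weights 2, 1, 1, giving (1/6) · 4 · (1/2). -/
theorem tendsto_corr_combination (s : ℕ) :
    Tendsto (fun m : ℕ => ((m : ℂ) + 1) * ((-1) ^ (m + s + 1) *
      (2 * corr (m + (s + 1)) - corr (m + s) - corr (m + (s + 2))))) atTop (𝓝 (1 / 3)) := by
  have hn : Tendsto (fun m : ℕ => (1 : ℂ) / ((m : ℂ) + 1)) atTop (𝓝 0) :=
    tendsto_one_div_add_atTop_nhds_zero_nat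
  have h0 : ∀ m : ℕ, (m : ℂ) + 1 ≠ 0 := fun m => by exact_mod_cast Nat.succ_ne_zero m
  have key : ∀ i : ℕ, Tendsto (fun m : ℕ => ((m : ℂ) + 1) * (2 * ((m + i : ℕ) : ℂ) + 3)⁻¹) atTop
      (𝓝 (1 / 2)) := by
    intro i
    have h1 : Tendsto (fun m : ℕ => (2 + (2 * (i : ℂ) + 1) * (1 / ((m : ℂ) + 1)))⁻¹) atTop
        (𝓝 (2 + (2 * (i : ℂ) + 1) * 0)⁻¹) :=
      ((hn.const_mul _).const_add 2).inv₀ (by norm_num)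
    rw [show (2 + (2 * (i : ℂ) + 1) * 0)⁻¹ = 1 / 2 by norm_num] at h1
    refine h1.congr fun m => ?_
    have h2 := h0 m
    rw [← inv_inj, inv_inv, mul_inv, inv_inv]
    field_simp
    push_cast
    ring
  have hsign : Tendsto (fun m : ℕ => (-1 : ℂ) ^ (m + s + 1) * (1 / 36 *
      (2 * (((m : ℂ) + 1) * (2 * ((m + (s + 1) : ℕ) : ℂ) + 3)⁻¹) -
        ((m : ℂ) + 1) * (2 * ((m + s : ℕ) : ℂ) + 3)⁻¹ -
        ((m : ℂ) + 1) * (2 * ((m + (s + 2) : ℕ) : ℂ) + 3)⁻¹))) atTop (𝓝 0) := by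
    have h1 := ((((key (s + 1)).const_mul 2).sub (key s)).sub (key (s + 2))).const_mul (1 / 36)
    rw [show (1 / 36 : ℂ) * (2 * (1 / 2) - 1 / 2 - 1 / 2) = 0 by norm_num] at h1
    rw [tendsto_zero_iff_norm_tendsto_zero] at h1 ⊢
    simpa using h1
  have hmain := ((((key (s + 1)).const_mul 2).add (key s)).add (key (s + 2))).const_mul (1 / 6)
  have h := hsign.add hmain
  rw [show (0 : ℂ) + 1 / 6 * (2 * (1 / 2) + 1 / 2 + 1 / 2) = 1 / 3 by norm_num] at h
  refine h.congr fun m => ?_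
  rw [corr_eq, corr_eq, corr_eq]
  have e : ((-1 : ℂ) ^ (m + s)) * (-1) ^ (m + s) = 1 := by
    rw [← mul_pow]
    norm_num
  rw [show m + (s + 1) = m + s + 1 by ring, show m + (s + 2) = m + s + 1 + 1 by ring,
    pow_succ (-1 : ℂ) (m + s + 1), pow_succ (-1 : ℂ) (m + s)]
  linear_combination (-(1 / 6 : ℂ)) * ((m : ℂ) + 1) * (2 * (2 * ((m + s + 1 : ℕ) : ℂ) + 3)⁻¹ +
    (2 * ((m + s : ℕ) : ℂ) + 3)⁻¹ + (2 * ((m + s + 1 + 1 : ℕ) : ℂ) + 3)⁻¹) * e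

theorem exists_tau_eq_reducedChar (m : ℕ) {k : ℕ} (y : Fin k → ℂ) (hy : ∀ i, y i ≠ 0) :
    ∃ c : ℂ, c ≠ 0 ∧ ∀ {n : ℕ} (x : Fin n → ℂ) (t : ℂ), t ≠ 0 →
      coords x = t ::ₘ (Multiset.replicate m 1 + coords y) →
      tau x = c * reducedChar m (Matrix.vecCons (joukowski t) fun i => joukowski (y i)) := by
  obtain ⟨c, hc, h⟩ := exists_tau_eq m (k + 1)
  refine ⟨c, hc, fun x t ht hx => ?_⟩
  rw [h x (Matrix.vecCons t y), ← comp_vecCons joukowski t y]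
  · rfl
  · exact Fin.cases ht hy
  · rw [hx, coords_vecCons, Multiset.add_cons]

/-- The cross ratio of characters, in the variables `Y = z + z⁻¹`. -/
def reducedRatio (m : ℕ) {s : ℕ} (a b : ℂ) (Y : Fin s → ℂ) (T : ℂ) : ℂ :=
  (reducedChar m (Matrix.vecCons T (Matrix.vecCons a Y)) *
    reducedChar m (Matrix.vecCons T (Matrix.vecCons b Y))) /
  (reducedChar m (Matrix.vecCons T Y) *
    reducedChar m (Matrix.vecCons T (Matrix.vecCons a (Matrix.vecCons b Y))))

theorem exists_ratio_eq (m : ℕ) {s : ℕ} {ζ₁ ζ₂ : ℂ} {y : Fin s → ℂ} (h1 : ζ₁ ≠ 0) (h2 : ζ₂ ≠ 0)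
    (hy : ∀ i, y i ≠ 0) :
    ∃ c : ℂ, c ≠ 0 ∧ ∀ {n : ℕ} (x : Fin n → ℂ) (t : ℂ), t ≠ 0 →
      coords x = t ::ₘ (Multiset.replicate m 1 + coords y) →
      ratio ζ₁ ζ₂ x = c * reducedRatio m (joukowski ζ₁) (joukowski ζ₂) (fun i => joukowski (y i))
        (joukowski t) := by
  have hy1 : ∀ ζ : ℂ, ζ ≠ 0 → ∀ i, (Matrix.vecCons ζ y) i ≠ 0 := fun ζ hζ => Fin.cases hζ hy
  have hy2 : ∀ i, (Matrix.vecCons ζ₁ (Matrix.vecCons ζ₂ y)) i ≠ 0 := Fin.cases h1 (hy1 ζ₂ h2)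
  obtain ⟨c0, hc0, e0⟩ := exists_tau_eq_reducedChar m y hy
  obtain ⟨c1, hc1, e1⟩ := exists_tau_eq_reducedChar m _ (hy1 ζ₁ h1)
  obtain ⟨c2, hc2, e2⟩ := exists_tau_eq_reducedChar m _ (hy1 ζ₂ h2)
  obtain ⟨c3, hc3, e3⟩ := exists_tau_eq_reducedChar m _ hy2
  refine ⟨c1 * c2 / (c0 * c3), by positivity, fun x t ht hx => ?_⟩
  have hcons : ∀ ζ : ℂ, ζ ::ₘ t ::ₘ (Multiset.replicate m 1 + coords y) =
      t ::ₘ (Multiset.replicate m 1 + ζ ::ₘ coords y) := fun ζ => by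
    rw [Multiset.cons_swap, Multiset.add_cons]
  rw [ratio, reducedRatio, e0 x t ht hx, e1 (Matrix.vecCons ζ₁ x) t ht, e2 (Matrix.vecCons ζ₂ x) t ht,
    e3 (Matrix.vecCons ζ₁ (Matrix.vecCons ζ₂ x)) t ht, comp_vecCons, comp_vecCons, comp_vecCons,
    comp_vecCons]
  · rw [mul_mul_mul_comm, mul_mul_mul_comm c0, mul_div_mul_comm]
  · rw [coords_vecCons, coords_vecCons, coords_vecCons, coords_vecCons, hx, hcons,
      Multiset.cons_swap, Multiset.add_cons, Multiset.add_cons, Multiset.add_cons]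
  · rw [coords_vecCons, coords_vecCons, hx, hcons]
  · rw [coords_vecCons, coords_vecCons, hx, hcons]

/-- The prefactor, the growth and every resonance with T occur equally often above and below, so
they cancel exactly. Only the corrections differ, since their index counts the variables not set to
1. -/
theorem logDeriv_reducedRatio {s : ℕ} {a b T : ℂ} {Y : Fin s → ℂ}
    (h : Regular (Matrix.vecCons T (Matrix.vecCons a (Matrix.vecCons b Y)))) :
    (∀ᶠ m in atTop, AnalyticAt ℂ (reducedRatio m a b Y) T ∧ reducedRatio m a b Y T ≠ 0) ∧
      Tendsto (fun m : ℕ => ((m : ℂ) + 1) * (logDeriv (reducedRatio m a b Y) T -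
        (2 * corr (m + (s + 1)) - corr (m + s) - corr (m + (s + 2))) * deriv profile T))
        atTop (𝓝 0) := by
  have h' := h
  simp only [regular_vecCons] at h'
  obtain ⟨hT, hTr, ha, har, hb, hbr, hY⟩ := h'
  have hTa := hTr 0
  have hTb := hTr 1
  have hTY : ∀ i, resonance T (Y i) ≠ 0 := fun i => hTr i.succ.succ
  have haY : ∀ i, resonance a (Y i) ≠ 0 := fun i => har i.succ
  have hr0 : Regular (Matrix.vecCons T Y) := regular_vecCons.2 ⟨hT, hTY, hY⟩
  have hr1 : Regular (Matrix.vecCons T (Matrix.vecCons a Y)) :=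
    regular_vecCons.2 ⟨hT, Fin.cases hTa hTY, regular_vecCons.2 ⟨ha, haY, hY⟩⟩
  have hr2 : Regular (Matrix.vecCons T (Matrix.vecCons b Y)) :=
    regular_vecCons.2 ⟨hT, Fin.cases hTb hTY, regular_vecCons.2 ⟨hb, hbr, hY⟩⟩
  obtain ⟨n0, l0⟩ := logDeriv_reducedChar hr0
  obtain ⟨n1, l1⟩ := logDeriv_reducedChar hr1
  obtain ⟨n2, l2⟩ := logDeriv_reducedChar hr2
  obtain ⟨n3, l3⟩ := logDeriv_reducedChar h
  have hd : ∀ (m : ℕ) {k : ℕ} (y : Fin k → ℂ),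
      Differentiable ℂ fun t => reducedChar m (Matrix.vecCons t y) := fun m k y =>
    (differentiable_reducedChar m (k + 1)).comp (differentiable_vecCons y)
  have hn := n0.and (n1.and (n2.and n3))
  refine ⟨?_, ?_⟩
  · filter_upwards [hn] with m ⟨m0, m1, m2, m3⟩
    refine ⟨?_, div_ne_zero (mul_ne_zero m1 m2) (mul_ne_zero m0 m3)⟩
    unfold reducedRatio
    exact ((((hd m _).analyticAt T).mul ((hd m _).analyticAt T))).div
      (((hd m _).analyticAt T).mul ((hd m _).analyticAt T)) (mul_ne_zero m0 m3)
  · have hl := (l1.add l2).sub (l0.add l3)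
    simp only [add_zero, sub_zero] at hl
    refine hl.congr' ?_
    filter_upwards [hn] with m ⟨m0, m1, m2, m3⟩
    unfold reducedRatio
    rw [logDeriv_div (f := fun T => reducedChar m (Matrix.vecCons T (Matrix.vecCons a Y)) *
        reducedChar m (Matrix.vecCons T (Matrix.vecCons b Y)))
        (g := fun T => reducedChar m (Matrix.vecCons T Y) *
        reducedChar m (Matrix.vecCons T (Matrix.vecCons a (Matrix.vecCons b Y)))) T
        (mul_ne_zero m1 m2) (mul_ne_zero m0 m3)
        ((hd m _ T).mul (hd m _ T)) ((hd m _ T).mul (hd m _ T)),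
      logDeriv_mul (f := fun T => reducedChar m (Matrix.vecCons T (Matrix.vecCons a Y)))
        (g := fun T => reducedChar m (Matrix.vecCons T (Matrix.vecCons b Y))) T m1 m2
        (hd m _ T) (hd m _ T),
      logDeriv_mul (f := fun T => reducedChar m (Matrix.vecCons T Y))
        (g := fun T => reducedChar m (Matrix.vecCons T (Matrix.vecCons a (Matrix.vecCons b Y))))
        T m0 m3 (hd m _ T) (hd m _ T)]
    simp only [Fin.sum_univ_succ, Matrix.cons_val_zero, Matrix.cons_val_succ]
    ring

/-- The sequence d depends only on the multiset of the fixed coordinates, and x is quantified after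
it. One d thus serves every position j of the moving coordinate, which yields uniformity in j. -/
theorem logDeriv_ratio {s : ℕ} {ζ₁ ζ₂ z : ℂ} {y : Fin s → ℂ} (h1 : ζ₁ ≠ 0) (h2 : ζ₂ ≠ 0)
    (hz : z ≠ 0) (hy : ∀ i, y i ≠ 0)
    (h : Regular (Matrix.vecCons (joukowski z) (Matrix.vecCons (joukowski ζ₁)
      (Matrix.vecCons (joukowski ζ₂) fun i => joukowski (y i))))) :
    ∃ d : ℕ → ℂ, Tendsto (fun m : ℕ => ((m : ℂ) + 1) * ((-1) ^ (m + s + 1) * (z * d m))) atTop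
        (𝓝 ((z ^ 3 - (z ^ 3)⁻¹) / 2)) ∧
      ∀ᶠ m in atTop, ∀ {n : ℕ} (x : ℂ → Fin n → ℂ),
        (∀ t, coords (x t) = t ::ₘ (Multiset.replicate m 1 + coords y)) →
        AnalyticAt ℂ (fun t => ratio ζ₁ ζ₂ (x t)) z ∧ ratio ζ₁ ζ₂ (x z) ≠ 0 ∧
          logDeriv (fun t => ratio ζ₁ ζ₂ (x t)) z = d m := by
  obtain ⟨hr, hl⟩ := logDeriv_reducedRatio h
  have hJ := hasDerivAt_joukowski hz
  refine ⟨fun m => logDeriv (reducedRatio m (joukowski ζ₁) (joukowski ζ₂)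
    fun i => joukowski (y i)) (joukowski z) * (1 - (z ^ 2)⁻¹), ?_, ?_⟩
  · have hs : Tendsto (fun m : ℕ => (-1 : ℂ) ^ (m + s + 1) * (((m : ℂ) + 1) *
        (logDeriv (reducedRatio m (joukowski ζ₁) (joukowski ζ₂) fun i => joukowski (y i))
          (joukowski z) - (2 * corr (m + (s + 1)) - corr (m + s) - corr (m + (s + 2))) *
            deriv profile (joukowski z)))) atTop (𝓝 0) := by
      rw [tendsto_zero_iff_norm_tendsto_zero] at hl ⊢
      simpa using hl
    have h3 := (hs.mul_const (z * (1 - (z ^ 2)⁻¹))).add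
      ((tendsto_corr_combination s).mul_const (3 / 2 * (z ^ 3 - (z ^ 3)⁻¹)))
    rw [show 0 * (z * (1 - (z ^ 2)⁻¹)) + 1 / 3 * (3 / 2 * (z ^ 3 - (z ^ 3)⁻¹)) =
      (z ^ 3 - (z ^ 3)⁻¹) / 2 by ring] at h3
    refine h3.congr fun m => ?_
    rw [← deriv_profile_joukowski hz]
    ring
  · filter_upwards [hr] with m ⟨han, hne⟩ n x hx
    obtain ⟨c, hc, hcr⟩ := exists_ratio_eq m h1 h2 hy
    have hev : (fun t => ratio ζ₁ ζ₂ (x t)) =ᶠ[𝓝 z] fun t => c *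
        (reducedRatio m (joukowski ζ₁) (joukowski ζ₂) (fun i => joukowski (y i)) ∘ joukowski) t := by
      filter_upwards [isOpen_ne.mem_nhds hz] with t ht
      exact hcr (x t) t ht (hx t)
    have hJa : AnalyticAt ℂ joukowski z := analyticAt_id.add (analyticAt_id.inv hz)
    refine ⟨(analyticAt_const.mul (han.comp hJa)).congr hev.symm, ?_, ?_⟩
    · rw [hcr (x z) z hz (hx z)]
      exact mul_ne_zero hc hne
    · rw [(logDeriv_congr_nhds hev).self_of_nhds, logDeriv_const_mul _ _ hc,
        logDeriv_comp han.differentiableAt hJ.differentiableAt, hJ.deriv]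

/-! ### Admissibility and non-resonance imply regularity. -/

theorem exists_sq_eq_of_mem_slitPlane {u : ℂ} (hu : u ∈ Complex.slitPlane) :
    ∃ v : ℂ, v ^ 2 = u ∧ 0 < v.re := by
  have hu0 := Complex.slitPlane_ne_zero hu
  refine ⟨Complex.exp (Complex.log u / 2), ?_, ?_⟩
  · rw [← Complex.exp_nat_mul, Nat.cast_two, mul_div_cancel₀ _ two_ne_zero, Complex.exp_log hu0]
  · rw [Complex.exp_re]
    refine mul_pos (Real.exp_pos _) (Real.cos_pos_of_mem_Ioo ?_)
    have h1 := (Complex.mem_slitPlane_iff_arg.1 hu).1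
    have h2 := Complex.neg_pi_lt_arg u
    have h3 := lt_of_le_of_ne (Complex.arg_le_pi u) h1
    have e : (Complex.log u / 2).im = u.arg / 2 := by
      rw [← Complex.log_im]
      exact Complex.div_ofNat_im _ _
    rw [e]
    constructor <;> linarith

theorem pow32_sq {z : ℂ} (hz : 0 < z.re) : pow32 (z ^ 2) = z ^ 3 := by
  have h0 := ne_zero_of_re_pos hz
  have h1 := abs_lt.1 (Complex.abs_arg_lt_pi_div_two_iff.2 (Or.inl hz))
  have h2 : Complex.log (z ^ 2) = (2 : ℕ) * Complex.log z := by
    rw [pow_two, (Complex.log_mul_eq_add_log_iff h0 h0).2 (by constructor <;> linarith)]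
    push_cast
    ring
  rw [pow32, Complex.cpow_def_of_ne_zero (pow_ne_zero 2 h0), h2,
    show ((2 : ℕ) : ℂ) * Complex.log z * (3 / 2) = (3 : ℕ) * Complex.log z by push_cast; ring,
    Complex.exp_nat_mul, Complex.exp_log h0]

theorem inv_re_pos {z : ℂ} (hz : 0 < z.re) : 0 < (z⁻¹).re := by
  rw [Complex.inv_re]
  exact div_pos hz (Complex.normSq_pos.2 (ne_zero_of_re_pos hz))

theorem joukowski_re_pos {z : ℂ} (hz : 0 < z.re) : 0 < (joukowski z).re := by
  rw [joukowski, Complex.add_re]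
  exact add_pos hz (inv_re_pos hz)

theorem profile_joukowski {z : ℂ} (hz : z ≠ 0) :
    profile (joukowski z) = (z ^ 3 + (z ^ 3)⁻¹) / 2 - 1 := by
  rw [profile, joukowski]
  field_simp
  ring

/-- Writing z³ = v² with Re v > 0, the quantity to be placed in the slit plane is ((v + v⁻¹)/2)²,
the square of a number with positive real part. -/
theorem joukowski_mem_goodSet {z : ℂ} (hz : 0 < z.re) (h : Admissible (z ^ 2)) :
    joukowski z ∈ goodSet := by
  refine ⟨joukowski_re_pos hz, ?_⟩
  have h1 := h.2
  rw [pow32_sq hz] at h1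
  obtain ⟨v, hv, hvre⟩ := exists_sq_eq_of_mem_slitPlane h1
  have hv0 := ne_zero_of_re_pos hvre
  rw [profile_joukowski (ne_zero_of_re_pos hz), ← hv]
  have e : 1 + ((v ^ 2 + (v ^ 2)⁻¹) / 2 - 1) / 2 = (joukowski v / 2) ^ 2 := by
    rw [joukowski]
    field_simp
    ring
  rw [e]
  refine sq_mem_slitPlane ?_
  rw [Complex.div_ofNat_re]
  exact half_pos (joukowski_re_pos hvre)

theorem regular_of_isEmpty (Y : Fin 0 → ℂ) : Regular Y := ⟨fun i => i.elim0, fun i => i.elim0⟩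

/-- On the diagonal the resonance is the derivative of `profile` divided by 2Y. Its only zero with
positive real part is Y = 1, which `goodSet` excludes. This is what allows equal variables such as
ζ₁ = ζ₂. -/
theorem resonance_self_ne_zero {Y : ℂ} (hY : Y ∈ goodSet) : resonance Y Y ≠ 0 := by
  intro h
  have hYre := hY.1
  have h1 : Y ^ 2 + Y * Y + Y ^ 2 - 3 = 0 := (div_eq_zero_iff.1 h).resolve_right
    (mul_ne_zero two_ne_zero (add_ne_zero_of_re_pos_of_re_pos hYre hYre))
  have h2 : (Y - 1) * (Y + 1) = 0 := by linear_combination h1 / 3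
  have h3 : Y + 1 ≠ 0 := add_ne_zero_of_re_pos_of_re_pos hYre (by simp)
  have h4 : Y = 1 := sub_eq_zero.1 ((mul_eq_zero.1 h2).resolve_right h3)
  have h5 := hY.2
  rw [h4, show 1 + profile 1 / 2 = 0 by rw [profile]; norm_num] at h5
  exact Complex.slitPlane_ne_zero h5 rfl

/-- A zero would equate the two values of `profile`, that is z³ = ζ³ or z³ζ³ = 1. Non-resonance then
gives z = ζ or zζ = 1, so both points have the same Y, and the diagonal case applies. -/
theorem resonance_joukowski_ne_zero {z ζ : ℂ} (hz : 0 < z.re) (hζ : 0 < ζ.re)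
    (ha : Admissible (z ^ 2)) (h : NonResonant (z ^ 2) (ζ ^ 2)) :
    resonance (joukowski z) (joukowski ζ) ≠ 0 := by
  intro hr
  have hz0 := ne_zero_of_re_pos hz
  have hζ0 := ne_zero_of_re_pos hζ
  have h1 := resonance_mul (joukowski_re_pos hz) (joukowski_re_pos hζ)
  rw [hr, zero_mul, profile_joukowski hz0, profile_joukowski hζ0] at h1
  rw [NonResonant, pow32_sq hz, pow32_sq hζ] at h
  have h2 : (z ^ 3 - ζ ^ 3) * (z ^ 3 * ζ ^ 3 - 1) = 0 := by
    field_simp at h1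
    linear_combination -h1
  have h3 : joukowski z = joukowski ζ := by
    rcases mul_eq_zero.1 h2 with h4 | h4
    · have h5 : (z - ζ) * (z + ζ) = 0 := by linear_combination h.1 (sub_eq_zero.1 h4)
      rw [sub_eq_zero.1 ((mul_eq_zero.1 h5).resolve_right (add_ne_zero_of_re_pos_of_re_pos hz hζ))]
    · have h5 : (z - ζ⁻¹) * (z + ζ⁻¹) = 0 := by
        have := h.2 (sub_eq_zero.1 h4)
        field_simp
        linear_combination this
      rw [sub_eq_zero.1 ((mul_eq_zero.1 h5).resolve_right
        (add_ne_zero_of_re_pos_of_re_pos hz (inv_re_pos hζ))), joukowski, joukowski, inv_inv,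
        add_comm]
  rw [← h3] at hr
  exact resonance_self_ne_zero (joukowski_mem_goodSet hz ha) hr

theorem tau_eq_of_sq_eq {n : ℕ} {x y : Fin n → ℂ} (h : ∀ i, x i ^ 2 = y i ^ 2) :
    tau x = tau y := by
  rw [tau, tau]
  congr 1
  exact funext h

/-- Only squares enter τ, so ζ₁, ζ₂ and wq⁻¹ may be replaced by square roots with positive real
part, as the asymptotics in Y requires. -/
theorem ratio_eq_of_sq_eq {n : ℕ} {a b a' b' : ℂ} {x y : Fin n → ℂ} (ha : a ^ 2 = a' ^ 2)
    (hb : b ^ 2 = b' ^ 2) (h : ∀ i, x i ^ 2 = y i ^ 2) : ratio a b x = ratio a' b' y := by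
  rw [ratio, ratio, tau_eq_of_sq_eq h,
    tau_eq_of_sq_eq (x := Matrix.vecCons a x) (y := Matrix.vecCons a' y) (Fin.cases ha h),
    tau_eq_of_sq_eq (x := Matrix.vecCons b x) (y := Matrix.vecCons b' y) (Fin.cases hb h),
    tau_eq_of_sq_eq (x := Matrix.vecCons a (Matrix.vecCons b x))
      (y := Matrix.vecCons a' (Matrix.vecCons b' y)) (Fin.cases ha (Fin.cases hb h))]

/-! ### The two currents. -/

theorem coords_update_one {L : ℕ} (j : Fin L) (t : ℂ) :
    coords (Function.update (fun _ : Fin L => (1 : ℂ)) j t) =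
      t ::ₘ Multiset.replicate (L - 1) 1 := by
  have h := coords_update (fun _ : Fin L => (1 : ℂ)) j t
  obtain ⟨k, rfl⟩ : ∃ k, L = k + 1 := ⟨L - 1, by have := j.isLt; omega⟩
  rw [coords_const, Multiset.replicate_succ, Multiset.cons_swap, ← Multiset.singleton_add 1,
    add_comm] at h
  exact add_left_cancel h

theorem coords_append2_one (L : ℕ) (a b : ℂ) :
    coords (append2 (fun _ : Fin L => (1 : ℂ)) a b) = b ::ₘ a ::ₘ Multiset.replicate L 1 := by
  rw [append2, coords_snoc, coords_snoc, coords_const]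

theorem eventually_norm_sub_div_le {g : ℕ → ℂ} {K : ℂ}
    (h : Tendsto (fun L : ℕ => (L : ℂ) * g L) atTop (𝓝 K)) {ε : ℝ} (hε : 0 < ε) :
    ∀ᶠ L : ℕ in atTop, ‖g L - K / L‖ ≤ ε / L := by
  filter_upwards [Metric.tendsto_nhds.1 h ε hε, eventually_gt_atTop 0] with L hL hL0
  have h0 : (L : ℂ) ≠ 0 := by exact_mod_cast hL0.ne'
  have e : g L - K / L = (L * g L - K) / L := by field_simp
  rw [dist_eq_norm] at hL
  rw [e, norm_div, Complex.norm_natCast]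
  gcongr

theorem tendsto_current {s : ℕ} {d : ℕ → ℂ} {K : ℂ}
    (h : Tendsto (fun m : ℕ => ((m : ℂ) + 1) * ((-1) ^ (m + s + 1) * d m)) atTop (𝓝 (K / 2))) :
    Tendsto (fun m : ℕ => ((m : ℂ) + 1) * ((-1) ^ (m + s + 1) *
      (Complex.I * (Real.sqrt 3 / 2)) * d m)) atTop (𝓝 (Complex.I * Real.sqrt 3 / 4 * K)) := by
  have h1 := h.mul_const (Complex.I * (Real.sqrt 3 / 2))
  rw [show K / 2 * (Complex.I * (Real.sqrt 3 / 2)) = Complex.I * Real.sqrt 3 / 4 * K by ring] at h1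
  refine h1.congr fun m => ?_
  ring

theorem horizontalCurrent_asymptotics {ζ₁ ζ₂ z : ℂ} (hz : 0 < z.re) (haz : Admissible (z ^ 2))
    (ha1 : Admissible (ζ₁ ^ 2)) (ha2 : Admissible (ζ₂ ^ 2))
    (hz1 : NonResonant (z ^ 2) (ζ₁ ^ 2)) (hz2 : NonResonant (z ^ 2) (ζ₂ ^ 2))
    (h12 : NonResonant (ζ₁ ^ 2) (ζ₂ ^ 2)) :
    (∀ᶠ L : ℕ in atTop, ∀ j : Fin L,
      AnalyticAt ℂ (fun t => ratio ζ₁ ζ₂ (Function.update (fun _ : Fin L => (1 : ℂ)) j t)) z ∧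
      ratio ζ₁ ζ₂ (Function.update (fun _ : Fin L => (1 : ℂ)) j z) ≠ 0) ∧
    ∀ ε : ℝ, 0 < ε → ∀ᶠ L : ℕ in atTop, ∀ j : Fin L,
      ‖horizontalCurrent ζ₁ ζ₂ (Function.update (fun _ : Fin L => (1 : ℂ)) j z) j
        - Complex.I * (Real.sqrt 3 : ℂ) / (4 * (L : ℂ)) * (z ^ 3 - (z ^ 3)⁻¹)‖ ≤ ε / (L : ℝ) := by
  obtain ⟨a, hsa, ha⟩ := exists_sq_eq_of_mem_slitPlane ha1.1
  obtain ⟨b, hsb, hb⟩ := exists_sq_eq_of_mem_slitPlane ha2.1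
  rw [← hsa] at ha1 hz1 h12
  rw [← hsb] at ha2 hz2 h12
  have hratio : ∀ (L : ℕ) (x : Fin L → ℂ), ratio ζ₁ ζ₂ x = ratio a b x := fun L x =>
    ratio_eq_of_sq_eq hsa.symm hsb.symm fun _ => rfl
  have hreg : Regular (Matrix.vecCons (joukowski z) (Matrix.vecCons (joukowski a)
      (Matrix.vecCons (joukowski b) fun i => joukowski ((![] : Fin 0 → ℂ) i)))) := by
    simp only [regular_vecCons, Fin.forall_fin_succ, IsEmpty.forall_iff, Matrix.cons_val_zero,
      Matrix.cons_val_succ, and_true, true_and]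
    exact ⟨joukowski_mem_goodSet hz haz, ⟨resonance_joukowski_ne_zero hz ha haz hz1,
      resonance_joukowski_ne_zero hz hb haz hz2⟩, joukowski_mem_goodSet ha ha1,
      resonance_joukowski_ne_zero ha hb ha1 h12, joukowski_mem_goodSet hb ha2,
      regular_of_isEmpty _⟩
  obtain ⟨d, hd, hev⟩ := logDeriv_ratio (ne_zero_of_re_pos ha) (ne_zero_of_re_pos hb)
    (ne_zero_of_re_pos hz) (fun i => i.elim0) hreg
  have hev' := (tendsto_sub_atTop_nat 1).eventually hev
  have hcoords : ∀ {L : ℕ} (j : Fin L) (t : ℂ),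
      coords (Function.update (fun _ : Fin L => (1 : ℂ)) j t) =
        t ::ₘ (Multiset.replicate (L - 1) 1 + coords (![] : Fin 0 → ℂ)) := by
    intro L j t
    rw [coords_update_one]
    simp [coords]
  refine ⟨?_, fun ε hε => ?_⟩
  · filter_upwards [hev'] with L hL j
    obtain ⟨h1, h2, -⟩ := hL _ (hcoords j)
    simp only [hratio]
    exact ⟨h1, h2⟩
  · have hlim : Tendsto (fun L : ℕ => (L : ℂ) * ((-1) ^ L *
        (Complex.I * (Real.sqrt 3 / 2)) * (z * d (L - 1)))) atTop
        (𝓝 (Complex.I * Real.sqrt 3 / 4 * (z ^ 3 - (z ^ 3)⁻¹))) := by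
      have h1 := tendsto_current (s := 0) (d := fun m => z * d m) hd
      -- Here s = 0 and m = L - 1, so m + s + 1 = L is the exponent of the sign and m + 1 = L the
      -- normalization.
      refine (h1.comp (tendsto_sub_atTop_nat 1)).congr' ?_
      filter_upwards [eventually_gt_atTop 0] with L hL
      obtain ⟨k, rfl⟩ : ∃ k, L = k + 1 := ⟨L - 1, by omega⟩
      simp
    filter_upwards [hev', eventually_norm_sub_div_le hlim hε] with L hL hle j
    obtain ⟨-, -, h3⟩ := hL _ (hcoords j)
    have e : horizontalCurrent ζ₁ ζ₂ (Function.update (fun _ : Fin L => (1 : ℂ)) j z) j =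
        (-1) ^ L * (Complex.I * (Real.sqrt 3 / 2)) * (z * d (L - 1)) := by
      simp only [horizontalCurrent, Function.update_self, Function.update_idem, hratio, h3]
      ring
    rw [e]
    convert hle using 3
    rw [mul_div_assoc, div_mul_eq_div_div]
    ring

theorem verticalCurrent_asymptotics {ζ₁ ζ₂ q w : ℂ} (hw : 0 < w.re) (haw : Admissible (w ^ 2))
    (hav : Admissible ((w * q⁻¹) ^ 2)) (ha1 : Admissible (ζ₁ ^ 2)) (ha2 : Admissible (ζ₂ ^ 2))
    (hwv : NonResonant (w ^ 2) ((w * q⁻¹) ^ 2))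
    (hw1 : NonResonant (w ^ 2) (ζ₁ ^ 2)) (hw2 : NonResonant (w ^ 2) (ζ₂ ^ 2))
    (hv1 : NonResonant ((w * q⁻¹) ^ 2) (ζ₁ ^ 2)) (hv2 : NonResonant ((w * q⁻¹) ^ 2) (ζ₂ ^ 2))
    (h12 : NonResonant (ζ₁ ^ 2) (ζ₂ ^ 2)) :
    (∀ᶠ L : ℕ in atTop,
      AnalyticAt ℂ (fun t => ratio ζ₁ ζ₂ (append2 (fun _ : Fin L => (1 : ℂ)) (w * q⁻¹) t)) w ∧
      ratio ζ₁ ζ₂ (append2 (fun _ : Fin L => (1 : ℂ)) (w * q⁻¹) w) ≠ 0) ∧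
    (fun L : ℕ => verticalCurrent ζ₁ ζ₂ q (fun _ : Fin L => (1 : ℂ)) w
      - Complex.I * (Real.sqrt 3 : ℂ) / (4 * (L : ℂ)) * (w ^ 3 - (w ^ 3)⁻¹))
      =o[atTop] (fun L : ℕ => 1 / (L : ℝ)) := by
  obtain ⟨a, hsa, ha⟩ := exists_sq_eq_of_mem_slitPlane ha1.1
  obtain ⟨b, hsb, hb⟩ := exists_sq_eq_of_mem_slitPlane ha2.1
  obtain ⟨v, hsv, hv⟩ := exists_sq_eq_of_mem_slitPlane hav.1
  rw [← hsa] at ha1 hw1 hv1 h12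
  rw [← hsb] at ha2 hw2 hv2 h12
  rw [← hsv] at hav hwv hv1 hv2
  have hratio : ∀ (L : ℕ) (t : ℂ), ratio ζ₁ ζ₂ (append2 (fun _ : Fin L => (1 : ℂ)) (w * q⁻¹) t) =
      ratio a b (append2 (fun _ : Fin L => (1 : ℂ)) v t) := by
    intro L t
    refine ratio_eq_of_sq_eq hsa.symm hsb.symm (Fin.lastCases ?_ (Fin.lastCases ?_ fun i => ?_))
    · simp [append2]
    · simp [append2, hsv]
    · simp [append2]
  have hreg : Regular (Matrix.vecCons (joukowski w) (Matrix.vecCons (joukowski a)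
      (Matrix.vecCons (joukowski b) fun i => joukowski ((![v] : Fin 1 → ℂ) i)))) := by
    rw [comp_vecCons]
    simp only [regular_vecCons, Fin.forall_fin_succ, IsEmpty.forall_iff, Matrix.cons_val_zero,
      Matrix.cons_val_succ, and_true, true_and]
    refine ⟨joukowski_mem_goodSet hw haw, ⟨resonance_joukowski_ne_zero hw ha haw hw1,
      resonance_joukowski_ne_zero hw hb haw hw2, resonance_joukowski_ne_zero hw hv haw hwv⟩,
      joukowski_mem_goodSet ha ha1, ⟨resonance_joukowski_ne_zero ha hb ha1 h12, ?_⟩,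
      joukowski_mem_goodSet hb ha2, ?_, joukowski_mem_goodSet hv hav,
      regular_of_isEmpty _⟩
    · rw [resonance_comm]
      exact resonance_joukowski_ne_zero hv ha hav hv1
    · rw [resonance_comm]
      exact resonance_joukowski_ne_zero hv hb hav hv2
  obtain ⟨d, hd, hev⟩ := logDeriv_ratio (ne_zero_of_re_pos ha) (ne_zero_of_re_pos hb)
    (ne_zero_of_re_pos hw) (Fin.cases (ne_zero_of_re_pos hv) fun i => i.elim0) hreg
  have hcoords : ∀ (L : ℕ) (t : ℂ), coords (append2 (fun _ : Fin L => (1 : ℂ)) v t) =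
      t ::ₘ (Multiset.replicate L 1 + coords (![v] : Fin 1 → ℂ)) := by
    intro L t
    rw [coords_append2_one, coords_vecCons, Multiset.add_cons]
    simp [coords]
  refine ⟨?_, Asymptotics.isLittleO_iff.2 fun ε hε => ?_⟩
  · filter_upwards [hev] with L hL
    obtain ⟨h1, h2, -⟩ := hL _ (hcoords L)
    simp only [hratio]
    exact ⟨h1, h2⟩
  · have hlim : Tendsto (fun L : ℕ => (L : ℂ) * ((-1) ^ (L + 2) *
        (Complex.I * (Real.sqrt 3 / 2)) * (w * d L))) atTop
        (𝓝 (Complex.I * Real.sqrt 3 / 4 * (w ^ 3 - (w ^ 3)⁻¹))) := by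
      -- Here s = 1 and m = L: the sign exponent m + s + 1 is L + 2, and the factor L/(L + 1)
      -- changes the normalization from m + 1 to L.
      have h1 := (tendsto_natCast_div_add_atTop (𝕜 := ℂ) 1).mul (tendsto_current (s := 1) (d := fun m => w * d m) hd)
      rw [one_mul] at h1
      refine h1.congr fun L => ?_
      have h0 : (L : ℂ) + 1 ≠ 0 := by exact_mod_cast Nat.succ_ne_zero L
      field_simp
    filter_upwards [hev, eventually_norm_sub_div_le hlim hε] with L hL hle
    obtain ⟨-, -, h3⟩ := hL _ (hcoords L)
    have e : verticalCurrent ζ₁ ζ₂ q (fun _ : Fin L => (1 : ℂ)) w =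
        (-1) ^ (L + 2) * (Complex.I * (Real.sqrt 3 / 2)) * (w * d L) := by
      simp only [verticalCurrent, hratio, h3]
      ring
    rw [e, norm_div, norm_one, RCLike.norm_natCast, mul_one_div]
    convert hle using 3
    rw [mul_div_assoc, div_mul_eq_div_div]
    ring

end DenseLoop

end

theorem theorem5p12 :
    -- the currents `X_L^{(j)}` at `z_j = z`, `z_i = 1` for `i ≠ j`
    (∀ ζ₁ ζ₂ z : ℂ, 0 < z.re →
      DenseLoop.Admissible (z ^ 2) → DenseLoop.Admissible (ζ₁ ^ 2) →
      DenseLoop.Admissible (ζ₂ ^ 2) →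
      DenseLoop.NonResonant (z ^ 2) (ζ₁ ^ 2) → DenseLoop.NonResonant (z ^ 2) (ζ₂ ^ 2) →
      DenseLoop.NonResonant (ζ₁ ^ 2) (ζ₂ ^ 2) →
      -- the logarithm has holomorphic branches at the point
      (∀ᶠ L : ℕ in Filter.atTop, ∀ j : Fin L,
        AnalyticAt ℂ (fun t => DenseLoop.ratio ζ₁ ζ₂
          (Function.update (fun _ : Fin L => (1 : ℂ)) j t)) z ∧
        DenseLoop.ratio ζ₁ ζ₂ (Function.update (fun _ : Fin L => (1 : ℂ)) j z) ≠ 0) ∧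
      (∀ ε : ℝ, 0 < ε → ∀ᶠ L : ℕ in Filter.atTop, ∀ j : Fin L,
        ‖DenseLoop.horizontalCurrent ζ₁ ζ₂ (Function.update (fun _ : Fin L => (1 : ℂ)) j z) j
          - Complex.I * (Real.sqrt 3 : ℂ) / (4 * (L : ℂ)) * (z ^ 3 - (z ^ 3)⁻¹)‖
          ≤ ε / (L : ℝ))) ∧
    -- the currents `Y_L` at `z_1 = ... = z_L = 1`
    (∀ ζ₁ ζ₂ q w : ℂ, 0 < w.re →
      DenseLoop.Admissible (w ^ 2) → DenseLoop.Admissible ((w * q⁻¹) ^ 2) →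
      DenseLoop.Admissible (ζ₁ ^ 2) → DenseLoop.Admissible (ζ₂ ^ 2) →
      DenseLoop.NonResonant (w ^ 2) ((w * q⁻¹) ^ 2) →
      DenseLoop.NonResonant (w ^ 2) (ζ₁ ^ 2) → DenseLoop.NonResonant (w ^ 2) (ζ₂ ^ 2) →
      DenseLoop.NonResonant ((w * q⁻¹) ^ 2) (ζ₁ ^ 2) →
      DenseLoop.NonResonant ((w * q⁻¹) ^ 2) (ζ₂ ^ 2) →
      DenseLoop.NonResonant (ζ₁ ^ 2) (ζ₂ ^ 2) →
      (∀ᶠ L : ℕ in Filter.atTop,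
        AnalyticAt ℂ (fun t => DenseLoop.ratio ζ₁ ζ₂
          (DenseLoop.append2 (fun _ : Fin L => (1 : ℂ)) (w * q⁻¹) t)) w ∧
        DenseLoop.ratio ζ₁ ζ₂
          (DenseLoop.append2 (fun _ : Fin L => (1 : ℂ)) (w * q⁻¹) w) ≠ 0) ∧
      (fun L : ℕ => DenseLoop.verticalCurrent ζ₁ ζ₂ q (fun _ : Fin L => (1 : ℂ)) w
          - Complex.I * (Real.sqrt 3 : ℂ) / (4 * (L : ℂ)) * (w ^ 3 - (w ^ 3)⁻¹))
        =o[Filter.atTop] (fun L : ℕ => 1 / (L : ℝ))) := 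
  ⟨fun _ _ _ hz haz ha1 ha2 hz1 hz2 h12 =>
      DenseLoop.horizontalCurrent_asymptotics hz haz ha1 ha2 hz1 hz2 h12,
    fun _ _ _ _ hw haw hav ha1 ha2 hwv hw1 hw2 hv1 hv2 h12 =>
      DenseLoop.verticalCurrent_asymptotics hw haw hav ha1 ha2 hwv hw1 hw2 hv1 hv2 h12⟩
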